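/- Let $\bar{\mathbb R}=\mathbb R\cup\{+\infty\}$ and let $\Theta$ be a probability measure on $\bar{\mathbb R}^{\mathbb N^*}$ (an offspring law; $x_i=+\infty$ means that the $i$-th child does not exist, and $e^{-\infty}=0$, $\infty\cdot e^{-\infty}=\infty^2 e^{-\infty}=0$). Assume the boundary case with finite variance: $$\int \sum_{i} e^{-x_i}\,d\Theta=1,\qquad \int \sum_i x_ie^{-x_i}\,d\Theta=0,\qquad \sigma^2=\int \sum_i x_i^2e^{-x_i}\,d\Theta\in(0,\infty).$$ For $x\in\mathbb R$ let $\mathbb P^*_x$ be the law of the spinal branching random walk $((X_u)_{u\in\mathcal U},(\xi_n)_{n\ge0})$ started at $x$, where $\mathcal U=\bigcup_{n\ge0}(\mathbb N^*)^n$: the root $\xi_0=\varnothing$ has position $X_{\varnothing}=x$; given generation $n$, the particles $u\neq\xi_n$ of generation $n$ have children at positions $X_{ui}=X_u+x_i$ with $(x_i)_{i\ge1}$ of law $\Theta$, while for $\xi_n$ the vector $(x_i)_{i\ge1}$ has the size-biased law $\Theta^*$ with $d\Theta^*/d\Theta=\sum_ie^{-x_i}$, all these vectors being independent; and then $\xi_{n+1}=\xi_ni$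 with conditional probability $e^{-x_i}/\sum_je^{-x_j}$, where $(x_j)_j$ is the vector used at $\xi_n$. Non-existing particles have position $+\infty$. Let $\mathcal F_n=\sigma(X_u,\,|u|\le n;\ \xi_k,\,k\le n)$ and $\mathcal F_\infty=\bigvee_n\mathcal F_n$, and let $$R(y)=\sum_{n\ge0}\mathbb P^*_0\Big(X_{\xi_n}\ge -y,\ X_{\xi_n}<X_{\xi_k}\ \text{for all } 0\le k<n\Big)$$ be the renewal function of the strictly descending ladder heights of $(X_{\xi_n})_{n\ge0}$. Let $x\ge0$. There is exactly one probability measure $\mathbb P^+_x$ on $\mathcal F_\infty$ such that for every $n\ge0$ $$\frac{d\mathbb P^+_x}{d\mathbb P^*_x}\Big|_{\mathcal F_n}=\frac{R(X_{\xi_n})}{R(x)}\,\mathbf 1_{\{\min_{k\le n}X_{\xi_k}\ge0\}} .$$ Let $(Y_n)_{n\ge0}$ be a sequence of real random variables, adapted to $(\mathcal F_n)_{n\ge0}$ and uniformly bounded (for some constant $C$, $|Y_n|\le C$ holds $\mathbb P^*_x$-almost surely for every $n$), and let $Y_\infty$ be a random variable such that $Y_n\to Y_\infty$ in probability under $\mathbb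 P^+_x$. Then $$\lim_{n\to\infty}\mathbb E^*_x\Big[Y_n\,\Big|\,\min_{k\le n}X_{\xi_k}\ge0\Big]=\mathbb E^+_x[Y_\infty].$$ -/

import Mathlib

open MeasureTheory ProbabilityTheory Filter Topology
open scoped ENNReal

noncomputable section

namespace SpinalBRW

/-- Vertices of the Ulam–Harris tree, as finite words. A word is stored with its last letter first:
the root is `[]` and the `i`-th child of `u` is `i :: u`. The generation of `u` is `u.length`.
The alphabet is indexed by `ℕ` instead of `{1, 2, …}`. -/
abbrev Vertex : Type := List ℕ

instance : MeasurableSpace Vertex := ⊤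

instance : DiscreteMeasurableSpace Vertex := ⟨fun _ => trivial⟩

/-- Vectors of displacements of the children of a particle; `⊤ = +∞` at index `i` means that the
`i`-th child does not exist. -/
abbrev Offspring : Type := ℕ → WithTop ℝ

/-- `e^{-y}`, with `e^{-∞} = 0`. -/
def expNeg (y : WithTop ℝ) : ℝ := if y = ⊤ then 0 else Real.exp (-(y.untopD 0))

/-- `∑_i e^{-x_i}`, the sum being over the existing children. -/
def weight (v : Offspring) : ℝ≥0∞ := ∑' i, ENNReal.ofReal (expNeg (v i))

/-- The standing assumptions on the offspring law `Θ`: boundary case, and `σ² ∈ (0, ∞)`.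
Terms with `v i = ⊤` vanish because of the factor `expNeg (v i)`. -/
structure BoundaryCase (Θ : Measure Offspring) : Prop where
  normalized : ∫⁻ v, weight v ∂Θ = 1
  centered : ∫ v, ∑' i, (v i).untopD 0 * expNeg (v i) ∂Θ = 0
  variance_pos : 0 < ∫⁻ v, ∑' i, ENNReal.ofReal ((v i).untopD 0 ^ 2 * expNeg (v i)) ∂Θ
  variance_lt_top : ∫⁻ v, ∑' i, ENNReal.ofReal ((v i).untopD 0 ^ 2 * expNeg (v i)) ∂Θ < ∞

/-- The size-biased reproduction law `Θ*`. -/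
def sizeBiased (Θ : Measure Offspring) : Measure Offspring := Θ.withDensity weight

/-- Reproduction of a spine particle together with the choice of the next spine particle: the
displacement vector `v` has law `Θ*`, and given `v` the index `i` is chosen with probability
`e^{-v_i} / ∑_j e^{-v_j}`. -/
def spineStep (Θ : Measure Offspring) : Measure (Offspring × ℕ) :=
  ((sizeBiased Θ).prod Measure.count).withDensity
    (fun p => ENNReal.ofReal (expNeg (p.1 p.2)) / weight p.1)

/-- Independent inputs of the spinal branching random walk: a displacement vector for each vertex
(used if the vertex is off the spine), and for each generation the displacement vector of the spine
particle together with the index of its child on the spine. -/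
abbrev Input : Type := (Vertex → Offspring) × (ℕ → Offspring × ℕ)

/-- Off-spine vectors are i.i.d. with law `Θ`, spine steps are i.i.d. with law `spineStep Θ`. -/
def inputLaw (Θ : Measure Offspring) : Measure Input :=
  (Measure.infinitePi fun _ : Vertex => Θ).prod (Measure.infinitePi fun _ : ℕ => spineStep Θ)

/-- The spine `ξ_n`. -/
def spineOf (a : Input) : ℕ → Vertex
  | 0 => []
  | n + 1 => (a.2 n).2 :: spineOf a n

/-- The positions `X_u` of the particles when the root sits at `x`. -/
def positionOf (x : ℝ) (a : Input) : Vertex → WithTop ℝ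
  | [] => (x : WithTop ℝ)
  | i :: u => positionOf x a u +
      (if u = spineOf a u.length then (a.2 u.length).1 i else a.1 u i)

/-- The canonical space of branching random walks with a spine: positions `(X_u)_u` and spine
`(ξ_n)_n`. -/
abbrev Path : Type := (Vertex → WithTop ℝ) × (ℕ → Vertex)

/-- The law `P*_x` of the spinal branching random walk started at `x`. -/
def starLaw (Θ : Measure Offspring) (x : ℝ) : Measure Path :=
  (inputLaw Θ).map fun a => (positionOf x a, spineOf a)

/-- The position `X_{ξ_n}` of the spine at generation `n`. -/
def spinePos (n : ℕ) (ω : Path) : WithTop ℝ := ω.1 (ω.2 n)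

/-- The event `min_{k ≤ n} X_{ξ_k} ≥ 0`. -/
def stayNonneg (n : ℕ) : Set Path := {ω | ∀ k ≤ n, 0 ≤ spinePos k ω}

/-- The filtration `F_n` generated by the positions and the spine up to generation `n`. -/
def canonicalFiltration : Filtration ℕ (inferInstance : MeasurableSpace Path) where
  seq n :=
    (⨆ u : Vertex, ⨆ _ : u.length ≤ n,
      MeasurableSpace.comap (fun ω : Path => ω.1 u) inferInstance) ⊔
    (⨆ k : ℕ, ⨆ _ : k ≤ n, MeasurableSpace.comap (fun ω : Path => ω.2 k) inferInstance)
  mono' _ _ hmn := sup_le_sup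
    (iSup_mono fun _ => iSup_mono' fun h => ⟨h.trans hmn, le_rfl⟩)
    (iSup_mono fun _ => iSup_mono' fun h => ⟨h.trans hmn, le_rfl⟩)
  le' _ := sup_le
    (iSup₂_le fun u _ => ((measurable_pi_apply u).comp measurable_fst).comap_le)
    (iSup₂_le fun k _ => ((measurable_pi_apply k).comp measurable_snd).comap_le)

/-- The renewal function of the strictly descending ladder heights of the spine,
`R(y) = ∑_{n ≥ 0} P*_0(X_{ξ_n} ≥ -y, X_{ξ_n} < X_{ξ_k} for all k < n)`. -/
def renewal (Θ : Measure Offspring) (y : ℝ) : ℝ≥0∞ :=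
  ∑' n : ℕ, starLaw Θ 0
    {ω | ((-y : ℝ) : WithTop ℝ) ≤ spinePos n ω ∧ ∀ k < n, spinePos n ω < spinePos k ω}

/-- `P` is the law `P⁺_x`: a probability measure whose density with respect to `P*_x` on `F_n` is
`R(X_{ξ_n}) 1_{min_{k ≤ n} X_{ξ_k} ≥ 0} / R(x)`, for every `n`. (The spine position is
`P*_x`-almost surely finite, so the value of `R` at `+∞` plays no role.) -/
structure IsPlusLaw (Θ : Measure Offspring) (x : ℝ) (P : Measure Path) : Prop where
  isProbabilityMeasure : IsProbabilityMeasure P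
  density : ∀ (n : ℕ) (A : Set Path), MeasurableSet[canonicalFiltration n] A →
    P A = ∫⁻ ω in A, (stayNonneg n).indicator
      (fun ω => renewal Θ ((spinePos n ω).untopD 0) / renewal Θ x) ω ∂(starLaw Θ x)

/-! The following facts check that the measures above are probability measures and that the
law `starLaw` is not the junk value of `Measure.map` at a non-measurable function. -/

lemma measurable_expNeg : Measurable expNeg :=
  Measurable.ite (measurableSet_singleton _) measurable_const
    (Real.measurable_exp.comp (WithTop.measurable_untopD 0).neg)

lemma measurable_weight : Measurable weight :=
  Measurable.tsum fun i =>
    (measurable_expNeg.comp (measurable_pi_apply i)).ennreal_ofReal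

lemma isProbabilityMeasure_spineStep (Θ : Measure Offspring) [IsProbabilityMeasure Θ]
    (h : BoundaryCase Θ) : IsProbabilityMeasure (spineStep Θ) := by
  have hw := measurable_weight
  have he : Measurable fun p : Offspring × ℕ => expNeg (p.1 p.2) :=
    measurable_from_prod_countable_left fun i =>
      measurable_expNeg.comp (measurable_pi_apply i)
  have : IsProbabilityMeasure (sizeBiased Θ) := ⟨by
    rw [sizeBiased, withDensity_apply _ MeasurableSet.univ, Measure.restrict_univ, h.normalized]⟩
  have hq : Measurable fun p : Offspring × ℕ =>
      ENNReal.ofReal (expNeg (p.1 p.2)) / weight p.1 :=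
    he.ennreal_ofReal.div (hw.comp measurable_fst)
  refine ⟨?_⟩
  rw [spineStep, withDensity_apply _ MeasurableSet.univ, Measure.restrict_univ,
    lintegral_prod _ hq.aemeasurable]
  have h1 : ∀ v : Offspring,
      ∫⁻ i : ℕ, ENNReal.ofReal (expNeg (v i)) / weight v ∂Measure.count = weight v / weight v := by
    intro v
    rw [lintegral_count]
    simp only [div_eq_mul_inv, ENNReal.tsum_mul_right]
    rfl
  simp only [h1]
  have hww : Measurable fun v => weight v / weight v := hw.div hw
  rw [sizeBiased, lintegral_withDensity_eq_lintegral_mul _ hw hww]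
  rw [← h.normalized]
  have hfin : ∀ᵐ v ∂Θ, weight v < ∞ :=
    ae_lt_top hw (by rw [h.normalized]; exact ENNReal.one_ne_top)
  refine lintegral_congr_ae (hfin.mono fun v hv => ?_)
  by_cases h0 : weight v = 0
  · simp [h0]
  · simp [ENNReal.div_self h0 hv.ne]

lemma measurable_withTop_add :
    Measurable fun p : WithTop ℝ × WithTop ℝ => p.1 + p.2 := by
  have : (fun p : WithTop ℝ × WithTop ℝ => p.1 + p.2) = fun p =>
      if p.1 = ⊤ ∨ p.2 = ⊤ then ⊤ else ((p.1.untopD 0 + p.2.untopD 0 : ℝ) : WithTop ℝ) := by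
    funext ⟨a, b⟩
    induction a <;> induction b <;> simp
  rw [this]
  refine Measurable.ite ?_ measurable_const ?_
  · exact (measurable_fst (measurableSet_singleton _)).union
      (measurable_snd (measurableSet_singleton _))
  · exact WithTop.measurable_coe.comp
      (((WithTop.measurable_untopD 0).comp measurable_fst).add
        ((WithTop.measurable_untopD 0).comp measurable_snd))

lemma measurable_spineOf (n : ℕ) : Measurable fun a : Input => spineOf a n := by
  induction n with
  | zero => exact measurable_const
  | succ n ih =>
    have h1 : Measurable fun a : Input => (a.2 n).2 :=
      measurable_snd.comp ((measurable_pi_apply n).comp measurable_snd)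
    exact (Measurable.of_discrete (f := fun p : ℕ × Vertex => p.1 :: p.2)).comp (h1.prodMk ih)

lemma measurable_positionOf (x : ℝ) (u : Vertex) :
    Measurable fun a : Input => positionOf x a u := by
  induction u with
  | nil => exact measurable_const
  | cons i u ih =>
    refine measurable_withTop_add.comp (ih.prodMk (Measurable.ite ?_ ?_ ?_))
    · have : {a : Input | u = spineOf a u.length} =
          (fun a : Input => spineOf a u.length) ⁻¹' {u} := by
        ext a; simp [eq_comm]
      rw [this]
      exact measurable_spineOf _ (measurableSet_singleton _)
    · exact (measurable_pi_apply i).comp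
        (measurable_fst.comp ((measurable_pi_apply u.length).comp measurable_snd))
    · exact (measurable_pi_apply i).comp ((measurable_pi_apply u).comp measurable_fst)

lemma isProbabilityMeasure_starLaw (Θ : Measure Offspring) [IsProbabilityMeasure Θ]
    (h : BoundaryCase Θ) (x : ℝ) : IsProbabilityMeasure (starLaw Θ x) := by
  have := isProbabilityMeasure_spineStep Θ h
  have : IsProbabilityMeasure (inputLaw Θ) := by unfold inputLaw; infer_instance
  exact Measure.isProbabilityMeasure_map
    ((measurable_pi_lambda _ (measurable_positionOf x)).prodMk
      (measurable_pi_lambda _ measurable_spineOf)).aemeasurable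

end SpinalBRW

end

/-! Under `starLaw` the spine positions S form a centered random walk with finite variance. Write
h_j(y) for `survival`, the probability that this walk started at y stays nonnegative up to time j.
By the Markov property, conditioning on survival up to time n + j weights the first n generations by
h_j(S_n)/h_{n+j}(x) on the event of survival up to n. This weight is compared with the density
R(S_n)/R(x) of P⁺ in two ways: it converges to it for fixed n as j → ∞
(`BoundaryCase.tendsto_stayDensity`), and it is at most a constant multiple of it as long as n ≤ q(j
+ 1) (`BoundaryCase.exists_stayDensity_le`).

The domination needs some room j after time n, while Y_n is conditioned at time n itself. So the
conditioning time n is first prolonged to n + n/q; for q large this changes conditional means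
little, because h_n(x) varies slowly (`CenteredLaw.exists_survival_slow`). At the later time,
domination allows Y_n to be replaced by Y_k with k fixed and large, at a cost of K·E⁺|Y_n - Y_k|,
which is small since bounded convergence in probability is convergence in L¹. The limit for a fixed
generation then concludes (`IsPlusLaw.tendsto_stayMean_of_tendstoInMeasure`).

The estimates on h come from fluctuation theory. In the convolution semiring of finite measures, the
Wiener–Hopf factorization yields Spitzer's identity in the form (n + 1) h_{n+1}(0) = ∑ p_{k+1}
h_{n-k}(0), with p_k the probability that the walk from 0 is nonnegative at time k. By the central
limit theorem p_k has a positive limit ρ, hence (n + 1) h_{n+1}(0) / (h_0(0) + ⋯ + h_n(0)) → ρ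
(`SpitzerSeq.tendsto_ratio`). Together with monotonicity this replaces sharp asymptotics of h.
Decomposing the walk at its minimum writes h(x) as the convolution of h(0) with a sequence of sum
R(x), so that h_n(x)/h_n(0) → R(x) (`SpitzerSeq.tendsto_conv_div`).

As for P⁺ itself: R is harmonic for the killed walk (`walkOp_renewalFn`), so the spine steps can be
given the transition law of a Doob transform while the off-spine vectors keep their law. Uniqueness
holds because the events of finite generations form a generating π-system. -/

namespace SpinalBRW

/-! ### Wiener–Hopf factorization and Spitzer's identity in a commutative semiring. -/

section Fluctuation

open Finset

variable {M : Type*} [CommSemiring M]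

/-- The powers of `f`, projected by `P` after each multiplication. If `f` is the law of the steps
of a random walk and `P` the restriction to a set, this is the law of the walk killed on leaving
that set. -/
def killedPow (P : M →+ M) (f : M) : ℕ → M
  | 0 => 1
  | n + 1 => P (killedPow P f n * f)

variable {P Q : M →+ M}

/-- A splitting of a semiring into two complementary parts closed under multiplication, the first
of which contains `1`. -/
structure IsSplitting (P Q : M →+ M) : Prop where
  add_eq : ∀ u, P u + Q u = u
  right_left : ∀ u, Q (P u) = 0
  left_right : ∀ u, P (Q u) = 0
  right_mul : ∀ u v, Q u = 0 → Q v = 0 → Q (u * v) = 0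
  left_mul : ∀ u v, P u = 0 → P v = 0 → P (u * v) = 0
  right_one : Q 1 = 0

lemma IsSplitting.right_killedPow (h : IsSplitting P Q) (f : M) (n : ℕ) : Q (killedPow P f n) = 0 := by
  cases n with
  | zero => exact h.right_one
  | succ n => exact h.right_left _

lemma IsSplitting.left_killedPow_succ (h : IsSplitting P Q) (f : M) (n : ℕ) : P (killedPow Q f (n + 1)) = 0 :=
  h.left_right _

/-- The power of index 0 is `1`, which belongs to the `P` part, so the powers killed by `Q` do not
all lie in the `Q` part; a factor `u` from that part repairs this. -/
lemma IsSplitting.left_mul_killedPow (h : IsSplitting P Q) (f : M) {u : M} (hu : P u = 0) (n : ℕ) :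
    P (u * killedPow Q f n) = 0 := by
  cases n with
  | zero => simpa [killedPow] using hu
  | succ n => exact h.left_mul _ _ hu (h.left_killedPow_succ f n)

/-- The Wiener–Hopf factorization. -/
theorem IsSplitting.sum_killedPow_mul_killedPow [IsCancelAdd M] (h : IsSplitting P Q) (f : M) (n : ℕ) :
    ∑ p ∈ antidiagonal n, killedPow P f p.1 * killedPow Q f p.2 = f ^ n := by
  induction n with
  | zero => simp [killedPow]
  | succ n ih =>
    rw [pow_succ, ← ih]
    set W := ∑ p ∈ antidiagonal n, killedPow P f p.1 * killedPow Q f p.2 with hW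
    set W' := ∑ p ∈ antidiagonal (n + 1), killedPow P f p.1 * killedPow Q f p.2 with hW'
    -- `W * f` and `W'` are compared twice, with terms moved across because there is no subtraction.
    -- The discrepancies in `e1` lie in the `P` part and vanish under `Q`; those in `e2` lie in the
    -- `Q` part and vanish under `P`. Hence the two components of `W * f` and `W'` agree.
    have e1 : W * f + killedPow P f (n + 1) =
        W' + ∑ p ∈ antidiagonal n, killedPow P f p.1 * P (killedPow Q f p.2 * f) := by
      rw [hW', Nat.sum_antidiagonal_succ', hW, sum_mul, add_assoc, ← sum_add_distrib, add_comm]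
      congr 1
      · simp [killedPow]
      · refine sum_congr rfl fun p _ => ?_
        rw [← mul_add, mul_assoc]
        congr 1
        rw [killedPow, add_comm, h.add_eq]
    have e2 : W * f + killedPow Q f (n + 1) =
        W' + ∑ p ∈ antidiagonal n, Q (killedPow P f p.1 * f) * killedPow Q f p.2 := by
      rw [hW', Nat.sum_antidiagonal_succ, hW, sum_mul, add_assoc, ← sum_add_distrib, add_comm]
      congr 1
      · simp [killedPow]
      · refine sum_congr rfl fun p _ => ?_
        rw [← add_mul, mul_right_comm]
        congr 1
        rw [killedPow, h.add_eq]
    have f1 := congrArg Q e1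
    have f2 := congrArg P e2
    rw [map_add, map_add, h.right_killedPow, 
      map_sum Q (fun p : ℕ × ℕ => killedPow P f p.1 * _) (antidiagonal n),
      sum_eq_zero fun p _ => h.right_mul _ _ (h.right_killedPow f _) (h.right_left _),
      add_zero, add_zero] at f1
    rw [map_add, map_add, h.left_killedPow_succ,
      map_sum P (fun p : ℕ × ℕ => _ * killedPow Q f p.2) (antidiagonal n),
      sum_eq_zero fun p _ => h.left_mul_killedPow f (h.left_right _) _,
      add_zero, add_zero] at f2
    rw [← h.add_eq W', ← h.add_eq (W * f), f1, f2]

/-- Since `B` has constant term 1, the coefficients of `A * B` and `A' * B` differ at the first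
index where `A` and `A'` may differ by exactly the difference of the coefficients there. The
additive form avoids subtraction. -/
lemma coeff_add_coeff_mul_eq {A A' B : PowerSeries M} (hB : PowerSeries.coeff 0 B = 1) (n : ℕ)
    (hA : ∀ k < n, PowerSeries.coeff k A = PowerSeries.coeff k A') :
    PowerSeries.coeff n A + PowerSeries.coeff n (A' * B) =
      PowerSeries.coeff n A' + PowerSeries.coeff n (A * B) := by
  cases n with
  | zero =>
    rw [PowerSeries.coeff_mul, PowerSeries.coeff_mul]
    simp only [Nat.antidiagonal_zero, sum_singleton, hB, mul_one]
    exact add_comm _ _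
  | succ n =>
    rw [PowerSeries.coeff_mul, PowerSeries.coeff_mul, Nat.sum_antidiagonal_succ',
      Nat.sum_antidiagonal_succ', hB, mul_one, mul_one]
    rw [← add_assoc, ← add_assoc, add_comm (PowerSeries.coeff (n + 1) A)]
    congr 1
    refine sum_congr rfl fun p hp => ?_
    rw [hA]
    have := mem_antidiagonal.1 hp
    omega

/-- Spitzer's identity, in differential form. -/
theorem IsSplitting.succ_mul_killedPow_succ [IsCancelAdd M] (h : IsSplitting P Q) (f : M) (n : ℕ) :
    (n + 1 : M) * killedPow P f (n + 1) =
      ∑ p ∈ antidiagonal n, P (f ^ (p.1 + 1)) * killedPow P f p.2 := by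
  set A := PowerSeries.mk (killedPow P f) with hA
  set B := PowerSeries.mk (killedPow Q f) with hB
  set U := PowerSeries.mk fun n => P (f ^ (n + 1)) with hU
  set V := PowerSeries.mk fun n => Q (f ^ (n + 1)) with hV
  set dA := PowerSeries.derivative M A with hdA
  set dB := PowerSeries.derivative M B with hdB
  have hAB : A * B = PowerSeries.mk fun n => f ^ n := by
    ext n
    rw [PowerSeries.coeff_mul, PowerSeries.coeff_mk, ← h.sum_killedPow_mul_killedPow f n]
    simp [hA, hB]
  have hUV : U + V = PowerSeries.mk fun n => f ^ (n + 1) := by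
    ext n
    simp [hU, hV, h.add_eq]
  -- `A * B` is the geometric series 1/(1 - fX), whose logarithmic derivative f/(1 - fX) is `U + V`.
  have hd : PowerSeries.derivative M (A * B) = (U + V) * (A * B) := by
    rw [hAB, hUV]
    ext n
    rw [PowerSeries.coeff_derivative, PowerSeries.coeff_mul, PowerSeries.coeff_mk]
    rw [sum_congr rfl fun p hp => show _ = f ^ (n + 1) from by
      rw [PowerSeries.coeff_mk, PowerSeries.coeff_mk, ← pow_add, ← mem_antidiagonal.1 hp]
      congr 1; ring]
    simp [mul_comm]
  have hprod : dA * B + dB * A = U * A * B + V * B * A := by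
    have : PowerSeries.derivative M (A * B) = dA * B + dB * A := by
      rw [Derivation.leibniz, smul_eq_mul, smul_eq_mul, add_comm, mul_comm A, mul_comm B]
    rw [← this, hd]; ring
  have hA0 : PowerSeries.coeff 0 A = 1 := by simp [hA, killedPow]
  have hB0 : PowerSeries.coeff 0 B = 1 := by simp [hB, killedPow]
  have hcA : ∀ n, PowerSeries.coeff n dA = (n + 1 : M) * killedPow P f (n + 1) := fun n => by
    rw [hdA, PowerSeries.coeff_derivative, hA, PowerSeries.coeff_mk, mul_comm]
  have hcB : ∀ n, PowerSeries.coeff n dB = (n + 1 : M) * killedPow Q f (n + 1) := fun n => by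
    rw [hdB, PowerSeries.coeff_derivative, hB, PowerSeries.coeff_mk, mul_comm]
  have hcUA : ∀ n, PowerSeries.coeff n (U * A) =
      ∑ p ∈ antidiagonal n, P (f ^ (p.1 + 1)) * killedPow P f p.2 := fun n => by
    simp [PowerSeries.coeff_mul, hU, hA]
  have hcVB : ∀ n, PowerSeries.coeff n (V * B) =
      ∑ p ∈ antidiagonal n, Q (f ^ (p.1 + 1)) * killedPow Q f p.2 := fun n => by
    simp [PowerSeries.coeff_mul, hV, hB]
  have hnat : ∀ (T : M →+ M) (n : ℕ) (u : M), T u = 0 → T ((n + 1 : M) * u) = 0 := by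
    intro T n u hu
    rw [← Nat.cast_succ, ← nsmul_eq_mul, map_nsmul, hu, nsmul_zero]
  -- Formally A'/A - U = -(B'/B - V), with the left side in the `P` part and the right side in the
  -- `Q` part, so both vanish. Without inverses or differences the argument runs coefficient by
  -- coefficient.
  have key : ∀ n, PowerSeries.coeff n dA = PowerSeries.coeff n (U * A) ∧
      PowerSeries.coeff n dB = PowerSeries.coeff n (V * B) := by
    intro n
    induction n using Nat.strong_induction_on with
    | _ n ih =>
      have e1 := coeff_add_coeff_mul_eq hB0 n fun k hk => (ih k hk).1
      have e2 := coeff_add_coeff_mul_eq hA0 n fun k hk => (ih k hk).2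
      have e3 := congrArg (PowerSeries.coeff n) hprod
      rw [map_add, map_add] at e3
      have e4 : PowerSeries.coeff n dA + PowerSeries.coeff n dB =
          PowerSeries.coeff n (U * A) + PowerSeries.coeff n (V * B) := by
        refine add_right_cancel (b := PowerSeries.coeff n (U * A * B) +
          PowerSeries.coeff n (V * B * A)) ?_
        rw [add_add_add_comm, e1, e2, add_add_add_comm, e3]
      have q1 : Q (PowerSeries.coeff n dA) = 0 := by
        rw [hcA]; exact hnat _ _ _ (h.right_killedPow f _)
      have q2 : P (PowerSeries.coeff n dB) = 0 := by
        rw [hcB]; exact hnat _ _ _ (h.left_killedPow_succ f _)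
      have q3 : Q (PowerSeries.coeff n (U * A)) = 0 := by
        rw [hcUA, map_sum]
        exact sum_eq_zero fun p _ => h.right_mul _ _ (h.right_left _) (h.right_killedPow f _)
      have q4 : P (PowerSeries.coeff n (V * B)) = 0 := by
        rw [hcVB, map_sum]
        exact sum_eq_zero fun p _ => h.left_mul_killedPow f (h.left_right _) _
      have hp := congrArg P e4
      have hq := congrArg Q e4
      rw [map_add, map_add, q2, q4, add_zero, add_zero] at hp
      rw [map_add, map_add, q1, q3, zero_add, zero_add] at hq
      constructor
      · rw [← h.add_eq (PowerSeries.coeff n dA), ← h.add_eq (PowerSeries.coeff n (U * A)),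
          q1, q3, hp]
      · rw [← h.add_eq (PowerSeries.coeff n dB), ← h.add_eq (PowerSeries.coeff n (V * B)),
          q2, q4, hq]
  rw [← hcA, (key n).1, hcUA]

end Fluctuation

end SpinalBRW

namespace SpinalBRW

/-! ### Asymptotics of sequences that satisfy Spitzer's recursion. -/

section Sequences

open Finset

/-- Partial sums `h 0 + ⋯ + h n`. -/
def partialSum (h : ℕ → ℝ) (n : ℕ) : ℝ := ∑ k ∈ range (n + 1), h k

lemma partialSum_succ (h : ℕ → ℝ) (n : ℕ) : partialSum h (n + 1) = partialSum h n + h (n + 1) :=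
  sum_range_succ _ _

lemma partialSum_mono {h : ℕ → ℝ} (h0 : ∀ n, 0 ≤ h n) : Monotone (partialSum h) :=
  monotone_nat_of_le_succ fun n => by rw [partialSum_succ]; linarith [h0 (n + 1)]

lemma succ_mul_le_partialSum {h : ℕ → ℝ} (anti : Antitone h) (n : ℕ) :
    (n + 1) * h n ≤ partialSum h n := by
  have := card_nsmul_le_sum (range (n + 1)) h (h n) fun k hk =>
    anti (Nat.lt_succ_iff.1 (mem_range.1 hk))
  simpa [partialSum] using this

/-- Differential form of `∑ h n s ^ n = exp (∑ p k s ^ k / k)`, with `p` converging to a positive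
limit and `h` nonincreasing. -/
structure SpitzerSeq (h p : ℕ → ℝ) (ρ : ℝ) : Prop where
  zero : h 0 = 1
  anti : Antitone h
  nonneg : ∀ n, 0 ≤ h n
  p_nonneg : ∀ n, 0 ≤ p n
  p_le_one : ∀ n, p n ≤ 1
  rec_eq : ∀ n : ℕ, (n + 1) * h (n + 1) = ∑ q ∈ antidiagonal n, p (q.1 + 1) * h q.2
  tendsto : Tendsto p atTop (𝓝 ρ)
  pos : 0 < ρ

namespace SpitzerSeq

variable {h p : ℕ → ℝ} {ρ : ℝ}

lemma one_le_partialSum (hs : SpitzerSeq h p ρ) (n : ℕ) : 1 ≤ partialSum h n := by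
  have := partialSum_mono hs.nonneg (Nat.zero_le n)
  simpa [partialSum, hs.zero] using this

/-- In the recursion, `p` is evaluated before index `K` only for the last few values of `k`. There
are at most `K` of them, and monotonicity bounds each such `h k` by `partialSum h n / (n + 1 - K)`.
-/
lemma abs_succ_mul_sub_le (hs : SpitzerSeq h p ρ) {ε : ℝ} (K n : ℕ) (hKn : K ≤ n)
    (hK : ∀ j ≥ K, |p j - ρ| ≤ ε) :
    |(n + 1) * h (n + 1) - ρ * partialSum h n| ≤
      (ε + (1 + ρ) * K / (n + 1 - K)) * partialSum h n := by
  have hε : 0 ≤ ε := (abs_nonneg _).trans (hK K le_rfl)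
  have hKn' : (K : ℝ) ≤ n := Nat.cast_le.2 hKn
  have hH := hs.one_le_partialSum n
  have e1 : (n + 1) * h (n + 1) - ρ * partialSum h n =
      ∑ k ∈ range (n + 1), (p (n - k + 1) - ρ) * h k := by
    rw [hs.rec_eq, Nat.sum_antidiagonal_eq_sum_range_succ_mk, ← sum_range_reflect, partialSum,
      mul_sum, ← sum_sub_distrib]
    refine sum_congr rfl fun k hk => ?_
    have hk' := mem_range.1 hk
    simp only
    rw [show n - (n.succ - 1 - k) = k by omega, show n.succ - 1 - k = n - k by omega]
    ring
  rw [e1]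
  have e2 : ∀ k ∈ range (n + 1), |(p (n - k + 1) - ρ) * h k| ≤
      ε * h k + if n - k < K then (1 + ρ) * (partialSum h n / (n + 1 - K)) else 0 := by
    intro k hk
    have hk' := mem_range.1 hk
    rw [abs_mul, abs_of_nonneg (hs.nonneg k)]
    split_ifs with hc
    · have h1 : |p (n - k + 1) - ρ| ≤ 1 + ρ := by
        rw [abs_le]
        constructor <;> linarith [hs.p_nonneg (n - k + 1), hs.p_le_one (n - k + 1), hs.pos]
      have h2 : h k ≤ partialSum h n / (n + 1 - K) := by
        rw [le_div_iff₀ (by linarith)]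
        calc h k * (n + 1 - K) ≤ h k * (k + 1) := by
              refine mul_le_mul_of_nonneg_left ?_ (hs.nonneg k)
              have : (n : ℝ) ≤ k + K := by exact_mod_cast (by omega : n ≤ k + K)
              linarith
          _ = (k + 1) * h k := mul_comm _ _
          _ ≤ partialSum h k := succ_mul_le_partialSum hs.anti k
          _ ≤ partialSum h n := partialSum_mono hs.nonneg (by omega)
      have := mul_le_mul h1 h2 (hs.nonneg k) (by linarith [hs.pos])
      have := mul_nonneg hε (hs.nonneg k)
      linarith
    · rw [add_zero]
      exact mul_le_mul_of_nonneg_right (hK _ (by omega)) (hs.nonneg k)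
  refine (abs_sum_le_sum_abs _ _).trans ((sum_le_sum e2).trans ?_)
  rw [sum_add_distrib, ← mul_sum, ← sum_filter, sum_const, nsmul_eq_mul, add_mul ε]
  refine add_le_add le_rfl ?_
  have hcard : #{k ∈ range (n + 1) | n - k < K} ≤ K := by
    refine (card_le_card_of_injOn (fun k => n - k) (t := range K) ?_ ?_).trans_eq (card_range K)
    · intro k hk
      have := (mem_filter.1 hk).2
      simpa using this
    · intro k hk l hl hkl
      have h1 := mem_range.1 (mem_filter.1 hk).1
      have h2 := mem_range.1 (mem_filter.1 hl).1
      simp only at hkl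
      omega
  have : (0 : ℝ) < n + 1 - K := by linarith
  calc (#{k ∈ range (n + 1) | n - k < K} : ℝ) * ((1 + ρ) * (partialSum h n / (n + 1 - K)))
      ≤ K * ((1 + ρ) * (partialSum h n / (n + 1 - K))) := by
        refine mul_le_mul_of_nonneg_right (by exact_mod_cast hcard) ?_
        have := hs.pos
        positivity
    _ = (1 + ρ) * K / (n + 1 - K) * partialSum h n := by ring

/-- This limit is the only form of regular variation that is used: all later comparisons of `h` at
different times follow from it and monotonicity. -/
lemma tendsto_ratio (hs : SpitzerSeq h p ρ) :
    Tendsto (fun n : ℕ => (n + 1) * h (n + 1) / partialSum h n) atTop (𝓝 ρ) := by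
  rw [Metric.tendsto_atTop]
  intro ε hε
  obtain ⟨K, hK⟩ := (Metric.tendsto_atTop.1 hs.tendsto) (ε / 2) (half_pos hε)
  have hlim : Tendsto (fun n : ℕ => (1 + ρ) * K / ((n : ℝ) + 1 - K)) atTop (𝓝 0) := by
    refine Tendsto.div_atTop tendsto_const_nhds ?_
    have : (fun n : ℕ => (n : ℝ) + 1 - K) = fun n : ℕ => (n : ℝ) + (1 - K) := by
      funext n; ring
    rw [this]
    exact tendsto_atTop_add_const_right _ _ tendsto_natCast_atTop_atTop
  obtain ⟨N, hN⟩ := eventually_atTop.1 (hlim.eventually (gt_mem_nhds (half_pos hε)))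
  refine ⟨max K N, fun n hn => ?_⟩
  have h1 := hs.abs_succ_mul_sub_le (ε := ε / 2) K n (le_of_max_le_left hn) fun j hj => by
    have := (hK j hj).le
    rwa [Real.dist_eq] at this
  have h2 := hN n (le_of_max_le_right hn)
  have hH := hs.one_le_partialSum n
  have hH' : 0 < partialSum h n := by linarith
  rw [Real.dist_eq, div_sub' hH'.ne', abs_div, abs_of_pos hH', div_lt_iff₀ hH',
    mul_comm (partialSum h n) ρ]
  refine h1.trans_lt ?_
  refine mul_lt_mul_of_pos_right ?_ hH'
  linarith

lemma h_pos (hs : SpitzerSeq h p ρ) (n : ℕ) : 0 < h n := by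
  obtain ⟨N, hN⟩ := eventually_atTop.1 (hs.tendsto_ratio.eventually (lt_mem_nhds hs.pos))
  have h1 := hN (max N n) (le_max_left _ _)
  have h2 : 0 < h (max N n + 1) := by
    by_contra hc
    have : h (max N n + 1) = 0 := le_antisymm (not_lt.1 hc) (hs.nonneg _)
    simp [this] at h1
  exact h2.trans_le (hs.anti (by omega))

/-- The partial sums are comparable with `n * h n`. -/
lemma exists_partialSum_le (hs : SpitzerSeq h p ρ) :
    ∃ C : ℝ, 1 ≤ C ∧ ∀ n : ℕ, partialSum h n ≤ C * ((n + 1) * h n) := by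
  have hlim : Tendsto (fun n : ℕ => ((n + 1) * h (n + 1) / partialSum h n)⁻¹) atTop (𝓝 ρ⁻¹) :=
    hs.tendsto_ratio.inv₀ hs.pos.ne'
  obtain ⟨C, hC⟩ := hlim.bddAbove_range
  refine ⟨max 1 C, le_max_left _ _, fun n => ?_⟩
  have hC' : ((n + 1) * h (n + 1) / partialSum h n)⁻¹ ≤ max 1 C :=
    (hC ⟨n, rfl⟩).trans (le_max_right _ _)
  have hn : (0 : ℝ) < n + 1 := by positivity
  rw [inv_div, div_le_iff₀ (mul_pos hn (hs.h_pos _))] at hC'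
  refine hC'.trans ?_
  have := hs.anti (Nat.le_succ n)
  gcongr

/-- Partial sums are at least 1 and at most `C * ((k + 1) * h k)`, so `h k` dominates a multiple of
the harmonic series. -/
lemma tendsto_partialSum (hs : SpitzerSeq h p ρ) : Tendsto (partialSum h) atTop atTop := by
  obtain ⟨C, hC1, hC⟩ := hs.exists_partialSum_le
  have hC0 : 0 < C := by linarith
  refine tendsto_atTop_mono (fun n => ?_) (Tendsto.const_mul_atTop (r := C⁻¹) (by positivity)
    (Real.tendsto_sum_range_one_div_nat_succ_atTop.comp (tendsto_add_atTop_nat 1)))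
  rw [Function.comp_apply, mul_sum, partialSum]
  refine sum_le_sum fun k _ => ?_
  have h1 := (hs.one_le_partialSum k).trans (hC k)
  have hk : (0 : ℝ) < k + 1 := by positivity
  rw [inv_mul_le_iff₀ hC0, div_le_iff₀ hk]
  linarith

/-- Slow variation of `h` over short multiplicative ranges. -/
lemma exists_mul_le (hs : SpitzerSeq h p ρ) {δ : ℝ} (hδ : 0 < δ) :
    ∃ η > 0, ∃ N : ℕ, ∀ n m : ℕ, N ≤ n → n ≤ m → (m : ℝ) ≤ (1 + η) * n →
      (1 - δ) * h n ≤ h m := by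
  -- With η = κ, the ratio limit at both ends and the growth of the partial sums give h m ≥ (1 -
  -- κ)/(1 + κ)² · h n, and this factor is at least 1 - 3κ.
  obtain ⟨κ, hκ, rfl⟩ : ∃ κ : ℝ, 0 < κ ∧ 3 * κ = δ := ⟨δ / 3, by positivity, by ring⟩
  have hρ := hs.pos
  have hev := (hs.tendsto_ratio.eventually (lt_mem_nhds (show ρ * (1 - κ) < ρ by nlinarith))).and
    (hs.tendsto_ratio.eventually (gt_mem_nhds (show ρ < ρ * (1 + κ) by nlinarith)))
  obtain ⟨N, hN⟩ := eventually_atTop.1 hev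
  refine ⟨κ, hκ, N + 1, fun n m hn hnm hm => ?_⟩
  obtain ⟨n, rfl⟩ : ∃ n', n = n' + 1 := ⟨n - 1, by omega⟩
  obtain ⟨m, rfl⟩ : ∃ m', m = m' + 1 := ⟨m - 1, by omega⟩
  have h1 := (hN m (by omega)).1.le
  have h2 := (hN n (by omega)).2.le
  have hHm := hs.one_le_partialSum m
  have hHn := hs.one_le_partialSum n
  rw [le_div_iff₀ (by linarith)] at h1
  rw [div_le_iff₀ (by linarith)] at h2
  have hH : partialSum h n ≤ partialSum h m := partialSum_mono hs.nonneg (by omega)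
  have hn0 : (0 : ℝ) < n + 1 := by positivity
  have hhm := hs.h_pos (m + 1)
  have hhn := hs.h_pos (n + 1)
  push_cast at hm
  rcases le_total 1 κ with hκ1 | hκ1
  · nlinarith
  · have e1 : (1 - κ) * ((n + 1) * h (n + 1)) ≤ (1 - κ) * (ρ * (1 + κ) * partialSum h n) :=
      mul_le_mul_of_nonneg_left h2 (by linarith)
    have e2 : ρ * (1 - κ) * partialSum h n ≤ ρ * (1 - κ) * partialSum h m :=
      mul_le_mul_of_nonneg_left hH (mul_nonneg hρ.le (by linarith))
    have e3 : (m + 1) * h (m + 1) ≤ (1 + κ) * (n + 1) * h (m + 1) :=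
      mul_le_mul_of_nonneg_right hm hhm.le
    have e4 : (1 - κ) * ((n + 1) * h (n + 1)) ≤ (1 + κ) * ((1 + κ) * (n + 1) * h (m + 1)) := by
      have := mul_le_mul_of_nonneg_left ((e2.trans h1).trans e3) (show 0 ≤ 1 + κ by linarith)
      linarith
    have e5 : (1 - κ) * h (n + 1) ≤ (1 + κ) ^ 2 * h (m + 1) := by
      refine le_of_mul_le_mul_left ?_ hn0
      linarith
    have e6 : (1 - 3 * κ) * (1 + κ) ^ 2 ≤ 1 - κ := by nlinarith [pow_pos hκ 2, pow_pos hκ 3]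
    have e7 : (1 + κ) ^ 2 * ((1 - 3 * κ) * h (n + 1)) ≤ (1 + κ) ^ 2 * h (m + 1) := by
      have := mul_le_mul_of_nonneg_right e6 hhn.le
      linarith
    exact le_of_mul_le_mul_left e7 (by positivity)

variable {r hx : ℕ → ℝ} {R : ℝ}

lemma sum_mul_le (hs : SpitzerSeq h p ρ) (hr : ∀ n, 0 ≤ r n)
    (hxe : ∀ n, hx n = ∑ q ∈ antidiagonal n, r q.1 * h q.2) (n : ℕ) :
    (∑ k ∈ range (n + 1), r k) * h n ≤ hx n := by
  rw [hxe, Nat.sum_antidiagonal_eq_sum_range_succ_mk, sum_mul]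
  exact sum_le_sum fun k _ => mul_le_mul_of_nonneg_left (hs.anti (Nat.sub_le _ _)) (hr k)

lemma partialSum_conv_le (hs : SpitzerSeq h p ρ) (hr : ∀ n, 0 ≤ r n) (hR : HasSum r R)
    (hxe : ∀ n, hx n = ∑ q ∈ antidiagonal n, r q.1 * h q.2) (n : ℕ) :
    partialSum hx n ≤ R * partialSum h n := by
  have e : partialSum hx n = ∑ k ∈ range (n + 1), r k * ∑ l ∈ range (n + 1 - k), h l := by
    simp_rw [partialSum, hxe, Nat.sum_antidiagonal_eq_sum_range_succ_mk, mul_sum]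
    exact sum_range_diag_flip (n + 1) fun k l => r k * h l
  rw [e]
  calc ∑ k ∈ range (n + 1), r k * ∑ l ∈ range (n + 1 - k), h l
      ≤ ∑ k ∈ range (n + 1), r k * partialSum h n := by
        refine sum_le_sum fun k _ => mul_le_mul_of_nonneg_left ?_ (hr k)
        exact sum_le_sum_of_subset_of_nonneg (range_subset_range.2 (Nat.sub_le _ _))
          fun i _ _ => hs.nonneg i
    _ = (∑ k ∈ range (n + 1), r k) * partialSum h n := (sum_mul _ _ _).symm
    _ ≤ R * partialSum h n := mul_le_mul_of_nonneg_right
        (sum_le_hasSum _ (fun i _ => hr i) hR) (by linarith [hs.one_le_partialSum n])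

/-- Monotonicity of `hx` turns the bound on its partial sums into a pointwise one, valid for every
`n` and linear in `R`. This is what later makes the domination uniform in the starting point. -/
lemma conv_le {C : ℝ} (hs : SpitzerSeq h p ρ) (hr : ∀ n, 0 ≤ r n) (hR : HasSum r R)
    (hxe : ∀ n, hx n = ∑ q ∈ antidiagonal n, r q.1 * h q.2) (anti : Antitone hx)
    (hC : ∀ n : ℕ, partialSum h n ≤ C * ((n + 1) * h n)) (n : ℕ) :
    hx n ≤ C * R * h n := by
  have hR0 : 0 ≤ R := hR.nonneg hr
  have h1 := (succ_mul_le_partialSum anti n).trans (hs.partialSum_conv_le hr hR hxe n)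
  have h2 := h1.trans (mul_le_mul_of_nonneg_left (hC n) hR0)
  refine le_of_mul_le_mul_left (a := (n + 1 : ℝ)) ?_ (by positivity)
  linarith

/-- A monotone density argument. On a window from `n` to `m` of length proportional to `m`, the sum
of `hx` is at least `(m - n) * hx m`. It is also at most `R` times the sum of `h`, up to an error
that is small compared with `partialSum h m`. Slow variation replaces `h n` by `h m`. -/
lemma eventually_conv_le (hs : SpitzerSeq h p ρ) (hr : ∀ n, 0 ≤ r n) (hR : HasSum r R)
    (hxe : ∀ n, hx n = ∑ q ∈ antidiagonal n, r q.1 * h q.2) (anti : Antitone hx) {θ : ℝ}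
    (hθ : 0 < θ) : ∀ᶠ m in atTop, hx m ≤ (R + θ) * h m := by
  have hR0 : 0 ≤ R := hR.nonneg hr
  obtain ⟨C, hC1, hC⟩ := hs.exists_partialSum_le
  obtain ⟨δ, hδ0, hδ1, hδR⟩ : ∃ δ : ℝ, 0 < δ ∧ δ ≤ 1 / 2 ∧ 2 * δ * R ≤ θ / 2 := by
    refine ⟨min (1 / 2) (θ / (4 * (R + 1))), by positivity, min_le_left _ _, ?_⟩
    have h1 : min (1 / 2) (θ / (4 * (R + 1))) ≤ θ / (4 * (R + 1)) := min_le_right _ _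
    rw [le_div_iff₀ (by positivity)] at h1
    have : 0 < min (1 / 2) (θ / (4 * (R + 1))) := by positivity
    nlinarith
  obtain ⟨η, hη, N, hN⟩ := hs.exists_mul_le hδ0
  -- By this choice m/(1 + η) = m - 2cm; half of the gap absorbs the rounding of `n`, which leaves m
  -- - n ≥ cm. Then `ε` is such that the error 2ε · `partialSum h m` costs at most (θ/2) · h m after
  -- division by m - n.
  obtain ⟨c, hc, hcη⟩ : ∃ c : ℝ, 0 < c ∧ 2 * c * (1 + η) = η :=
    ⟨η / (2 * (1 + η)), by positivity, by field_simp⟩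
  obtain ⟨ε, hε, hεC⟩ : ∃ ε : ℝ, 0 < ε ∧ 4 * ε * C = c * (θ / 2) :=
    ⟨c * (θ / 2) / (4 * C), by positivity, by field_simp⟩
  have hlow : ∀ᶠ j in atTop, (R - ε) * h j ≤ hx j := by
    have := hR.tendsto_sum_nat.comp (tendsto_add_atTop_nat 1)
    filter_upwards [this.eventually (lt_mem_nhds (show R - ε < R by linarith))] with j hj
    exact (mul_le_mul_of_nonneg_right hj.le (hs.nonneg j)).trans (hs.sum_mul_le hr hxe j)
  obtain ⟨K, hK⟩ := eventually_atTop.1 hlow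
  have hx0 : ∀ j, 0 ≤ hx j := fun j => by
    rw [hxe]; exact sum_nonneg fun q _ => mul_nonneg (hr _) (hs.nonneg _)
  have hlow' : ∀ n, (R - ε) * partialSum h n - R * partialSum h K ≤ partialSum hx n := by
    intro n
    -- Before `K` the lower bound on `hx` may fail, but the total defect is at most `R * partialSum
    -- h K`, a constant negligible against the diverging partial sums.
    have hstep : ∀ j, (R - ε) * h j - hx j ≤ if j < K then R * h j else 0 := by
      intro j
      split_ifs with hj
      · have := hx0 j
        have := mul_nonneg hε.le (hs.nonneg j)
        linarith
      · linarith [hK j (not_lt.1 hj)]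
    have h1 := sum_le_sum fun j (_ : j ∈ range (n + 1)) => hstep j
    rw [sum_sub_distrib, ← mul_sum, ← sum_filter, ← mul_sum] at h1
    have h2 : ∑ j ∈ range (n + 1) with j < K, h j ≤ partialSum h K := by
      refine sum_le_sum_of_subset_of_nonneg ?_ fun i _ _ => hs.nonneg i
      intro j hj
      have := (mem_filter.1 hj).2
      exact mem_range.2 (by omega)
    have h3 := mul_le_mul_of_nonneg_left h2 hR0
    simp only [partialSum] at h3 ⊢
    linarith
  have hdiff : ∀ {f : ℕ → ℝ}, Antitone f → ∀ n m : ℕ, n ≤ m →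
      (m - n) * f m ≤ partialSum f m - partialSum f n ∧
      partialSum f m - partialSum f n ≤ (m - n) * f n := by
    intro f hf n m hnm
    induction m, hnm using Nat.le_induction with
    | base => simp
    | succ m hnm ih =>
      rw [partialSum_succ]
      have h1 := hf (Nat.le_succ m)
      have h2 := hf (hnm.trans (Nat.le_succ m))
      have h3 : (n : ℝ) ≤ m := Nat.cast_le.2 hnm
      push_cast
      simp only [Nat.succ_eq_add_one] at h1 h2
      constructor <;> nlinarith [ih.1, ih.2]
  have hHlarge : ∀ᶠ m in atTop, R * partialSum h K ≤ ε * partialSum h m := by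
    have := (hs.tendsto_partialSum.const_mul_atTop hε).eventually_ge_atTop (R * partialSum h K)
    exact this
  have hmlarge : ∀ᶠ m : ℕ in atTop, max ((1 + η) * N) (max 1 (2 / c)) ≤ (m : ℝ) :=
    tendsto_natCast_atTop_atTop.eventually_ge_atTop _
  filter_upwards [hHlarge, hmlarge] with m hHm hm
  obtain ⟨hm1, hm'⟩ := max_le_iff.1 hm
  obtain ⟨hm2, hm3⟩ := max_le_iff.1 hm'
  set n := ⌈(m : ℝ) / (1 + η)⌉₊ with hn
  have hη1 : 0 < 1 + η := by linarith
  have hn1 : (m : ℝ) ≤ (1 + η) * n := by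
    have := Nat.le_ceil ((m : ℝ) / (1 + η))
    rw [div_le_iff₀ hη1] at this
    linarith
  have hn2 : (n : ℝ) < m / (1 + η) + 1 := Nat.ceil_lt_add_one (by positivity)
  have hn3 : c * m ≤ m - n := by
    rw [div_le_iff₀ hc] at hm3
    have e : (m : ℝ) / (1 + η) = m - 2 * c * m := by
      rw [div_eq_iff hη1.ne']
      linear_combination (m : ℝ) * hcη
    linarith
  have hnN : N ≤ n := by
    have h1 : (1 + η) * (N : ℝ) ≤ (1 + η) * n := hm1.trans hn1
    exact_mod_cast le_of_mul_le_mul_left h1 hη1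
  have hnm : n ≤ m := by
    have : (n : ℝ) ≤ m := by nlinarith
    exact_mod_cast this
  have hslow := hN n m hnN hnm hn1
  have a1 := (hdiff anti n m hnm).1
  have a2 := (hdiff hs.anti n m hnm).2
  have a3 := hs.partialSum_conv_le hr hR hxe m
  have a4 := hlow' n
  have a5 : partialSum h n ≤ partialSum h m := partialSum_mono hs.nonneg hnm
  have a6 := hC m
  have hpos : (0 : ℝ) < m - n := by nlinarith
  have hhm := hs.h_pos m
  have b1 : (m - n) * hx m ≤ R * ((m - n) * h n) + 2 * ε * partialSum h m := by
    have c1 := mul_le_mul_of_nonneg_left a2 hR0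
    have c2 := mul_le_mul_of_nonneg_left a5 hε.le
    linarith
  have b2 : 2 * ε * partialSum h m ≤ (m - n) * (θ / 2 * h m) := by
    calc 2 * ε * partialSum h m ≤ 2 * ε * (C * ((m + 1) * h m)) :=
          mul_le_mul_of_nonneg_left a6 (by positivity)
      _ ≤ 2 * ε * (C * ((2 * m) * h m)) := by gcongr; linarith
      _ = (c * m) * (θ / 2 * h m) := by linear_combination (m * h m) * hεC
      _ ≤ (m - n) * (θ / 2 * h m) := mul_le_mul_of_nonneg_right hn3 (by positivity)
  have b3 : hx m ≤ R * h n + θ / 2 * h m := by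
    refine le_of_mul_le_mul_left ?_ hpos
    linarith
  -- Inverts slow variation: (1 + 2δ)(1 - δ) ≥ 1 because δ ≤ 1/2.
  have b4 : h n ≤ (1 + 2 * δ) * h m := by
    have := mul_le_mul_of_nonneg_left hslow (show 0 ≤ 1 + 2 * δ by linarith)
    nlinarith [hs.h_pos n, mul_nonneg (mul_nonneg hδ0.le (show 0 ≤ 1 - 2 * δ by linarith))
      (hs.h_pos n).le]
  have b5 := mul_le_mul_of_nonneg_left b4 hR0
  have b6 := mul_le_mul_of_nonneg_right hδR hhm.le
  linarith

/-- A convolution of `h` with a summable sequence is asymptotic to a multiple of `h`. -/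
lemma tendsto_conv_div (hs : SpitzerSeq h p ρ) (hr : ∀ n, 0 ≤ r n) (hR : HasSum r R)
    (hxe : ∀ n, hx n = ∑ q ∈ antidiagonal n, r q.1 * h q.2) (anti : Antitone hx) :
    Tendsto (fun n => hx n / h n) atTop (𝓝 R) := by
  rw [tendsto_order]
  constructor
  · intro a ha
    have := hR.tendsto_sum_nat.comp (tendsto_add_atTop_nat 1)
    filter_upwards [this.eventually (lt_mem_nhds ha)] with n hn
    rw [lt_div_iff₀ (hs.h_pos n)]
    exact (mul_lt_mul_of_pos_right hn (hs.h_pos n)).trans_le (hs.sum_mul_le hr hxe n)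
  · intro a ha
    filter_upwards [hs.eventually_conv_le hr hR hxe anti (half_pos (sub_pos.2 ha))] with n hn
    rw [div_lt_iff₀ (hs.h_pos n)]
    refine hn.trans_lt (mul_lt_mul_of_pos_right ?_ (hs.h_pos n))
    linarith

end SpitzerSeq

end Sequences

end SpinalBRW

namespace SpinalBRW

/-! ### The convolution semiring of finite measures on the line. -/

noncomputable section ConvolutionSemiring

open Set

/-- Finite measures on `ℝ`, as a semiring whose multiplication is convolution. -/
def ConvMeasure : Type := FiniteMeasure ℝ

namespace ConvMeasure

/-- The underlying measure. -/
def toMeasure (μ : ConvMeasure) : Measure ℝ := FiniteMeasure.toMeasure μ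

/-- A finite measure, seen in the convolution semiring. -/
def of (μ : Measure ℝ) [IsFiniteMeasure μ] : ConvMeasure := (⟨μ, inferInstance⟩ : FiniteMeasure ℝ)

@[simp] lemma toMeasure_of (μ : Measure ℝ) [IsFiniteMeasure μ] : (of μ).toMeasure = μ := rfl

instance (μ : ConvMeasure) : IsFiniteMeasure μ.toMeasure := FiniteMeasure.isFiniteMeasure μ

lemma toMeasure_injective : Function.Injective toMeasure := FiniteMeasure.toMeasure_injective

instance : AddCommMonoid ConvMeasure := inferInstanceAs (AddCommMonoid (FiniteMeasure ℝ))

@[simp] lemma toMeasure_add (μ ν : ConvMeasure) :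
    (μ + ν).toMeasure = μ.toMeasure + ν.toMeasure := rfl

@[simp] lemma toMeasure_zero : (0 : ConvMeasure).toMeasure = 0 := rfl

instance : Mul ConvMeasure := ⟨fun μ ν => of (μ.toMeasure ∗ ν.toMeasure)⟩

@[simp] lemma toMeasure_mul (μ ν : ConvMeasure) :
    (μ * ν).toMeasure = μ.toMeasure ∗ ν.toMeasure := rfl

instance : One ConvMeasure := ⟨of (Measure.dirac 0)⟩

@[simp] lemma toMeasure_one : (1 : ConvMeasure).toMeasure = Measure.dirac 0 := rfl

instance : CommSemiring ConvMeasure where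
  left_distrib μ ν ρ := toMeasure_injective
    (Measure.conv_add μ.toMeasure ν.toMeasure ρ.toMeasure)
  right_distrib μ ν ρ := toMeasure_injective
    (Measure.add_conv μ.toMeasure ν.toMeasure ρ.toMeasure)
  zero_mul _ := toMeasure_injective (Measure.zero_conv _)
  mul_zero _ := toMeasure_injective (Measure.conv_zero _)
  mul_assoc _ _ _ := toMeasure_injective (Measure.conv_assoc _ _ _)
  one_mul _ := toMeasure_injective (Measure.dirac_zero_conv _)
  mul_one _ := toMeasure_injective (Measure.conv_dirac_zero _)
  mul_comm _ _ := toMeasure_injective (Measure.conv_comm _ _)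

instance : IsCancelAdd ConvMeasure where
  add_left_cancel μ ν ρ h := toMeasure_injective <| by
    ext s _
    have := congrArg (fun κ : ConvMeasure => κ.toMeasure s) h
    simp only [toMeasure_add, Measure.add_apply] at this
    exact (ENNReal.add_right_inj (measure_ne_top _ _)).1 this
  add_right_cancel μ ν ρ h := toMeasure_injective <| by
    ext s _
    have := congrArg (fun κ : ConvMeasure => κ.toMeasure s) h
    simp only [toMeasure_add, Measure.add_apply] at this
    exact (ENNReal.add_left_inj (measure_ne_top _ _)).1 this

/-- Restriction of measures to a set. -/
def restrict (s : Set ℝ) : ConvMeasure →+ ConvMeasure where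
  toFun μ := of (μ.toMeasure.restrict s)
  map_zero' := toMeasure_injective (by simp)
  map_add' _ _ := toMeasure_injective (by simp)

@[simp] lemma toMeasure_restrict (s : Set ℝ) (μ : ConvMeasure) :
    (restrict s μ).toMeasure = μ.toMeasure.restrict s := rfl

lemma restrict_eq_zero {s : Set ℝ} {μ : ConvMeasure} :
    restrict s μ = 0 ↔ μ.toMeasure s = 0 := by
  rw [← toMeasure_injective.eq_iff]
  simp [Measure.restrict_eq_zero]

/-- Total mass, as a semiring homomorphism. -/
def mass : ConvMeasure →+* ℝ where
  toFun μ := μ.toMeasure.real univ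
  map_zero' := by simp
  map_one' := by simp
  map_add' _ _ := by simp [measureReal_add_apply]
  map_mul' μ ν := by
    simp only [toMeasure_mul, Measure.conv, Measure.real]
    rw [Measure.map_apply (by fun_prop) MeasurableSet.univ, preimage_univ, ← univ_prod_univ,
      Measure.prod_prod, ENNReal.toReal_mul]

lemma mass_apply (μ : ConvMeasure) : mass μ = μ.toMeasure.real univ := rfl

lemma mul_apply_eq_zero {s : Set ℝ} (hs : MeasurableSet s) (hadd : ∀ x y, x + y ∈ s → x ∈ s ∨ y ∈ s)
    {μ ν : ConvMeasure} (hμ : μ.toMeasure s = 0) (hν : ν.toMeasure s = 0) :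
    (μ * ν).toMeasure s = 0 := by
  rw [toMeasure_mul, Measure.conv, Measure.map_apply (by fun_prop) hs]
  refine measure_mono_null (t := s ×ˢ univ ∪ univ ×ˢ s) ?_ (measure_union_null ?_ ?_)
  · rintro ⟨x, y⟩ h
    rcases hadd x y h with h | h <;> simp [h]
  · simp [Measure.prod_prod, hμ]
  · simp [Measure.prod_prod, hν]

/-- Both half-lines are closed under addition, and the unit mass at 0 sits on the closed one. The
asymmetry at 0 is what makes the descending ladder heights strict. -/
lemma isSplitting : IsSplitting (restrict (Ici 0)) (restrict (Iio 0)) where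
  add_eq μ := toMeasure_injective <| by
    simp only [toMeasure_add, toMeasure_restrict]
    rw [← compl_Ici]
    exact Measure.restrict_add_restrict_compl measurableSet_Ici
  right_left μ := by
    rw [restrict_eq_zero, toMeasure_restrict, Measure.restrict_apply measurableSet_Iio]
    simp [← compl_Ici]
  left_right μ := by
    rw [restrict_eq_zero, toMeasure_restrict, Measure.restrict_apply measurableSet_Ici]
    simp [← compl_Ici]
  right_mul μ ν := by
    simp only [restrict_eq_zero]
    refine mul_apply_eq_zero measurableSet_Iio fun x y hxy => ?_
    by_contra! h
    simp only [mem_Iio, not_lt] at h hxy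
    linarith
  left_mul μ ν := by
    simp only [restrict_eq_zero]
    refine mul_apply_eq_zero measurableSet_Ici fun x y hxy => ?_
    by_contra! h
    simp only [mem_Ici, not_le] at h hxy
    linarith
  right_one := by
    rw [restrict_eq_zero, toMeasure_one, Measure.dirac_apply' _ measurableSet_Iio]
    simp

end ConvMeasure

end ConvolutionSemiring

end SpinalBRW

namespace SpinalBRW

/-! ### The walk killed below zero, its minimum, and the renewal function. -/

noncomputable section Walk

open Set ConvMeasure
open Finset.HasAntidiagonal (antidiagonal)

variable (F : Measure ℝ)

/-- The transition operator of the random walk with step law `F`, killed on leaving `[0, ∞)`. -/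
def walkOp (f : ℝ → ℝ≥0∞) (x : ℝ) : ℝ≥0∞ := ∫⁻ y, (Ici 0).indicator f (x + y) ∂F

/-- The probability that the walk started at `x ≥ 0` stays nonnegative up to time `n`. -/
def survival : ℕ → ℝ → ℝ≥0∞
  | 0 => fun _ => 1
  | n + 1 => walkOp F (survival n)

variable {F}

lemma walkOp_le_walkOp {f g : ℝ → ℝ≥0∞} (h : ∀ x, 0 ≤ x → f x ≤ g x) (x : ℝ) :
    walkOp F f x ≤ walkOp F g x :=
  lintegral_mono fun _ => indicator_le_indicator' fun hy => h _ hy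

lemma walkOp_congr {f g : ℝ → ℝ≥0∞} (h : ∀ x, 0 ≤ x → f x = g x) : walkOp F f = walkOp F g :=
  funext fun x => le_antisymm (walkOp_le_walkOp (fun y hy => (h y hy).le) x)
    (walkOp_le_walkOp (fun y hy => (h y hy).ge) x)

lemma survival_mono (n : ℕ) : Monotone (survival F n) := by
  induction n with
  | zero => exact monotone_const
  | succ n ih =>
    intro x x' hx
    refine lintegral_mono fun y => ?_
    by_cases hy : 0 ≤ x + y
    · have hy' : 0 ≤ x' + y := by linarith
      simp only [indicator, mem_Ici, hy, hy', if_true]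
      exact ih (by linarith)
    · simp [hy]

lemma walkOp_sum_mul {ι : Type*} (s : Finset ι) {f : ι → ℝ → ℝ≥0∞} (hf : ∀ i, Measurable (f i))
    (c : ι → ℝ≥0∞) (x : ℝ) :
    walkOp F (fun y => ∑ i ∈ s, f i y * c i) x = ∑ i ∈ s, walkOp F (f i) x * c i := by
  have hm : ∀ i, Measurable fun y => (Ici 0).indicator (f i) (x + y) := fun i =>
    ((hf i).indicator measurableSet_Ici).comp (measurable_const_add x)
  simp_rw [walkOp, ← lintegral_mul_const _ (hm _)]
  rw [← lintegral_finsetSum _ fun i _ => (hm i).mul_const _]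
  refine lintegral_congr fun y => ?_
  by_cases hy : 0 ≤ x + y <;> simp [indicator, hy]

/-- If each of the first `j` steps is at least δ, the walk has climbed by `j * δ` without leaving
the half-line; monotonicity in the starting point does the rest. -/
lemma pow_mul_survival_le (δ : ℝ) (hδ : 0 ≤ δ) (n j : ℕ) {y : ℝ} (hy : 0 ≤ y) :
    F (Ici δ) ^ j * survival F n (y + j * δ) ≤ survival F (n + j) y := by
  induction j generalizing y with
  | zero => simp
  | succ j ih =>
    calc F (Ici δ) ^ (j + 1) * survival F n (y + (j + 1 : ℕ) * δ)
        = F (Ici δ) * (F (Ici δ) ^ j * survival F n ((y + δ) + j * δ)) := by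
          rw [pow_succ, show y + ((j + 1 : ℕ) : ℝ) * δ = (y + δ) + j * δ by push_cast; ring]
          ring
      _ ≤ F (Ici δ) * survival F (n + j) (y + δ) := by gcongr; exact ih (by linarith)
      _ = ∫⁻ _ in Ici δ, survival F (n + j) (y + δ) ∂F := by rw [setLIntegral_const, mul_comm]
      _ ≤ ∫⁻ t in Ici δ, (Ici 0).indicator (survival F (n + j)) (y + t) ∂F := by
          refine setLIntegral_mono' measurableSet_Ici fun t ht => ?_
          have ht' : 0 ≤ y + t := by linarith [mem_Ici.1 ht]
          simp only [indicator, mem_Ici, ht', if_true]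
          exact survival_mono _ (by linarith [mem_Ici.1 ht])
      _ ≤ survival F (n + (j + 1)) y := setLIntegral_le_lintegral _ _

variable (F) [IsProbabilityMeasure F]

/-- The law of the walk started at `0`, killed on leaving `[0, ∞)`. -/
def stayLaw (n : ℕ) : ConvMeasure := killedPow (restrict (Ici 0)) (of F) n

/-- The law of the walk started at `0`, killed on returning to `[0, ∞)`. -/
def belowLaw (n : ℕ) : ConvMeasure := killedPow (restrict (Iio 0)) (of F) n

/-- The mass that the walk killed on returning to `[0, ∞)` gives to `[-x, ∞)` at time `n`. -/
def ladderMass (n : ℕ) (x : ℝ) : ℝ≥0∞ := (belowLaw F n).toMeasure (Ici (-x))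

/-- The probability that the walk first returns to `[0, ∞)` at time `n + 1`. -/
def returnMass (n : ℕ) : ℝ≥0∞ := (belowLaw F n * of F).toMeasure (Ici 0)

/-- The renewal function of the strictly descending ladder heights. -/
def renewalFn (x : ℝ) : ℝ≥0∞ := ∑' n, ladderMass F n x

variable {F}

lemma measurable_walkOp {f : ℝ → ℝ≥0∞} (hf : Measurable f) : Measurable (walkOp F f) :=
  Measurable.lintegral_prod_right' (f := fun p : ℝ × ℝ => (Ici 0).indicator f (p.1 + p.2))
    ((hf.indicator measurableSet_Ici).comp measurable_add)

lemma measurable_survival (n : ℕ) : Measurable (survival F n) := by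
  induction n with
  | zero => exact measurable_const
  | succ n ih => exact measurable_walkOp ih

lemma survival_succ_le (n : ℕ) (x : ℝ) : survival F (n + 1) x ≤ survival F n x := by
  induction n generalizing x with
  | zero =>
    calc survival F 1 x ≤ ∫⁻ _, 1 ∂F := lintegral_mono fun y => indicator_le_self' (fun _ _ => zero_le) _
      _ = 1 := by simp
  | succ n ih => exact walkOp_le_walkOp (fun y _ => ih y) x

lemma survival_antitone (x : ℝ) : Antitone fun n => survival F n x :=
  antitone_nat_of_succ_le fun n => survival_succ_le n x

lemma survival_le_one (n : ℕ) (x : ℝ) : survival F n x ≤ 1 := survival_antitone x (Nat.zero_le n)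

lemma survival_ne_top (n : ℕ) (x : ℝ) : survival F n x ≠ ∞ :=
  ((survival_le_one n x).trans_lt ENNReal.one_lt_top).ne

lemma lintegral_walkOp (μ : ConvMeasure) {f : ℝ → ℝ≥0∞} (hf : Measurable f) :
    ∫⁻ x, walkOp F f x ∂μ.toMeasure = ∫⁻ x, f x ∂(restrict (Ici 0) (μ * of F)).toMeasure := by
  rw [toMeasure_restrict, ← lintegral_indicator measurableSet_Ici, toMeasure_mul, toMeasure_of,
    Measure.lintegral_conv (hf.indicator measurableSet_Ici)]
  rfl

lemma lintegral_survival (m n : ℕ) :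
    ∫⁻ x, survival F m x ∂(stayLaw F n).toMeasure = (stayLaw F (n + m)).toMeasure univ := by
  induction m generalizing n with
  | zero => simp [survival]
  | succ m ih =>
    rw [survival, lintegral_walkOp _ (measurable_survival m)]
    exact (ih (n + 1)).trans (by rw [Nat.succ_add_eq_add_succ])

lemma survival_zero_right (n : ℕ) : survival F n 0 = (stayLaw F n).toMeasure univ := by
  have := lintegral_survival (F := F) n 0
  rw [zero_add] at this
  rw [← this]
  simp [stayLaw, killedPow, lintegral_dirac' _ (measurable_survival n)]

lemma belowLaw_Ioi (n : ℕ) : (belowLaw F n).toMeasure (Ioi 0) = 0 := by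
  cases n with
  | zero => simp [belowLaw, killedPow]
  | succ n =>
    rw [belowLaw, killedPow, toMeasure_restrict, Measure.restrict_apply measurableSet_Ioi]
    have : Ioi (0 : ℝ) ∩ Iio 0 = ∅ := by ext; simp; intro h; linarith
    simp [this]

/-- Putting the new step first, the killing in `walkOp` costs nothing: `belowLaw` is carried by (-∞,
0], so ending above -x already forces x + y ≥ 0. The mass of the convolution on [-x, ∞) is then
split at 0. -/
lemma walkOp_ladderMass (n : ℕ) {x : ℝ} (hx : 0 ≤ x) :
    walkOp F (ladderMass F n) x = ladderMass F (n + 1) x + returnMass F n := by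
  have e1 : walkOp F (ladderMass F n) x = (belowLaw F n * of F).toMeasure (Ici (-x)) := by
    rw [mul_comm, ← lintegral_indicator_one measurableSet_Ici, toMeasure_mul, toMeasure_of,
      Measure.lintegral_conv (measurable_one.indicator measurableSet_Ici)]
    refine lintegral_congr fun y => ?_
    have e2 : ∫⁻ z, (Ici (-x)).indicator 1 (y + z) ∂(belowLaw F n).toMeasure =
        ladderMass F n (x + y) := by
      rw [ladderMass, ← lintegral_indicator_one measurableSet_Ici]
      refine lintegral_congr fun z => ?_
      simp only [indicator, mem_Ici, Pi.one_apply]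
      congr 1
      simp only [eq_iff_iff]
      constructor <;> intro <;> linarith
    rw [e2]
    by_cases hy : 0 ≤ x + y
    · simp [indicator, hy]
    · simp only [indicator, mem_Ici, hy, if_false]
      refine (measure_mono_null ?_ (belowLaw_Ioi (F := F) n)).symm
      intro z hz
      simp only [mem_Ici, mem_Ioi] at hz ⊢
      linarith
  have e3 := congrArg (fun μ : ConvMeasure => μ.toMeasure (Ici (-x)))
    (isSplitting.add_eq (belowLaw F n * of F))
  simp only [toMeasure_add, Measure.add_apply, toMeasure_restrict] at e3
  rw [Measure.restrict_apply measurableSet_Ici, inter_eq_right.2 (Ici_subset_Ici.2 (by linarith))]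
    at e3
  rw [e1, ← e3, add_comm]
  rfl

lemma belowLaw_univ (n : ℕ) : (belowLaw F n).toMeasure univ =
    (belowLaw F (n + 1)).toMeasure univ + returnMass F n := by
  have e1 : (belowLaw F n * of F).toMeasure univ = (belowLaw F n).toMeasure univ := by
    rw [toMeasure_mul, toMeasure_of, Measure.conv, Measure.map_apply (by fun_prop) MeasurableSet.univ,
      preimage_univ, ← univ_prod_univ, Measure.prod_prod, measure_univ (μ := F), mul_one]
  have e3 := congrArg (fun μ : ConvMeasure => μ.toMeasure univ)
    (isSplitting.add_eq (belowLaw F n * of F))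
  simp only [toMeasure_add, Measure.add_apply, toMeasure_restrict, e1] at e3
  rw [← e3, add_comm, Measure.restrict_apply_univ (Ici 0)]
  rfl

lemma sum_survival_mul_belowLaw (n : ℕ) :
    ∑ q ∈ antidiagonal n, survival F q.1 0 * (belowLaw F q.2).toMeasure univ = 1 := by
  have h1 := congrArg mass (isSplitting.sum_killedPow_mul_killedPow (of F) n)
  rw [map_sum, map_pow] at h1
  simp only [map_mul, mass_apply, toMeasure_of, probReal_univ, one_pow] at h1
  rw [← ENNReal.toReal_eq_one_iff, ENNReal.toReal_sum, ← h1]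
  · refine Finset.sum_congr rfl fun q _ => ?_
    rw [ENNReal.toReal_mul, survival_zero_right]
    rfl
  · exact fun q _ => ENNReal.mul_ne_top (survival_ne_top _ _) (measure_ne_top _ _)

/-- The factorization has total mass 1 at times `n` and `n + 1`. Subtracting the two identities
leaves the masses lost by `belowLaw` in one step. -/
lemma sum_survival_mul_returnMass (n : ℕ) :
    ∑ q ∈ antidiagonal n, survival F q.1 0 * returnMass F q.2 = survival F (n + 1) 0 := by
  have h1 := sum_survival_mul_belowLaw (F := F) n
  have h2 := sum_survival_mul_belowLaw (F := F) (n + 1)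
  have h3 : ∑ q ∈ antidiagonal n,
      survival F q.1 0 * (belowLaw F (q.2 + 1)).toMeasure univ ≠ ∞ :=
    ENNReal.sum_ne_top.2 fun q _ => ENNReal.mul_ne_top (survival_ne_top _ _) (measure_ne_top _ _)
  have h0 : (belowLaw F 0).toMeasure univ = 1 := by simp [belowLaw, killedPow]
  rw [Finset.Nat.sum_antidiagonal_succ', ← h1, h0, mul_one, add_comm] at h2
  have h4 : ∀ q : ℕ × ℕ, survival F q.1 0 * (belowLaw F q.2).toMeasure univ =
      survival F q.1 0 * (belowLaw F (q.2 + 1)).toMeasure univ +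
        survival F q.1 0 * returnMass F q.2 := fun q => by rw [belowLaw_univ q.2, mul_add]
  rw [Finset.sum_congr rfl fun q _ => h4 q, Finset.sum_add_distrib] at h2
  exact ((ENNReal.add_right_inj h3).1 h2).symm

lemma measurable_ladderMass (n : ℕ) : Measurable (ladderMass F n) :=
  Monotone.measurable fun _ _ hxy => measure_mono (Ici_subset_Ici.2 (neg_le_neg hxy))

lemma ladderMass_zero {x : ℝ} (hx : 0 ≤ x) : ladderMass F 0 x = 1 := by
  simp [ladderMass, belowLaw, killedPow, hx]

/-- Decomposition of the walk at its minimum. -/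
lemma survival_eq_sum (n : ℕ) {x : ℝ} (hx : 0 ≤ x) :
    survival F n x = ∑ q ∈ antidiagonal n, ladderMass F q.1 x * survival F q.2 0 := by
  induction n generalizing x with
  | zero => simp [ladderMass_zero hx, survival]
  | succ n ih =>
    -- Applying the operator to the induction hypothesis raises the index of each ladder mass and
    -- adds return masses; the latter add up to `survival F (n + 1) 0`, the missing term of ladder
    -- index 0.
    rw [survival, walkOp_congr fun y hy => ih hy, Finset.Nat.sum_antidiagonal_succ, ladderMass_zero hx, one_mul,
      walkOp_sum_mul _ fun q : ℕ × ℕ => measurable_ladderMass q.1, ← sum_survival_mul_returnMass,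
      ← Finset.Nat.sum_antidiagonal_swap (f := fun q => survival F q.1 0 * returnMass F q.2),
      ← Finset.sum_add_distrib]
    refine Finset.sum_congr rfl fun q _ => ?_
    rw [walkOp_ladderMass _ hx, add_mul, add_comm, mul_comm (returnMass F _)]
    rfl

lemma one_le_renewalFn {x : ℝ} (hx : 0 ≤ x) : 1 ≤ renewalFn F x :=
  (ladderMass_zero (F := F) hx).ge.trans (ENNReal.le_tsum 0)

lemma measurable_renewalFn : Measurable (renewalFn F) :=
  Measurable.tsum fun n => measurable_ladderMass n

lemma sum_returnMass (n : ℕ) :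
    ∑ k ∈ Finset.range n, returnMass F k + (belowLaw F n).toMeasure univ = 1 := by
  induction n with
  | zero => simp [belowLaw, killedPow]
  | succ n ih =>
    rw [← ih, Finset.sum_range_succ, belowLaw_univ n, add_assoc, add_comm (returnMass F n)]

lemma tsum_returnMass (h : Tendsto (fun n => (belowLaw F n).toMeasure univ) atTop (𝓝 0)) :
    ∑' n, returnMass F n = 1 := by
  have h1 := (ENNReal.tendsto_nat_tsum (returnMass F)).add h
  simp only [sum_returnMass, add_zero] at h1
  exact (tendsto_nhds_unique h1 tendsto_const_nhds)

/-- The renewal function is harmonic for the killed walk. -/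
lemma walkOp_renewalFn (h : Tendsto (fun n => (belowLaw F n).toMeasure univ) atTop (𝓝 0)) {x : ℝ}
    (hx : 0 ≤ x) : walkOp F (renewalFn F) x = renewalFn F x := by
  have e1 : walkOp F (renewalFn F) x = ∑' n, walkOp F (ladderMass F n) x := by
    simp only [walkOp]
    have hm : ∀ n, AEMeasurable (fun y => (Ici 0).indicator (ladderMass F n) (x + y)) F :=
      fun n => (((measurable_ladderMass n).indicator measurableSet_Ici).comp
        (measurable_const_add x)).aemeasurable
    rw [← lintegral_tsum hm]
    refine lintegral_congr fun y => ?_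
    by_cases hy : 0 ≤ x + y <;> simp [indicator, hy, renewalFn]
  -- The operator shifts the ladder series by one index. The lost initial term 1 is restored by the
  -- return masses, which sum to 1 exactly when the walk returns almost surely.
  rw [e1, renewalFn, tsum_eq_zero_add' (f := fun n => ladderMass F n x) ENNReal.summable,
    ladderMass_zero hx,
    ← tsum_returnMass h, ← ENNReal.tsum_add]
  refine tsum_congr fun n => ?_
  rw [walkOp_ladderMass n hx, add_comm]

/-- The renewal function is finite as soon as the walk can go up and can survive. -/
lemma renewalFn_ne_top {δ : ℝ} (hδ : 0 < δ) (hF : F (Ici δ) ≠ 0) (hpos : ∀ n, survival F n 0 ≠ 0)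
    {x : ℝ} (hx : 0 ≤ x) : renewalFn F x ≠ ∞ := by
  obtain ⟨j, hj⟩ := exists_nat_ge (x / δ)
  rw [div_le_iff₀ hδ] at hj
  have hp : F (Ici δ) ^ j ≠ 0 := pow_ne_zero _ hF
  have hp' : F (Ici δ) ^ j ≠ ∞ := ENNReal.pow_ne_top (measure_ne_top _ _)
  refine ne_top_of_le_ne_top (ENNReal.inv_ne_top.2 hp) ?_
  rw [renewalFn, ENNReal.tsum_eq_iSup_nat]
  refine iSup_le fun n => ?_
  -- Partial sums of the series are at most h_n(x)/h_n(0). Climbing by `j * δ ≥ x` from 0 bounds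
  -- this ratio by `(F (Ici δ) ^ j)⁻¹`, uniformly in `n`.
  have h1 : (∑ k ∈ Finset.range n, ladderMass F k x) * survival F n 0 ≤ survival F n x := by
    rw [survival_eq_sum n hx, Finset.Nat.sum_antidiagonal_eq_sum_range_succ_mk, Finset.sum_mul]
    refine (Finset.sum_le_sum_of_subset (Finset.range_subset_range.2 (Nat.le_succ n))).trans ?_
    refine Finset.sum_le_sum fun k _ => ?_
    gcongr
    exact survival_antitone 0 (Nat.sub_le _ _)
  have h2 : F (Ici δ) ^ j * survival F n x ≤ survival F n 0 :=
    calc F (Ici δ) ^ j * survival F n x ≤ F (Ici δ) ^ j * survival F n (0 + j * δ) := by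
          gcongr; exact survival_mono n (by linarith)
      _ ≤ survival F (n + j) 0 := pow_mul_survival_le δ hδ.le n j le_rfl
      _ ≤ survival F n 0 := survival_antitone 0 (Nat.le_add_right _ _)
  have h3 : F (Ici δ) ^ j * (∑ k ∈ Finset.range n, ladderMass F k x) ≤ 1 := by
    have := (mul_le_mul_right h1 (F (Ici δ) ^ j)).trans h2
    rw [← mul_assoc] at this
    calc _ = F (Ici δ) ^ j * (∑ k ∈ Finset.range n, ladderMass F k x) * survival F n 0 /
          survival F n 0 := (ENNReal.mul_div_cancel_right (hpos n) (survival_ne_top _ _)).symm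
      _ ≤ survival F n 0 / survival F n 0 := by gcongr
      _ ≤ 1 := ENNReal.div_self_le_one
  rw [ENNReal.le_inv_iff_mul_le, mul_comm]
  exact h3

end Walk

end SpinalBRW

namespace SpinalBRW

/-! ### Centered walks: survival probabilities compared across times and starting points. -/

noncomputable section CenteredWalk

open Set ConvMeasure
open Finset.HasAntidiagonal (antidiagonal)

/-- A centered law on `ℝ` with positive finite variance. -/
structure CenteredLaw (F : Measure ℝ) : Prop where
  integral_eq_zero : ∫ y, y ∂F = 0
  integrable_sq : Integrable (fun y => y ^ 2) F
  integral_sq_pos : 0 < ∫ y, y ^ 2 ∂F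

variable {F : Measure ℝ} [IsProbabilityMeasure F]

lemma charFun_pow (n : ℕ) (t : ℝ) : charFun ((of F) ^ n).toMeasure t = charFun F t ^ n := by
  induction n with
  | zero => simp [charFun_dirac]
  | succ n ih => rw [pow_succ, toMeasure_mul, charFun_conv, ih, toMeasure_of, pow_succ]

instance isProbabilityMeasure_pow (n : ℕ) : IsProbabilityMeasure ((of F) ^ n).toMeasure := by
  induction n with
  | zero => rw [pow_zero, toMeasure_one]; infer_instance
  | succ n ih => rw [pow_succ, toMeasure_mul, toMeasure_of]; infer_instance

/-- By the central limit theorem, the probability that the walk is nonnegative at time `n`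
converges. -/
lemma CenteredLaw.tendsto_pow_Ici (hF : CenteredLaw F) :
    Tendsto (fun n : ℕ => ((of F) ^ n).toMeasure (Ici 0)) atTop
      (𝓝 (gaussianReal 0 1 (Ici 0))) := by
  set σ := √(∫ y, y ^ 2 ∂F) with hσ
  have hσ0 : 0 < σ := Real.sqrt_pos.2 hF.integral_sq_pos
  have hσ2 : σ ^ 2 = ∫ y, y ^ 2 ∂F := Real.sq_sqrt hF.integral_sq_pos.le
  let μs : ℕ → ProbabilityMeasure ℝ := fun n =>
    ⟨((of F) ^ n).toMeasure.map (fun y => (σ⁻¹ * (√n)⁻¹) * y),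
      Measure.isProbabilityMeasure_map (by fun_prop)⟩
  let μ : ProbabilityMeasure ℝ := ⟨gaussianReal 0 1, inferInstance⟩
  have hlim : Tendsto μs atTop (𝓝 μ) := by
    refine ProbabilityMeasure.tendsto_iff_tendsto_charFun.2 fun t => ?_
    have h := tendsto_charFun_inv_sqrt_mul_pow (P := F) (X := fun y => σ⁻¹ * y) (by fun_prop)
      (by rw [integral_const_mul, hF.integral_eq_zero, mul_zero])
      (by
        simp only [Pi.pow_apply, mul_pow]
        rw [integral_const_mul, ← hσ2, inv_pow, inv_mul_cancel₀ (pow_pos hσ0 2).ne']) t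
    have e : charFun (gaussianReal 0 1) t = Complex.exp (-(t : ℂ) ^ 2 / 2) := by
      rw [charFun_gaussianReal]; congr 1; simp; ring
    change Tendsto (fun n : ℕ => charFun (((of F) ^ n).toMeasure.map
      (fun y => (σ⁻¹ * (√n)⁻¹) * y)) t) atTop (𝓝 (charFun (gaussianReal 0 1) t))
    rw [e]
    refine h.congr fun n => ?_
    rw [charFun_map_mul, charFun_map_mul, charFun_pow, mul_assoc]
  -- The half-line is invariant under the positive rescaling, and its frontier {0} is null for the
  -- Gaussian law.
  have h2 := ProbabilityMeasure.tendsto_measure_of_null_frontier_of_tendsto' hlim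
    (E := Ici 0) (by
      have := nullSingletonClass_gaussianReal (μ := 0) (v := 1) one_ne_zero
      change gaussianReal 0 1 (frontier (Ici 0)) = 0
      rw [frontier_Ici]
      exact measure_singleton 0)
  refine h2.congr' ?_
  filter_upwards [eventually_gt_atTop 0] with n hn
  have hc : 0 < σ⁻¹ * (√n)⁻¹ := by
    have : (0 : ℝ) < n := Nat.cast_pos.2 hn
    positivity
  change ((of F) ^ n).toMeasure.map (fun y => (σ⁻¹ * (√n)⁻¹) * y) (Ici 0) = _
  rw [Measure.map_apply (by fun_prop) measurableSet_Ici]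
  congr 1
  ext y
  simp only [mem_preimage, mem_Ici]
  exact mul_nonneg_iff_of_pos_left hc

lemma CenteredLaw.integrable (hF : CenteredLaw F) : Integrable (fun y => y) F := by
  have : MemLp (fun y : ℝ => y) 2 F :=
    (memLp_two_iff_integrable_sq measurable_id.aestronglyMeasurable).2 hF.integrable_sq
  exact this.integrable (by norm_num)

/-- Otherwise the step would be almost surely nonpositive with mean zero, hence zero, against the
positive variance. -/
lemma CenteredLaw.exists_Ici_ne_zero (hF : CenteredLaw F) : ∃ δ > 0, F (Ici δ) ≠ 0 := by
  by_contra! h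
  have h1 : F (Ioi 0) = 0 := by
    have : Ioi (0 : ℝ) ⊆ ⋃ n : ℕ, Ici ((n : ℝ) + 1)⁻¹ := by
      intro y hy
      obtain ⟨n, hn⟩ := exists_nat_one_div_lt (mem_Ioi.1 hy)
      rw [one_div] at hn
      exact mem_iUnion.2 ⟨n, hn.le⟩
    refine measure_mono_null this (measure_iUnion_null fun n => h _ (by positivity))
  have h2 : ∀ᵐ y ∂F, 0 ≤ -y := by
    rw [ae_iff]
    convert h1 using 2
    ext y; simp
  have h3 : (fun y : ℝ => -y) =ᵐ[F] 0 := by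
    refine (integral_eq_zero_iff_of_nonneg_ae h2 hF.integrable.neg).1 ?_
    rw [integral_neg, hF.integral_eq_zero, neg_zero]
  have h4 : ∫ y, y ^ 2 ∂F = 0 := by
    rw [integral_eq_zero_of_ae]
    filter_upwards [h3] with y hy
    have : y = 0 := by simpa using hy
    simp [this]
  exact hF.integral_sq_pos.ne' h4

/-- The recursion is the total mass of Spitzer's identity, since `mass` is a semiring homomorphism.
Of the limit ρ only its positivity matters. -/
lemma CenteredLaw.spitzerSeq (hF : CenteredLaw F) :
    SpitzerSeq (fun n => (survival F n 0).toReal) (fun n => ((of F) ^ n).toMeasure.real (Ici 0))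
      ((gaussianReal 0 1).real (Ici 0)) where
  zero := by simp [survival]
  anti := fun m n hmn => ENNReal.toReal_mono (survival_ne_top _ _) (survival_antitone 0 hmn)
  nonneg := fun n => ENNReal.toReal_nonneg
  p_nonneg := fun n => measureReal_nonneg
  p_le_one := fun n => measureReal_le_one
  rec_eq := fun n => by
    have h := congrArg mass (isSplitting.succ_mul_killedPow_succ (of F) n)
    rw [map_sum, map_mul, map_add, map_one, map_natCast] at h
    simp only [map_mul, mass_apply, toMeasure_restrict] at h
    simp only [survival_zero_right]
    refine h.trans (Finset.sum_congr rfl fun q _ => ?_)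
    rw [measureReal_restrict_apply_univ]
    rfl
  tendsto := (ENNReal.tendsto_toReal (measure_ne_top _ _)).comp hF.tendsto_pow_Ici
  pos := by
    refine ENNReal.toReal_pos (fun h => ?_) (measure_ne_top _ _)
    have := gaussianReal_absolutelyContinuous' 0 one_ne_zero h
    simp at this

lemma CenteredLaw.survival_zero_pos (hF : CenteredLaw F) (n : ℕ) :
    0 < (survival F n 0).toReal := hF.spitzerSeq.h_pos n

lemma CenteredLaw.survival_pos (hF : CenteredLaw F) (n : ℕ) {x : ℝ} (hx : 0 ≤ x) :
    0 < (survival F n x).toReal :=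
  (hF.survival_zero_pos n).trans_le
    (ENNReal.toReal_mono (survival_ne_top _ _) (survival_mono n hx))

/-- Both factors of the Wiener–Hopf sum are nonincreasing in time, so `partialSum` of survival at
`n` times the mass of `belowLaw F n` is at most 1, while the partial sums diverge. -/
lemma CenteredLaw.tendsto_belowLaw (hF : CenteredLaw F) :
    Tendsto (fun n => (belowLaw F n).toMeasure univ) atTop (𝓝 0) := by
  have hanti : Antitone fun n => (belowLaw F n).toMeasure univ :=
    antitone_nat_of_succ_le fun n => by rw [belowLaw_univ n]; exact le_self_add
  have hle : ∀ n, (belowLaw F n).toMeasure univ ≤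
      ENNReal.ofReal (partialSum (fun n => (survival F n 0).toReal) n)⁻¹ := by
    intro n
    have h1 := sum_survival_mul_belowLaw (F := F) n
    have hH := hF.spitzerSeq.one_le_partialSum n
    rw [Finset.Nat.sum_antidiagonal_eq_sum_range_succ_mk] at h1
    have h2 : (∑ k ∈ Finset.range (n + 1), survival F k 0) * (belowLaw F n).toMeasure univ ≤ 1 := by
      rw [← h1, Finset.sum_mul]
      refine Finset.sum_le_sum fun k _ => ?_
      exact mul_le_mul_right (hanti (Nat.sub_le n k)) _
    have h3 : ∑ k ∈ Finset.range (n + 1), survival F k 0 =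
        ENNReal.ofReal (partialSum (fun n => (survival F n 0).toReal) n) := by
      rw [partialSum, ENNReal.ofReal_sum_of_nonneg fun _ _ => ENNReal.toReal_nonneg]
      exact Finset.sum_congr rfl fun k _ => (ENNReal.ofReal_toReal (survival_ne_top _ _)).symm
    rw [ENNReal.ofReal_inv_of_pos (by linarith), ENNReal.le_inv_iff_mul_le, ← h3, mul_comm]
    exact h2
  refine tendsto_of_tendsto_of_tendsto_of_le_of_le tendsto_const_nhds ?_ (fun _ => zero_le) hle
  have := ENNReal.tendsto_ofReal (tendsto_inv_atTop_zero.comp hF.spitzerSeq.tendsto_partialSum)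
  simpa using this

lemma CenteredLaw.walkOp_renewalFn (hF : CenteredLaw F) {x : ℝ} (hx : 0 ≤ x) :
    walkOp F (renewalFn F) x = renewalFn F x :=
  SpinalBRW.walkOp_renewalFn hF.tendsto_belowLaw hx

lemma CenteredLaw.renewalFn_ne_top (hF : CenteredLaw F) {x : ℝ} (hx : 0 ≤ x) :
    renewalFn F x ≠ ∞ := by
  obtain ⟨δ, hδ, h⟩ := hF.exists_Ici_ne_zero
  refine SpinalBRW.renewalFn_ne_top hδ h (fun n h0 => ?_) hx
  have := hF.survival_zero_pos n
  simp [h0] at this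

lemma CenteredLaw.one_le_renewalFn (hF : CenteredLaw F) {x : ℝ} (hx : 0 ≤ x) :
    1 ≤ (renewalFn F x).toReal := by
  rw [← ENNReal.toReal_one]
  exact ENNReal.toReal_mono (hF.renewalFn_ne_top hx) (SpinalBRW.one_le_renewalFn hx)

lemma ladderMass_ne_top (n : ℕ) (x : ℝ) : ladderMass F n x ≠ ∞ := measure_ne_top _ _

lemma toReal_survival_eq_sum (n : ℕ) {x : ℝ} (hx : 0 ≤ x) :
    (survival F n x).toReal =
      ∑ q ∈ antidiagonal n, (ladderMass F q.1 x).toReal * (survival F q.2 0).toReal := by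
  rw [survival_eq_sum n hx, ENNReal.toReal_sum fun q _ =>
    ENNReal.mul_ne_top (ladderMass_ne_top _ _) (survival_ne_top _ _)]
  simp only [ENNReal.toReal_mul]

lemma CenteredLaw.hasSum_ladderMass (hF : CenteredLaw F) {x : ℝ} (hx : 0 ≤ x) :
    HasSum (fun n => (ladderMass F n x).toReal) (renewalFn F x).toReal := by
  rw [renewalFn, ENNReal.tsum_toReal_eq fun n => ladderMass_ne_top n x]
  exact ENNReal.hasSum_toReal (hF.renewalFn_ne_top hx)

lemma toReal_survival_antitone (x : ℝ) : Antitone fun n => (survival F n x).toReal :=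
  fun _ _ hmn => ENNReal.toReal_mono (survival_ne_top _ _) (survival_antitone x hmn)

lemma CenteredLaw.tendsto_survival_div (hF : CenteredLaw F) {x : ℝ} (hx : 0 ≤ x) :
    Tendsto (fun n => (survival F n x).toReal / (survival F n 0).toReal) atTop
      (𝓝 (renewalFn F x).toReal) :=
  hF.spitzerSeq.tendsto_conv_div (fun _ => ENNReal.toReal_nonneg) (hF.hasSum_ladderMass hx)
    (fun n => toReal_survival_eq_sum n hx) (toReal_survival_antitone x)

/-- Domination of the conditional densities. -/
lemma CenteredLaw.exists_survival_div_le (hF : CenteredLaw F) (q : ℕ) :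
    ∃ C : ℝ, ∀ n m : ℕ, n ≤ q * (m + 1) → ∀ x y : ℝ, 0 ≤ x → 0 ≤ y →
      (survival F m y).toReal / (survival F (n + m) x).toReal ≤ C * (renewalFn F y).toReal := by
  obtain ⟨C, hC1, hC⟩ := hF.spitzerSeq.exists_partialSum_le
  refine ⟨C * (C * (q + 1)), fun n m hnm x y hx hy => ?_⟩
  rw [div_le_iff₀ (hF.survival_pos _ hx)]
  have hV := (hF.one_le_renewalFn hy)
  have h1 : (survival F m y).toReal ≤ C * (renewalFn F y).toReal * (survival F m 0).toReal :=
    hF.spitzerSeq.conv_le (fun _ => ENNReal.toReal_nonneg) (hF.hasSum_ladderMass hy)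
      (fun n => toReal_survival_eq_sum n hy) (toReal_survival_antitone y) hC m
  -- Writing H for the partial sums of h(0): (m + 1) h_m ≤ H_m ≤ H_{n+m} ≤ C (n + m + 1) h_{n+m},
  -- and n + m + 1 ≤ (q + 1)(m + 1).
  have h2 : (survival F m 0).toReal ≤ C * (q + 1) * (survival F (n + m) 0).toReal := by
    have a1 := succ_mul_le_partialSum hF.spitzerSeq.anti m
    have a2 : partialSum (fun n => (survival F n 0).toReal) m ≤
        partialSum (fun n => (survival F n 0).toReal) (n + m) :=
      partialSum_mono hF.spitzerSeq.nonneg (Nat.le_add_left m n)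
    have a3 := hC (n + m)
    have a4 : ((n + m : ℕ) + 1 : ℝ) ≤ (q + 1) * (m + 1) := by
      have : (n : ℝ) ≤ q * (m + 1) := by exact_mod_cast hnm
      push_cast; linarith
    have a5 := mul_le_mul_of_nonneg_right a4 (hF.spitzerSeq.nonneg (n + m))
    have a6 := mul_le_mul_of_nonneg_left a5 (show 0 ≤ C by linarith)
    refine le_of_mul_le_mul_left (a := (m + 1 : ℝ)) ?_ (by positivity)
    linarith
  have h3 : (survival F (n + m) 0).toReal ≤ (survival F (n + m) x).toReal :=
    ENNReal.toReal_mono (survival_ne_top _ _) (survival_mono _ hx)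
  have hCq : 0 ≤ C * (q + 1 : ℝ) := by positivity
  calc (survival F m y).toReal ≤ C * (renewalFn F y).toReal * (survival F m 0).toReal := h1
    _ ≤ C * (renewalFn F y).toReal * (C * (q + 1) * (survival F (n + m) x).toReal) := by
        have := h2.trans (mul_le_mul_of_nonneg_left h3 hCq)
        gcongr
    _ = _ := by ring

lemma CenteredLaw.tendsto_survival_add_div (hF : CenteredLaw F) (k : ℕ) :
    Tendsto (fun j => (survival F (k + j) 0).toReal / (survival F j 0).toReal) atTop (𝓝 1) := by
  rw [tendsto_order]
  constructor
  · intro a ha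
    obtain ⟨η, hη, N, hN⟩ := hF.spitzerSeq.exists_mul_le (half_pos (sub_pos.2 ha))
    filter_upwards [eventually_ge_atTop N,
      tendsto_natCast_atTop_atTop.eventually_ge_atTop ((k : ℝ) / η)] with j hj hj'
    rw [div_le_iff₀ hη] at hj'
    rw [lt_div_iff₀ (hF.survival_zero_pos j)]
    refine lt_of_lt_of_le ?_ (hN j (k + j) hj (Nat.le_add_left _ _) (by push_cast; linarith))
    exact mul_lt_mul_of_pos_right (by linarith) (hF.survival_zero_pos j)
  · intro a ha
    refine Eventually.of_forall fun j => lt_of_le_of_lt ?_ ha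
    rw [div_le_one (hF.survival_zero_pos j)]
    exact toReal_survival_antitone 0 (Nat.le_add_left _ _)

/-- Convergence of the conditional densities. -/
lemma CenteredLaw.tendsto_survival_ratio (hF : CenteredLaw F) (k : ℕ) {x y : ℝ} (hx : 0 ≤ x)
    (hy : 0 ≤ y) :
    Tendsto (fun j => (survival F j y).toReal / (survival F (k + j) x).toReal) atTop
      (𝓝 ((renewalFn F y).toReal / (renewalFn F x).toReal)) := by
  have hV := hF.one_le_renewalFn hx
  have h1 := (hF.tendsto_survival_div hx).comp (tendsto_add_atTop_nat k)
  have h2 := ((hF.tendsto_survival_div hy).div h1 (by linarith)).div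
    (hF.tendsto_survival_add_div k) one_ne_zero
  rw [div_one] at h2
  refine h2.congr fun j => ?_
  have a1 := hF.survival_zero_pos j
  have a2 := hF.survival_zero_pos (k + j)
  have a3 := hF.survival_pos (k + j) hx
  simp only [Pi.div_apply, Function.comp_apply, add_comm j k]
  field_simp

/-- The survival probabilities vary slowly. -/
lemma CenteredLaw.exists_survival_slow (hF : CenteredLaw F) {x : ℝ} (hx : 0 ≤ x) {δ : ℝ}
    (hδ : 0 < δ) : ∃ q : ℕ, 0 < q ∧ ∀ᶠ n in atTop,
      (1 - δ) * (survival F n x).toReal ≤ (survival F (n + n / q) x).toReal := by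
  obtain ⟨κ, hκ, rfl⟩ : ∃ κ : ℝ, 0 < κ ∧ 3 * κ = δ := ⟨δ / 3, by positivity, by ring⟩
  obtain ⟨η, hη, N, hN⟩ := hF.spitzerSeq.exists_mul_le hκ
  -- Extending time by n/(q + 1) stays within the factor 1 + η. Passing from 0 to `x` through the
  -- limit `V` costs (1 - κ)/(1 + κ), so the total factor (1 - κ)²/(1 + κ) is at least 1 - 3κ.
  obtain ⟨q, hq⟩ := exists_nat_one_div_lt hη
  have hV := hF.one_le_renewalFn hx
  set V := (renewalFn F x).toReal with hVdef
  have hlow := (hF.tendsto_survival_div hx).eventually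
    (lt_mem_nhds (show V * (1 - κ) < V by nlinarith))
  have hup := (hF.tendsto_survival_div hx).eventually
    (gt_mem_nhds (show V < V * (1 + κ) by nlinarith))
  obtain ⟨N', hN'⟩ := eventually_atTop.1 (hlow.and hup)
  refine ⟨q + 1, Nat.succ_pos q, ?_⟩
  filter_upwards [eventually_ge_atTop N, eventually_ge_atTop N'] with n hn hn'
  set m := n + n / (q + 1) with hm
  have hnm : n ≤ m := Nat.le_add_right _ _
  rcases le_total 1 κ with hκ1 | hκ1
  · have := hF.survival_pos m hx
    have := hF.survival_pos n hx
    nlinarith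
  · have a1 := (hN' m (hn'.trans hnm)).1.le
    have a2 := (hN' n hn').2.le
    have pm := hF.survival_zero_pos m
    have pn := hF.survival_zero_pos n
    rw [le_div_iff₀ pm] at a1
    rw [div_le_iff₀ pn] at a2
    have a3 : (1 - κ) * (survival F n 0).toReal ≤ (survival F m 0).toReal := by
      refine hN n m hn hnm ?_
      have h1 : ((n / (q + 1) : ℕ) : ℝ) ≤ n / ((q + 1 : ℕ) : ℝ) := Nat.cast_div_le
      have h2 : (n : ℝ) / ((q + 1 : ℕ) : ℝ) ≤ n * η := by
        rw [div_eq_mul_one_div]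
        refine mul_le_mul_of_nonneg_left ?_ (Nat.cast_nonneg n)
        push_cast
        exact hq.le
      rw [hm]
      push_cast
      linarith
    rcases le_total (1 - 3 * κ) 0 with hneg | hpos
    · have := hF.survival_pos m hx
      have := hF.survival_pos n hx
      nlinarith
    · have b1 : (1 - 3 * κ) * (survival F n x).toReal ≤
          (1 - 3 * κ) * (V * (1 + κ) * (survival F n 0).toReal) :=
        mul_le_mul_of_nonneg_left a2 hpos
      have b2 : V * (1 - κ) * ((1 - κ) * (survival F n 0).toReal) ≤
          V * (1 - κ) * (survival F m 0).toReal :=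
        mul_le_mul_of_nonneg_left a3 (mul_nonneg (by linarith) (by linarith))
      have b3 : 0 ≤ 4 * κ ^ 2 * (V * (survival F n 0).toReal) := by positivity
      linarith

end CenteredWalk

end SpinalBRW

namespace SpinalBRW

/-! ### Sequences of independent steps and duality by time reversal. -/

noncomputable section Steps

open Set

variable {E : Type*}

/-- The first `n` terms of a sequence, continued by a constant. -/
def trunc (c : E) (n : ℕ) (b : ℕ → E) : ℕ → E := fun k => if k < n then b k else c

lemma trunc_trunc_of_le (c : E) {m n : ℕ} (h : m ≤ n) (b : ℕ → E) :
    trunc c m (trunc c n b) = trunc c m b := by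
  funext k
  by_cases hk : k < m
  · simp [trunc, hk, hk.trans_le h]
  · simp [trunc, hk]

lemma update_trunc (c : E) (n : ℕ) (b : ℕ → E) :
    Function.update (trunc c n b) n (b n) = trunc c (n + 1) b := by
  funext k
  rcases lt_trichotomy k n with hk | rfl | hk
  · rw [Function.update_of_ne hk.ne]
    simp [trunc, hk, hk.trans (Nat.lt_succ_self n)]
  · simp [trunc]
  · rw [Function.update_of_ne hk.ne']
    simp [trunc, hk.not_gt, Nat.not_lt.2 (Nat.succ_le_of_lt hk)]

/-- Reversal of the first `n` indices. -/
def reversal (n : ℕ) : Equiv.Perm ℕ :=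
  Function.Involutive.toPerm (fun k => if k < n then n - 1 - k else k) fun k => by
    by_cases hk : k < n
    · have h' : n - 1 - k < n := by omega
      simp only [hk, h', if_true]; omega
    · simp [hk]

lemma reversal_apply {n k : ℕ} (hk : k < n) : reversal n k = n - 1 - k :=
  if_pos hk

variable (ζ : E → ℝ)

/-- Positions of the walk with increments `ζ (b k)`, started at `x`. -/
def height (x : ℝ) (b : ℕ → E) (n : ℕ) : ℝ := x + ∑ k ∈ Finset.range n, ζ (b k)

variable {ζ}

@[simp] lemma height_zero (x : ℝ) (b : ℕ → E) : height ζ x b 0 = x := by simp [height]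

lemma height_succ (x : ℝ) (b : ℕ → E) (n : ℕ) :
    height ζ x b (n + 1) = height ζ x b n + ζ (b n) := by
  simp [height, Finset.sum_range_succ, add_assoc]

lemma height_trunc (c : E) (x : ℝ) {n k : ℕ} (hk : k ≤ n) (b : ℕ → E) :
    height ζ x (trunc c n b) k = height ζ x b k := by
  unfold height
  congr 1
  refine Finset.sum_congr rfl fun j hj => ?_
  rw [trunc, if_pos ((Finset.mem_range.1 hj).trans_le hk)]

/-- The duality of random walks: the reversed steps are again i.i.d., and their walk records the
increments of the original one counted back from time `n`. -/
lemma height_reversal (b : ℕ → E) {n k : ℕ} (hk : k ≤ n) :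
    height ζ 0 (fun j => b (reversal n j)) k = height ζ 0 b n - height ζ 0 b (n - k) := by
  induction k with
  | zero => simp
  | succ k ih =>
    rw [height_succ, ih (by omega), reversal_apply (by omega)]
    have : height ζ 0 b (n - k) = height ζ 0 b (n - (k + 1)) + ζ (b (n - 1 - k)) := by
      rw [show n - k = (n - (k + 1)) + 1 by omega, height_succ, show n - (k + 1) = n - 1 - k by omega]
    linarith

variable [MeasurableSpace E]

lemma measurable_trunc (c : E) (n : ℕ) : Measurable (trunc c n) := by
  refine measurable_pi_lambda _ fun k => ?_
  by_cases hk : k < n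
  · simpa [trunc, hk] using measurable_pi_apply k
  · simp [trunc, hk]

/-- In an i.i.d. sequence, the `n`-th term can be integrated out first in a function of the first
`n` terms and of the `n`-th one. -/
lemma lintegral_infinitePi_step (ν : Measure E) [IsProbabilityMeasure ν] (c : E) (n : ℕ)
    {f : (ℕ → E) → E → ℝ≥0∞} (hf : Measurable (Function.uncurry f))
    (htr : ∀ b e, f (trunc c n b) e = f b e) :
    ∫⁻ b, f b (b n) ∂(Measure.infinitePi fun _ : ℕ => ν) =
      ∫⁻ b, ∫⁻ e, f b e ∂ν ∂(Measure.infinitePi fun _ : ℕ => ν) := by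
  set Q := Measure.infinitePi fun _ : ℕ => ν with hQ
  have hind : IndepFun (trunc c n) (fun b : ℕ → E => b n) Q := by
    have h1 : iIndepFun (fun (i : ℕ) (b : ℕ → E) => b i) Q :=
      iIndepFun_infinitePi (P := fun _ : ℕ => ν) (X := fun _ e => e) fun _ => measurable_id
    have h2 := h1.indepFun_finset (Finset.range n) {n} (by simp) fun i => measurable_pi_apply i
    let φ : (Finset.range n → E) → ℕ → E := fun d k =>
      if hk : k < n then d ⟨k, Finset.mem_range.2 hk⟩ else c
    have hφ : Measurable φ := by
      refine measurable_pi_lambda _ fun k => ?_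
      by_cases hk : k < n
      · simpa [φ, hk] using measurable_pi_apply _
      · simp [φ, hk]
    let ψ : (({n} : Finset ℕ) → E) → E := fun d => d ⟨n, Finset.mem_singleton_self n⟩
    have h3 := h2.comp (φ := φ) (ψ := ψ) hφ (measurable_pi_apply (X := fun _ => E) _)
    convert! h3 using 1
  have hmap : Q.map (fun b => (trunc c n b, b n)) = (Q.map (trunc c n)).prod ν := by
    rw [(indepFun_iff_map_prod_eq_prod_map_map (measurable_trunc c n).aemeasurable
      (measurable_pi_apply n).aemeasurable).1 hind, hQ, Measure.infinitePi_map_eval]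
  have hmt := measurable_trunc c n
  have : IsProbabilityMeasure (Q.map (trunc c n)) :=
    Measure.isProbabilityMeasure_map hmt.aemeasurable
  calc ∫⁻ b, f b (b n) ∂Q = ∫⁻ b, Function.uncurry f (trunc c n b, b n) ∂Q :=
        lintegral_congr fun b => (htr b _).symm
    _ = ∫⁻ p, Function.uncurry f p ∂(Q.map fun b => (trunc c n b, b n)) :=
        (lintegral_map hf (hmt.prodMk (measurable_pi_apply n))).symm
    _ = ∫⁻ b, ∫⁻ e, f b e ∂ν ∂(Q.map (trunc c n)) := by
        rw [hmap, lintegral_prod _ hf.aemeasurable]; rfl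
    _ = ∫⁻ b, ∫⁻ e, f (trunc c n b) e ∂ν ∂Q := lintegral_map hf.lintegral_prod_right' hmt
    _ = ∫⁻ b, ∫⁻ e, f b e ∂ν ∂Q := by simp only [htr]

lemma infinitePi_map_perm (ν : Measure E) [IsProbabilityMeasure ν] (π : Equiv.Perm ℕ) :
    (Measure.infinitePi fun _ : ℕ => ν).map (fun b k => b (π k)) =
      Measure.infinitePi fun _ : ℕ => ν := by
  have h := Measure.infinitePi_map_piCongrLeft (fun _ : ℕ => ν) π.symm
  convert! h using 2
  funext b k
  rw [MeasurableEquiv.coe_piCongrLeft]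
  simpa using (Equiv.piCongrLeft_apply_apply (fun _ : ℕ => E) π.symm b (π k)).symm

lemma measurable_height (hζ : Measurable ζ) (x : ℝ) (n : ℕ) :
    Measurable fun b => height ζ x b n :=
  measurable_const.add (Finset.measurable_sum _ fun k _ => hζ.comp (measurable_pi_apply k))

/-- The walk with steps `F`, killed on returning to `[0, ∞)`, has law `belowLaw F`. -/
lemma lintegral_belowLaw {ν : Measure E} [IsProbabilityMeasure ν] (hζ : Measurable ζ)
    {F : Measure ℝ} [IsProbabilityMeasure F] (hF : ν.map ζ = F) (n : ℕ) {g : ℝ → ℝ≥0∞}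
    (hg : Measurable g) :
    ∫⁻ b, {b : ℕ → E | ∀ k < n, height ζ 0 b (k + 1) < 0}.indicator
        (fun b => g (height ζ 0 b n)) b ∂(Measure.infinitePi fun _ : ℕ => ν) =
      ∫⁻ y, g y ∂(belowLaw F n).toMeasure := by
  have hmS : ∀ n, MeasurableSet {b : ℕ → E | ∀ k < n, height ζ 0 b (k + 1) < 0} := fun n => by
    simp only [ofPred_forall]
    exact MeasurableSet.iInter fun k => MeasurableSet.iInter fun _ =>
      measurable_height hζ 0 (k + 1) measurableSet_Iio
  obtain ⟨c⟩ : Nonempty E := ν.nonempty_of_neZero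
  induction n generalizing g with
  | zero => simp [belowLaw, killedPow, lintegral_dirac' _ hg]
  | succ n ih =>
    set g' : ℝ → ℝ≥0∞ := (Iio 0).indicator g with hg'
    have hmg' : Measurable g' := hg.indicator measurableSet_Iio
    set f : (ℕ → E) → E → ℝ≥0∞ := fun b e =>
      {b : ℕ → E | ∀ k < n, height ζ 0 b (k + 1) < 0}.indicator
        (fun b => g' (height ζ 0 b n + ζ e)) b with hfdef
    have hf : Measurable (Function.uncurry f) := by
      have h1 : Measurable fun p : (ℕ → E) × E => g' (height ζ 0 p.1 n + ζ p.2) :=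
        hmg'.comp (((measurable_height hζ 0 n).comp measurable_fst).add
          (hζ.comp measurable_snd))
      exact h1.indicator (measurable_fst (hmS n))
    have htr : ∀ b e, f (trunc c n b) e = f b e := fun b e => by
      have h2 : (trunc c n b ∈ {b : ℕ → E | ∀ k < n, height ζ 0 b (k + 1) < 0}) ↔
          b ∈ {b : ℕ → E | ∀ k < n, height ζ 0 b (k + 1) < 0} :=
        forall₂_congr fun k hk => by rw [height_trunc c 0 hk]
      simp only [hfdef, indicator, h2, height_trunc c 0 le_rfl]
    have e1 : ∀ b : ℕ → E, {b : ℕ → E | ∀ k < n + 1, height ζ 0 b (k + 1) < 0}.indicator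
        (fun b => g (height ζ 0 b (n + 1))) b = f b (b n) := fun b => by
      simp only [hfdef, hg', indicator, mem_ofPred_eq, mem_Iio, ← height_succ, Nat.forall_lt_succ_right]
      split_ifs <;> first | rfl | tauto
    have e2 : ∀ b, ∫⁻ e, f b e ∂ν =
        {b : ℕ → E | ∀ k < n, height ζ 0 b (k + 1) < 0}.indicator
          (fun b => (fun z => ∫⁻ y, g' (z + y) ∂F) (height ζ 0 b n)) b := fun b => by
      by_cases hb : b ∈ {b : ℕ → E | ∀ k < n, height ζ 0 b (k + 1) < 0}
      · simp only [hfdef, indicator, hb, if_true]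
        rw [← hF, lintegral_map (f := fun y => g' (height ζ 0 b n + y))
          (hmg'.comp (measurable_const_add _)) hζ]
      · simp only [hfdef, indicator, hb, if_false, lintegral_zero]
    rw [lintegral_congr e1, lintegral_infinitePi_step ν c n hf htr, lintegral_congr e2,
      ih (g := fun z => ∫⁻ y, g' (z + y) ∂F)
        (Measurable.lintegral_prod_right' (f := fun p : ℝ × ℝ => g' (p.1 + p.2))
          (hmg'.comp measurable_add)),
      ← Measure.lintegral_conv hmg', hg', lintegral_indicator measurableSet_Iio]
    rfl

/-- The probability of a strict descending ladder epoch at `n`, with height at least `-y`. -/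
lemma infinitePi_ladder {ν : Measure E} [IsProbabilityMeasure ν] (hζ : Measurable ζ)
    {F : Measure ℝ} [IsProbabilityMeasure F] (hF : ν.map ζ = F) (n : ℕ) (y : ℝ) :
    Measure.infinitePi (fun _ : ℕ => ν)
      {b | -y ≤ height ζ 0 b n ∧ ∀ k < n, height ζ 0 b n < height ζ 0 b k} = ladderMass F n y := by
  have hm := measurable_height hζ 0
  have hmS : MeasurableSet
      {b : ℕ → E | -y ≤ height ζ 0 b n ∧ ∀ k < n, height ζ 0 b (k + 1) < 0} := by
    simp only [ofPred_and, ofPred_forall]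
    exact (measurableSet_le measurable_const (hm n)).inter
      (MeasurableSet.iInter fun k => MeasurableSet.iInter fun _ =>
        measurableSet_lt (hm (k + 1)) measurable_const)
  have hmrev : Measurable fun (b : ℕ → E) k => b (reversal n k) :=
    measurable_pi_lambda _ fun k => measurable_pi_apply _
  -- A strict minimum at time `n` becomes, in the reversed walk, staying strictly below 0 at the
  -- times 1, …, n, with the same endpoint.
  have h1 : {b : ℕ → E | -y ≤ height ζ 0 b n ∧ ∀ k < n, height ζ 0 b n < height ζ 0 b k} =
      (fun (b : ℕ → E) k => b (reversal n k)) ⁻¹'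
        {b | -y ≤ height ζ 0 b n ∧ ∀ k < n, height ζ 0 b (k + 1) < 0} := by
    ext b
    simp only [mem_ofPred_eq, mem_preimage, height_reversal b le_rfl, Nat.sub_self, height_zero,
      sub_zero]
    refine and_congr_right fun _ => ⟨fun h k hk => ?_, fun h k hk => ?_⟩
    · rw [height_reversal b hk]
      linarith [h (n - (k + 1)) (by omega)]
    · have := h (n - (k + 1)) (by omega)
      rw [height_reversal b (by omega), show n - (n - (k + 1) + 1) = k by omega] at this
      linarith
  rw [h1, ← Measure.map_apply hmrev hmS, infinitePi_map_perm, ladderMass,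
    ← lintegral_indicator_one hmS, ← lintegral_indicator_one measurableSet_Ici,
    ← lintegral_belowLaw hζ hF n (measurable_one.indicator measurableSet_Ici)]
  refine lintegral_congr fun b => ?_
  simp only [indicator, mem_ofPred_eq, mem_Ici, Pi.one_apply]
  split_ifs <;> first | rfl | tauto

end Steps

end SpinalBRW

namespace SpinalBRW

/-! ### The spine of the branching walk as a centered random walk. -/

noncomputable section Spine

open Set

/-- The displacement of the spine in one step. -/
def stepHeight (e : Offspring × ℕ) : ℝ := (e.1 e.2).untopD 0

/-- The law of the displacement of the spine in one step. -/
def stepLaw (Θ : Measure Offspring) : Measure ℝ := (spineStep Θ).map stepHeight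

lemma measurable_apply_prod : Measurable fun e : Offspring × ℕ => e.1 e.2 :=
  measurable_from_prod_countable_left fun i => measurable_pi_apply i

lemma measurable_stepHeight : Measurable stepHeight :=
  (WithTop.measurable_untopD 0).comp measurable_apply_prod

variable {Θ : Measure Offspring}

/-- The normalization of the choice of the child cancels the size-biasing. Where the weight is 0
both densities vanish, and it is infinite only on a null set. -/
lemma BoundaryCase.spineStep_eq (h : BoundaryCase Θ) :
    spineStep Θ = (Θ.prod Measure.count).withDensity
      fun p => ENNReal.ofReal (expNeg (p.1 p.2)) := by
  have hw := measurable_weight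
  have he : Measurable fun p : Offspring × ℕ => ENNReal.ofReal (expNeg (p.1 p.2)) :=
    (measurable_expNeg.comp measurable_apply_prod).ennreal_ofReal
  have hw1 : Measurable fun p : Offspring × ℕ => weight p.1 := hw.comp measurable_fst
  rw [spineStep, sizeBiased, prod_withDensity_left hw, ← withDensity_mul _ hw1
    (g := fun p => ENNReal.ofReal (expNeg (p.1 p.2)) / weight p.1) (he.div hw1)]
  refine withDensity_congr_ae ?_
  have hfin : ∀ᵐ v ∂Θ, weight v < ∞ :=
    ae_lt_top hw (by rw [h.normalized]; exact ENNReal.one_ne_top)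
  filter_upwards [Measure.quasiMeasurePreserving_fst.ae hfin] with p hp
  simp only [Pi.mul_apply]
  by_cases h0 : weight p.1 = 0
  · have : ENNReal.ofReal (expNeg (p.1 p.2)) ≤ weight p.1 :=
      ENNReal.le_tsum (f := fun i => ENNReal.ofReal (expNeg (p.1 i))) p.2
    rw [h0] at this
    rw [h0, zero_mul, le_antisymm this zero_le]
  · rw [ENNReal.mul_div_cancel h0 hp.ne]

lemma BoundaryCase.ae_ne_top (h : BoundaryCase Θ) : ∀ᵐ e ∂spineStep Θ, e.1 e.2 ≠ ⊤ := by
  rw [h.spineStep_eq]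
  have he : Measurable fun p : Offspring × ℕ => ENNReal.ofReal (expNeg (p.1 p.2)) :=
    (measurable_expNeg.comp measurable_apply_prod).ennreal_ofReal
  have hs : MeasurableSet {p : Offspring × ℕ | p.1 p.2 ≠ ⊤} :=
    (measurable_apply_prod (measurableSet_singleton _)).compl
  rw [ae_withDensity_iff he]
  refine Eventually.of_forall fun p hp ht => hp ?_
  simp [expNeg, ht]

lemma BoundaryCase.lintegral_spineStep (h : BoundaryCase Θ) {f : Offspring × ℕ → ℝ≥0∞}
    (hf : Measurable f) : ∫⁻ e, f e ∂spineStep Θ =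
      ∫⁻ v, ∑' i, ENNReal.ofReal (expNeg (v i)) * f (v, i) ∂Θ := by
  have he : Measurable fun p : Offspring × ℕ => ENNReal.ofReal (expNeg (p.1 p.2)) :=
    (measurable_expNeg.comp measurable_apply_prod).ennreal_ofReal
  rw [h.spineStep_eq, lintegral_withDensity_eq_lintegral_mul _ he hf,
    lintegral_prod _ (he.mul hf).aemeasurable]
  simp [lintegral_count]

lemma expNeg_nonneg (y : WithTop ℝ) : 0 ≤ expNeg y := by
  unfold expNeg; split_ifs <;> positivity

lemma BoundaryCase.lintegral_sq (h : BoundaryCase Θ) :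
    ∫⁻ y, ENNReal.ofReal (y ^ 2) ∂stepLaw Θ =
      ∫⁻ v, ∑' i, ENNReal.ofReal ((v i).untopD 0 ^ 2 * expNeg (v i)) ∂Θ := by
  rw [stepLaw, lintegral_map (by fun_prop) measurable_stepHeight,
    h.lintegral_spineStep (measurable_stepHeight.pow_const 2).ennreal_ofReal]
  refine lintegral_congr fun v => tsum_congr fun i => ?_
  rw [stepHeight, mul_comm, ← ENNReal.ofReal_mul (sq_nonneg _)]

variable [IsProbabilityMeasure Θ]

lemma BoundaryCase.isProbabilityMeasure_stepLaw (h : BoundaryCase Θ) :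
    IsProbabilityMeasure (stepLaw Θ) := by
  have := isProbabilityMeasure_spineStep Θ h
  exact Measure.isProbabilityMeasure_map measurable_stepHeight.aemeasurable

/-- Under the size-biased law, the spine performs a centered random walk with finite variance. -/
lemma BoundaryCase.centeredLaw (h : BoundaryCase Θ) : CenteredLaw (stepLaw Θ) := by
  have := h.isProbabilityMeasure_stepLaw
  have := isProbabilityMeasure_spineStep Θ h
  have hsq : Integrable (fun y => y ^ 2) (stepLaw Θ) := by
    refine ⟨by fun_prop, ?_⟩
    rw [hasFiniteIntegral_iff_ofReal (ae_of_all _ fun y => sq_nonneg y), h.lintegral_sq]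
    exact h.variance_lt_top
  refine ⟨?_, hsq, ?_⟩
  -- The second moment gives integrability of the first, which is what allows Fubini to unfold the
  -- mean into the integral of sums in `centered`.
  · have hint : Integrable (fun y => y) (stepLaw Θ) :=
      ((memLp_two_iff_integrable_sq measurable_id.aestronglyMeasurable).2 hsq).integrable
        (by norm_num)
    have hint' : Integrable stepHeight (spineStep Θ) :=
      (integrable_map_measure measurable_id.aestronglyMeasurable
        measurable_stepHeight.aemeasurable).1 hint
    have he : Measurable fun p : Offspring × ℕ => ENNReal.ofReal (expNeg (p.1 p.2)) :=
      (measurable_expNeg.comp measurable_apply_prod).ennreal_ofReal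
    rw [h.spineStep_eq, integrable_withDensity_iff_integrable_smul' he
      (ae_of_all _ fun _ => ENNReal.ofReal_lt_top)] at hint'
    rw [stepLaw, integral_map (f := fun y => y) measurable_stepHeight.aemeasurable
      measurable_id.aestronglyMeasurable, h.spineStep_eq,
      integral_withDensity_eq_integral_toReal_smul he (ae_of_all _ fun _ => ENNReal.ofReal_lt_top),
      integral_prod _ hint', ← h.centered]
    refine integral_congr_ae ?_
    filter_upwards [hint'.prod_right_ae] with v hv
    rw [integral_countable hv]
    refine tsum_congr fun i => ?_
    simp [stepHeight, Measure.real, ENNReal.toReal_ofReal (expNeg_nonneg _), mul_comm]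
  · rw [integral_eq_lintegral_of_nonneg_ae (ae_of_all _ fun y => sq_nonneg y) (by fun_prop),
      h.lintegral_sq]
    exact ENNReal.toReal_pos h.variance_pos.ne' h.variance_lt_top.ne

/-- The canonical path built from the inputs. -/
def pathOf (x : ℝ) (a : Input) : Path := (positionOf x a, spineOf a)

lemma measurable_pathOf (x : ℝ) : Measurable (pathOf x) :=
  (measurable_pi_lambda _ (measurable_positionOf x)).prodMk
    (measurable_pi_lambda _ measurable_spineOf)

lemma lintegral_starLaw (Θ : Measure Offspring) (x : ℝ) {f : Path → ℝ≥0∞} (hf : Measurable f) :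
    ∫⁻ ω, f ω ∂starLaw Θ x = ∫⁻ a, f (pathOf x a) ∂inputLaw Θ :=
  lintegral_map hf (measurable_pathOf x)

/-- The inputs used up to generation `n`. -/
def truncInput (n : ℕ) (a : Input) : Input := (a.1, trunc (fun _ => 0, 0) n a.2)

lemma length_spineOf (a : Input) (n : ℕ) : (spineOf a n).length = n := by
  induction n with
  | zero => rfl
  | succ n ih => simp [spineOf, ih]

lemma spineOf_truncInput (a : Input) {k n : ℕ} (hk : k ≤ n) :
    spineOf (truncInput n a) k = spineOf a k := by
  induction k with
  | zero => rfl
  | succ k ih =>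
    rw [spineOf, spineOf, ih (by omega)]
    simp [truncInput, trunc, Nat.lt_of_succ_le hk]

lemma positionOf_truncInput (x : ℝ) (a : Input) {n : ℕ} {u : Vertex} (hu : u.length ≤ n) :
    positionOf x (truncInput n a) u = positionOf x a u := by
  induction u with
  | nil => rfl
  | cons i u ih =>
    have hu' : u.length < n := by simpa using hu
    rw [positionOf, positionOf, ih hu'.le, spineOf_truncInput a hu'.le]
    simp [truncInput, trunc, hu']

/-- Events of generation `n` depend only on the inputs used up to that generation. -/
lemma mem_iff_of_measurableSet (x : ℝ) {n : ℕ} {A : Set Path}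
    (hA : MeasurableSet[canonicalFiltration n] A) (a : Input) :
    pathOf x (truncInput n a) ∈ A ↔ pathOf x a ∈ A := by
  -- The sets that do not see the truncation form a σ-algebra, so only generators need checking.
  let m : MeasurableSpace Path :=
    { MeasurableSet' := fun A => pathOf x (truncInput n a) ∈ A ↔ pathOf x a ∈ A
      measurableSet_empty := Iff.rfl
      measurableSet_compl := fun _ h => not_congr h
      measurableSet_iUnion := fun f h => by
        simp only [mem_iUnion]
        exact exists_congr h }
  have hle : canonicalFiltration n ≤ m := by
    refine sup_le (iSup₂_le fun u hu => ?_) (iSup₂_le fun k hk => ?_)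
    · rintro _ ⟨B, _, rfl⟩
      change positionOf x (truncInput n a) u ∈ B ↔ positionOf x a u ∈ B
      rw [positionOf_truncInput x a hu]
    · rintro _ ⟨B, _, rfl⟩
      change spineOf (truncInput n a) k ∈ B ↔ spineOf a k ∈ B
      rw [spineOf_truncInput a hk]
  exact hle A hA

lemma apply_truncInput_of_measurable (x : ℝ) {n : ℕ} {Z : Path → ℝ≥0∞}
    (hZ : Measurable[canonicalFiltration n] Z) (a : Input) :
    Z (pathOf x (truncInput n a)) = Z (pathOf x a) :=
  (mem_iff_of_measurableSet x (hZ (measurableSet_singleton (Z (pathOf x a)))) a).2 rfl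

/-- The real position of the spine. Paths whose spine is not a line of descent, a null event, are
given the value `0`, so that this only depends on the first `n` generations. -/
def spineHeight (n : ℕ) (ω : Path) : ℝ :=
  if (ω.2 n).length = n then (ω.1 (ω.2 n)).untopD 0 else 0

/-- The event that the spine stays nonnegative up to time `n`, in terms of `spineHeight`. -/
def stayHeight (n : ℕ) : Set Path := {ω | ∀ k ≤ n, 0 ≤ spineHeight k ω}

lemma measurable_spineHeight (n : ℕ) : Measurable[canonicalFiltration n] (spineHeight n) := by
  intro B hB
  have hpos : ∀ u : Vertex, u.length ≤ n → Measurable[canonicalFiltration n] fun ω : Path => ω.1 u :=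
    fun u hu => Measurable.mono (comap_measurable _)
      (le_sup_of_le_left (le_iSup₂_of_le u hu le_rfl)) le_rfl
  have hsp : Measurable[canonicalFiltration n] fun ω : Path => ω.2 n :=
    Measurable.mono (comap_measurable _) (le_sup_of_le_right (le_iSup₂_of_le n le_rfl le_rfl)) le_rfl
  have : spineHeight n ⁻¹' B = ⋃ u : Vertex, (fun ω : Path => ω.2 n) ⁻¹' {u} ∩
      {ω | (if u.length = n then (ω.1 u).untopD 0 else 0) ∈ B} := by
    ext ω
    simp only [mem_preimage, mem_iUnion, mem_inter_iff, mem_singleton_iff, mem_ofPred_eq]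
    exact ⟨fun h => ⟨ω.2 n, rfl, h⟩, by rintro ⟨u, rfl, h⟩; exact h⟩
  rw [this]
  refine MeasurableSet.iUnion fun u => (hsp (measurableSet_singleton u)).inter ?_
  by_cases hu : u.length = n
  · simp only [hu, if_true]
    exact ((WithTop.measurable_untopD 0).comp (hpos u hu.le)) hB
  · simp only [hu, if_false]
    exact MeasurableSet.const _

lemma measurable_spineHeight_of_le {k n : ℕ} (hk : k ≤ n) :
    Measurable[canonicalFiltration n] (spineHeight k) :=
  (measurable_spineHeight k).mono (canonicalFiltration.mono hk) le_rfl

lemma measurableSet_stayHeight (n : ℕ) : MeasurableSet[canonicalFiltration n] (stayHeight n) := by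
  have : stayHeight n = ⋂ k : ℕ, ⋂ _ : k ≤ n, spineHeight k ⁻¹' Ici 0 := by
    ext ω
    simp [stayHeight]
  rw [this]
  exact MeasurableSet.iInter fun k => MeasurableSet.iInter fun hk =>
    measurable_spineHeight_of_le hk measurableSet_Ici

lemma spinePos_pathOf (x : ℝ) {a : Input} (ha : ∀ k, (a.2 k).1 (a.2 k).2 ≠ ⊤) (n : ℕ) :
    spinePos n (pathOf x a) = ((height stepHeight x a.2 n : ℝ) : WithTop ℝ) := by
  induction n with
  | zero => simp [spinePos, pathOf, spineOf, positionOf]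
  | succ n ih =>
    change positionOf x a (spineOf a n) = _ at ih
    change positionOf x a (spineOf a (n + 1)) = _
    rw [spineOf, positionOf, length_spineOf, if_pos rfl, ih, height_succ, WithTop.coe_add]
    congr 1
    obtain ⟨y, hy⟩ := WithTop.ne_top_iff_exists.1 (ha n)
    rw [stepHeight, ← hy, WithTop.untopD_coe]

lemma spineHeight_pathOf (x : ℝ) {a : Input} (ha : ∀ k, (a.2 k).1 (a.2 k).2 ≠ ⊤) (n : ℕ) :
    spineHeight n (pathOf x a) = height stepHeight x a.2 n := by
  have h := spinePos_pathOf x ha n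
  rw [spinePos] at h
  rw [spineHeight, h, WithTop.untopD_coe]
  exact if_pos (length_spineOf a n)

lemma mem_stayHeight_pathOf (x : ℝ) {a : Input} (ha : ∀ k, (a.2 k).1 (a.2 k).2 ≠ ⊤) (n : ℕ) :
    pathOf x a ∈ stayHeight n ↔ ∀ k ≤ n, 0 ≤ height stepHeight x a.2 k :=
  forall₂_congr fun k _ => by rw [spineHeight_pathOf x ha]

lemma BoundaryCase.ae_infinitePi_ne_top (h : BoundaryCase Θ) :
    ∀ᵐ b ∂(Measure.infinitePi fun _ : ℕ => spineStep Θ), ∀ k, (b k).1 (b k).2 ≠ ⊤ := by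
  have := isProbabilityMeasure_spineStep Θ h
  rw [ae_all_iff]
  intro k
  exact (measurePreserving_eval_infinitePi (fun _ : ℕ => spineStep Θ)
    k).quasiMeasurePreserving.ae h.ae_ne_top

lemma BoundaryCase.ae_input_ne_top (h : BoundaryCase Θ) :
    ∀ᵐ a ∂inputLaw Θ, ∀ k, (a.2 k).1 (a.2 k).2 ≠ ⊤ := by
  have := isProbabilityMeasure_spineStep Θ h
  exact Measure.quasiMeasurePreserving_snd.ae h.ae_infinitePi_ne_top

/-- Almost surely under `P*_x`, the spine has real positions. -/
lemma BoundaryCase.ae_spinePos_eq (h : BoundaryCase Θ) (x : ℝ) :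
    ∀ᵐ ω ∂starLaw Θ x, ∀ n, spinePos n ω = ((spineHeight n ω : ℝ) : WithTop ℝ) := by
  have hm : MeasurableSet {ω : Path | ∀ n, spinePos n ω = ((spineHeight n ω : ℝ) : WithTop ℝ)} := by
    simp only [ofPred_forall]
    refine MeasurableSet.iInter fun n => measurableSet_eq_fun ?_ ?_
    · exact (measurable_from_prod_countable_left
        (f := fun p : (Vertex → WithTop ℝ) × Vertex => p.1 p.2) fun u => measurable_pi_apply u).comp
          (measurable_fst.prodMk ((measurable_pi_apply n).comp measurable_snd))
    · exact WithTop.measurable_coe.comp ((measurable_spineHeight n).mono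
        (canonicalFiltration.le n) le_rfl)
  refine (ae_map_iff (measurable_pathOf x).aemeasurable hm).2 ?_
  filter_upwards [h.ae_input_ne_top] with a ha n
  rw [spineHeight_pathOf x ha, spinePos_pathOf x ha]

lemma BoundaryCase.ae_mem_stayNonneg_iff (h : BoundaryCase Θ) (x : ℝ) :
    ∀ᵐ ω ∂starLaw Θ x, ∀ n, ω ∈ stayNonneg n ↔ ω ∈ stayHeight n := by
  filter_upwards [h.ae_spinePos_eq x] with ω hω n
  exact forall₂_congr fun k _ => by rw [hω]; exact WithTop.coe_nonneg

/-- The renewal function of the spine is that of the walk with steps `stepLaw Θ`. -/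
lemma BoundaryCase.renewal_eq (h : BoundaryCase Θ) (y : ℝ) :
    haveI := h.isProbabilityMeasure_stepLaw
    renewal Θ y = renewalFn (stepLaw Θ) y := by
  have := h.isProbabilityMeasure_stepLaw
  have := isProbabilityMeasure_spineStep Θ h
  refine tsum_congr fun n => ?_
  have hm := measurable_height measurable_stepHeight 0
  have hS : MeasurableSet {ω : Path | -y ≤ spineHeight n ω ∧
      ∀ k < n, spineHeight n ω < spineHeight k ω} := by
    have hmh : ∀ k, Measurable (spineHeight k) := fun k =>
      (measurable_spineHeight k).mono (canonicalFiltration.le k) le_rfl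
    simp only [ofPred_and, ofPred_forall]
    exact (measurableSet_le measurable_const (hmh n)).inter
      (MeasurableSet.iInter fun k => MeasurableSet.iInter fun _ => measurableSet_lt (hmh n) (hmh k))
  have hT : MeasurableSet {b : ℕ → Offspring × ℕ | -y ≤ height stepHeight 0 b n ∧
      ∀ k < n, height stepHeight 0 b n < height stepHeight 0 b k} := by
    simp only [ofPred_and, ofPred_forall]
    exact (measurableSet_le measurable_const (hm n)).inter
      (MeasurableSet.iInter fun k => MeasurableSet.iInter fun _ => measurableSet_lt (hm n) (hm k))
  calc starLaw Θ 0 {ω | ((-y : ℝ) : WithTop ℝ) ≤ spinePos n ω ∧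
        ∀ k < n, spinePos n ω < spinePos k ω}
      = starLaw Θ 0 {ω | -y ≤ spineHeight n ω ∧ ∀ k < n, spineHeight n ω < spineHeight k ω} := by
        refine measure_congr ?_
        filter_upwards [h.ae_spinePos_eq 0] with ω hω
        refine propext (and_congr ?_ (forall₂_congr fun k _ => ?_))
        · rw [hω]; exact WithTop.coe_le_coe
        · rw [hω, hω]; exact WithTop.coe_lt_coe
    _ = inputLaw Θ (pathOf 0 ⁻¹' {ω | -y ≤ spineHeight n ω ∧
          ∀ k < n, spineHeight n ω < spineHeight k ω}) :=
        Measure.map_apply (measurable_pathOf 0) hS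
    _ = inputLaw Θ (Prod.snd ⁻¹' {b : ℕ → Offspring × ℕ | -y ≤ height stepHeight 0 b n ∧
          ∀ k < n, height stepHeight 0 b n < height stepHeight 0 b k}) := by
        refine measure_congr ?_
        filter_upwards [h.ae_input_ne_top] with a ha
        refine propext (and_congr ?_ (forall₂_congr fun k _ => ?_))
        · rw [spineHeight_pathOf 0 ha]
        · rw [spineHeight_pathOf 0 ha, spineHeight_pathOf 0 ha]
    _ = ladderMass (stepLaw Θ) n y := by
        rw [← infinitePi_ladder measurable_stepHeight (ν := spineStep Θ)
            (F := stepLaw Θ) rfl n y,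
          ← Measure.map_apply measurable_snd hT, inputLaw, Measure.map_snd_prod, measure_univ,
          one_smul]

/-- The Markov property of the spine. -/
lemma BoundaryCase.lintegral_starLaw_step (h : BoundaryCase Θ) (x : ℝ) (n : ℕ)
    {Z : Path → ℝ≥0∞} (hZ : Measurable[canonicalFiltration n] Z) {g : ℝ → ℝ≥0∞}
    (hg : Measurable g) :
    ∫⁻ ω, Z ω * (stayHeight (n + 1)).indicator (fun ω => g (spineHeight (n + 1) ω)) ω
        ∂starLaw Θ x =
      ∫⁻ ω, Z ω * (stayHeight n).indicator (fun ω => walkOp (stepLaw Θ) g (spineHeight n ω)) ω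
        ∂starLaw Θ x := by
  have := h.isProbabilityMeasure_stepLaw
  have := isProbabilityMeasure_spineStep Θ h
  have hmh : ∀ k, Measurable (spineHeight k) := fun k =>
    (measurable_spineHeight k).mono (canonicalFiltration.le k) le_rfl
  have hmS : ∀ k, MeasurableSet (stayHeight k) := fun k =>
    canonicalFiltration.le k _ (measurableSet_stayHeight k)
  have hmZ : Measurable Z := hZ.mono (canonicalFiltration.le n) le_rfl
  have hm := measurable_height measurable_stepHeight x
  have hmW := measurable_walkOp (F := stepLaw Θ) hg
  have hl : Measurable fun ω => Z ω * (stayHeight (n + 1)).indicator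
      (fun ω => g (spineHeight (n + 1) ω)) ω :=
    hmZ.mul ((hg.comp (hmh (n + 1))).indicator (hmS (n + 1)))
  have hr : Measurable fun ω => Z ω * (stayHeight n).indicator
      (fun ω => walkOp (stepLaw Θ) g (spineHeight n ω)) ω :=
    hmZ.mul ((hmW.comp (hmh n)).indicator (hmS n))
  rw [lintegral_starLaw Θ x hl, lintegral_starLaw Θ x hr]
  let S : Set (ℕ → Offspring × ℕ) := {b | ∀ k ≤ n, 0 ≤ height stepHeight x b k}
  have hS : MeasurableSet S := by
    simp only [S, ofPred_forall]
    exact MeasurableSet.iInter fun k => MeasurableSet.iInter fun _ =>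
      measurableSet_le measurable_const (hm k)
  let g' : ℝ → ℝ≥0∞ := (Ici 0).indicator g
  have hg' : Measurable g' := hg.indicator measurableSet_Ici
  -- The spine step of generation `n` is separated as a free variable `e`; the rest depends only on
  -- earlier spine steps and on the off-spine vectors, which are fixed when `e` is integrated out.
  let f : Input → Offspring × ℕ → ℝ≥0∞ := fun a e =>
    Z (pathOf x a) * S.indicator (fun b => g' (height stepHeight x b n + stepHeight e)) a.2
  have hf : Measurable (Function.uncurry f) := by
    refine (hmZ.comp ((measurable_pathOf x).comp measurable_fst)).mul ?_
    have h1 : Measurable fun p : Input × (Offspring × ℕ) =>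
        g' (height stepHeight x p.1.2 n + stepHeight p.2) :=
      hg'.comp (((hm n).comp (measurable_snd.comp measurable_fst)).add
        (measurable_stepHeight.comp measurable_snd))
    exact h1.indicator ((measurable_snd.comp measurable_fst) hS)
  have e1 : ∀ᵐ a ∂inputLaw Θ, Z (pathOf x a) * (stayHeight (n + 1)).indicator
      (fun ω => g (spineHeight (n + 1) ω)) (pathOf x a) = f a (a.2 n) := by
    filter_upwards [h.ae_input_ne_top] with a ha
    simp only [f, g', S, indicator, mem_stayHeight_pathOf x ha, spineHeight_pathOf x ha, mem_Ici,
      ← height_succ, mem_ofPred_eq, Nat.le_succ_iff_eq_or_le, forall_eq_or_imp]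
    congr 1
    split_ifs <;> first | rfl | tauto
  have e2 : ∀ᵐ a ∂inputLaw Θ, Z (pathOf x a) * (stayHeight n).indicator
      (fun ω => walkOp (stepLaw Θ) g (spineHeight n ω)) (pathOf x a) =
        ∫⁻ e, f a e ∂spineStep Θ := by
    filter_upwards [h.ae_input_ne_top] with a ha
    simp only [f, indicator, mem_stayHeight_pathOf x ha, spineHeight_pathOf x ha]
    rw [lintegral_const_mul _ (by
      by_cases hb : a.2 ∈ S
      · simp only [hb, if_true]
        exact hg'.comp (measurable_stepHeight.const_add _)
      · simp only [hb, if_false]; exact measurable_const)]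
    congr 1
    by_cases hb : a.2 ∈ S
    · rw [if_pos (show ∀ k ≤ n, 0 ≤ height stepHeight x a.2 k from hb)]
      simp only [hb, if_true]
      rw [walkOp, stepLaw, lintegral_map
        (f := fun y => (Ici 0).indicator g (height stepHeight x a.2 n + y))
        (hg'.comp (measurable_const_add _)) measurable_stepHeight]
    · rw [if_neg (show ¬ ∀ k ≤ n, 0 ≤ height stepHeight x a.2 k from hb)]
      simp [hb]
  have hfd : Measurable fun a : Input => f a (a.2 n) :=
    hf.comp (measurable_id.prodMk ((measurable_pi_apply n).comp measurable_snd))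
  have hfi : Measurable fun a : Input => ∫⁻ e, f a e ∂spineStep Θ := hf.lintegral_prod_right'
  rw [lintegral_congr_ae e1, lintegral_congr_ae e2, inputLaw,
    lintegral_prod _ hfd.aemeasurable, lintegral_prod _ hfi.aemeasurable]
  refine lintegral_congr fun a₁ => ?_
  refine lintegral_infinitePi_step (spineStep Θ) (fun _ => 0, 0) n (f := fun b e => f (a₁, b) e)
    ?_ fun b e => ?_
  · exact hf.comp ((measurable_const.prodMk measurable_fst).prodMk measurable_snd)
  · have h1 := apply_truncInput_of_measurable x hZ (a₁, b)
    have h2 : (trunc (fun _ => 0, 0) n b ∈ S) ↔ b ∈ S :=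
      forall₂_congr fun k hk => by rw [height_trunc _ x hk]
    simp only [truncInput] at h1
    simp only [f, indicator, h1, h2, height_trunc _ x le_rfl]

end Spine

end SpinalBRW

namespace SpinalBRW

/-! ### Doob transform of a sequence of steps. -/

noncomputable section DoobTransform

open Set

variable {E : Type*}

/-- The sequence of the terms `1, …, n` of a finite sequence, continued by a constant. -/
def shiftExtend (c : E) (n : ℕ) (d : Finset.Iic n → E) : ℕ → E := fun k =>
  if h : k < n then d ⟨k + 1, Finset.mem_Iic.2 h⟩ else c

lemma shiftExtend_frestrictLe (c : E) (n : ℕ) (z : ℕ → E) :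
    shiftExtend c n (Preorder.frestrictLe n z) = trunc c n fun k => z (k + 1) := by
  funext k
  by_cases hk : k < n <;> simp [shiftExtend, trunc, hk]

variable [MeasurableSpace E] {ζ : E → ℝ} {ν : Measure E} [IsProbabilityMeasure ν]
  {V : ℝ → ℝ≥0∞}

/-- The law of a step from position `s`, transformed by a function `V` that is harmonic for the walk
killed on leaving `[0, ∞)`. -/
def doobKernel (ζ : E → ℝ) (ν : Measure E) [IsProbabilityMeasure ν] (V : ℝ → ℝ≥0∞) : Kernel ℝ E :=
  Kernel.piecewise (measurableSet_Ici : MeasurableSet (Ici (0 : ℝ)))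
    (Kernel.withDensity (Kernel.const ℝ ν) fun s e => (Ici 0).indicator V (s + ζ e) / V s)
    -- A default value that keeps the kernel Markov at negative positions, where the division by `V
    -- s` is not controlled.
    (Kernel.const ℝ ν)

lemma measurable_doobDensity (hζ : Measurable ζ) (hV : Measurable V) :
    Measurable (Function.uncurry fun s e => (Ici 0).indicator V (s + ζ e) / V s) :=
  ((hV.indicator measurableSet_Ici).comp
    (measurable_fst.add (hζ.comp measurable_snd))).div (hV.comp measurable_fst)

lemma doobKernel_of_nonneg (hζ : Measurable ζ) (hV : Measurable V) {s : ℝ} (hs : 0 ≤ s) :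
    doobKernel ζ ν V s = ν.withDensity fun e => (Ici 0).indicator V (s + ζ e) / V s := by
  rw [doobKernel, Kernel.piecewise_apply, if_pos (mem_Ici.2 hs),
    Kernel.withDensity_apply _ (measurable_doobDensity hζ hV), Kernel.const_apply]

/-- Positive finite harmonic functions of the walk killed on leaving `[0, ∞)`. -/
structure IsHarmonic (F : Measure ℝ) (V : ℝ → ℝ≥0∞) : Prop where
  measurable : Measurable V
  ne_zero : ∀ s, 0 ≤ s → V s ≠ 0
  ne_top : ∀ s, 0 ≤ s → V s ≠ ∞
  walkOp_eq : ∀ s, 0 ≤ s → walkOp F V s = V s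

/-- At `s ≥ 0`, harmonicity says exactly that the density integrates to 1, `V s` being positive and
finite. -/
lemma IsHarmonic.isMarkovKernel_doobKernel (hV : IsHarmonic (ν.map ζ) V) (hζ : Measurable ζ) :
    IsMarkovKernel (doobKernel ζ ν V) := by
  refine ⟨fun s => ?_⟩
  by_cases hs : 0 ≤ s
  · rw [doobKernel_of_nonneg hζ hV.measurable hs]
    refine ⟨?_⟩
    rw [withDensity_apply _ MeasurableSet.univ, Measure.restrict_univ]
    have hm : Measurable fun y => (Ici 0).indicator V (s + y) :=
      (hV.measurable.indicator measurableSet_Ici).comp (measurable_const_add s)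
    have := hV.walkOp_eq s hs
    rw [walkOp, lintegral_map hm hζ] at this
    simp only [div_eq_mul_inv]
    have hm' : Measurable fun e => (Ici 0).indicator V (s + ζ e) := hm.comp hζ
    rw [lintegral_mul_const _ hm', this, ENNReal.mul_inv_cancel (hV.ne_zero s hs)
      (hV.ne_top s hs)]
  · rw [doobKernel, Kernel.piecewise_apply, if_neg (by simpa using hs), Kernel.const_apply]
    infer_instance

lemma measurable_shiftExtend (c : E) (n : ℕ) : Measurable (shiftExtend c n) := by
  refine measurable_pi_lambda _ fun k => ?_
  by_cases hk : k < n
  · simpa [shiftExtend, hk] using measurable_pi_apply _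
  · simp [shiftExtend, hk]

/-- Existence of the transformed sequence of steps, in terms of its transitions. -/
lemma IsHarmonic.exists_step (hV : IsHarmonic (ν.map ζ) V) (hζ : Measurable ζ) (x : ℝ) (c : E) :
    ∃ Q : Measure (ℕ → E), IsProbabilityMeasure Q ∧
      ∀ (n : ℕ) (f : (ℕ → E) → E → ℝ≥0∞), Measurable (Function.uncurry f) →
        (∀ b e, f (trunc c n b) e = f b e) →
        ∫⁻ b, f b (b n) ∂Q = ∫⁻ b, ∫⁻ e, f b e ∂(doobKernel ζ ν V (height ζ x b n)) ∂Q := by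
  have := hV.isMarkovKernel_doobKernel hζ
  let κ : (n : ℕ) → Kernel (Finset.Iic n → E) E := fun n =>
    (doobKernel ζ ν V).comap (fun d => height ζ x (shiftExtend c n d) n)
      ((measurable_height hζ x n).comp (measurable_shiftExtend c n))
  -- The Ionescu-Tulcea construction needs an initial coordinate, here a dummy of law ν. It is
  -- dropped by the shift, so that step `n` is coordinate `n + 1`, drawn from coordinates 1, …, n.
  let T : Measure (ℕ → E) := Kernel.trajMeasure (X := fun _ => E) ν κ
  have hT : IsProbabilityMeasure T := by infer_instance
  have hsh : Measurable fun (z : ℕ → E) k => z (k + 1) :=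
    measurable_pi_lambda _ fun k => measurable_pi_apply (k + 1)
  refine ⟨T.map fun z k => z (k + 1), Measure.isProbabilityMeasure_map hsh.aemeasurable, ?_⟩
  intro n f hf htr
  have hfr : Measurable fun z : ℕ → E => Preorder.frestrictLe (π := fun _ => E) n z :=
    Preorder.measurable_frestrictLe n
  have hmarkov := Kernel.map_frestrictLe_trajMeasure_compProd_eq_map_trajMeasure
    (X := fun _ => E) (μ₀ := ν) (κ := κ) (a := n)
  have hfφ : Measurable fun p : (Finset.Iic n → E) × E => f (shiftExtend c n p.1) p.2 :=
    hf.comp (((measurable_shiftExtend c n).comp measurable_fst).prodMk measurable_snd)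
  have hfd : Measurable fun b : ℕ → E => f b (b n) :=
    hf.comp (measurable_id.prodMk (measurable_pi_apply n))
  have hfk : Measurable fun b : ℕ → E => ∫⁻ e, f b e ∂(doobKernel ζ ν V (height ζ x b n)) :=
    Measurable.lintegral_kernel_prod_right'
      (κ := (doobKernel ζ ν V).comap (fun b => height ζ x b n) (measurable_height hζ x n)) hf
  rw [lintegral_map hfd hsh, lintegral_map hfk hsh]
  calc ∫⁻ z, f (fun k => z (k + 1)) (z (n + 1)) ∂T
      = ∫⁻ z, f (shiftExtend c n (Preorder.frestrictLe n z)) (z (n + 1)) ∂T := by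
        refine lintegral_congr fun z => ?_
        rw [shiftExtend_frestrictLe, htr]
    _ = ∫⁻ p, f (shiftExtend c n p.1) p.2
          ∂(T.map fun z => (Preorder.frestrictLe (π := fun _ => E) n z, z (n + 1))) :=
        (lintegral_map hfφ (hfr.prodMk (measurable_pi_apply (n + 1)))).symm
    _ = ∫⁻ d, ∫⁻ e, f (shiftExtend c n d) e ∂κ n d
          ∂(T.map (Preorder.frestrictLe (π := fun _ => E) n)) := by
        rw [← hmarkov, Measure.lintegral_compProd hfφ]
    _ = ∫⁻ z, ∫⁻ e, f (shiftExtend c n (Preorder.frestrictLe n z)) e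
          ∂κ n (Preorder.frestrictLe n z) ∂T :=
        lintegral_map (Measurable.lintegral_kernel_prod_right' hfφ) hfr
    _ = _ := by
        refine lintegral_congr fun z => ?_
        simp only [κ, Kernel.comap_apply, shiftExtend_frestrictLe, htr, height_trunc c x le_rfl]

/-- Existence of the transformed sequence of steps, in terms of its densities. -/
lemma IsHarmonic.exists_density (hV : IsHarmonic (ν.map ζ) V) (hζ : Measurable ζ) {x : ℝ}
    (hx : 0 ≤ x) (c : E) :
    ∃ Q : Measure (ℕ → E), IsProbabilityMeasure Q ∧
      ∀ (n : ℕ) (f : (ℕ → E) → ℝ≥0∞), Measurable f → (∀ b, f (trunc c n b) = f b) →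
        ∫⁻ b, f b ∂Q = ∫⁻ b, f b * {b | ∀ k ≤ n, 0 ≤ height ζ x b k}.indicator
          (fun b => V (height ζ x b n) / V x) b ∂(Measure.infinitePi fun _ : ℕ => ν) := by
  obtain ⟨Q, hQ, hstep⟩ := hV.exists_step hζ x c
  have := hV.isMarkovKernel_doobKernel hζ
  refine ⟨Q, hQ, fun n => ?_⟩
  have hm := measurable_height hζ x
  let S : ℕ → Set (ℕ → E) := fun n => {b | ∀ k ≤ n, 0 ≤ height ζ x b k}
  have hS : ∀ n, MeasurableSet (S n) := fun n => by
    simp only [S, ofPred_forall]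
    exact MeasurableSet.iInter fun k => MeasurableSet.iInter fun _ =>
      measurableSet_le measurable_const (hm k)
  have hSt : ∀ n b, trunc c n b ∈ S n ↔ b ∈ S n := fun n b =>
    forall₂_congr fun k hk => by rw [height_trunc _ x hk]
  induction n with
  | zero =>
    intro f hf htr
    have h0 : ∀ b, f b = f fun _ => c := fun b => by rw [← htr]; rfl
    have h1 : ∀ b : ℕ → E, {b | ∀ k ≤ 0, 0 ≤ height ζ x b k}.indicator
        (fun b => V (height ζ x b 0) / V x) b = 1 := fun b => by
      simp [indicator, hx, ENNReal.div_self (hV.ne_zero x hx) (hV.ne_top x hx)]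
    simp only [h1, mul_one]
    rw [lintegral_congr h0, lintegral_congr h0]
    simp
  | succ n ih =>
    intro f hf htr
    let f' : (ℕ → E) → E → ℝ≥0∞ := fun b e => f (Function.update (trunc c n b) n e)
    have hf' : Measurable (Function.uncurry f') :=
      hf.comp (measurable_update'.comp
        (((measurable_trunc c n).comp measurable_fst).prodMk measurable_snd))
    have hf'tr : ∀ b e, f' (trunc c n b) e = f' b e := fun b e => by
      simp only [f', trunc_trunc_of_le c le_rfl]
    have hff' : ∀ b, f b = f' b (b n) := fun b => by
      simp only [f', update_trunc, htr]
    have hfk : Measurable fun b : ℕ → E => ∫⁻ e, f' b e ∂(doobKernel ζ ν V (height ζ x b n)) :=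
      Measurable.lintegral_kernel_prod_right'
        (κ := (doobKernel ζ ν V).comap (fun b => height ζ x b n) (hm n)) hf'
    rw [lintegral_congr hff', hstep n f' hf' hf'tr, ih _ hfk fun b => by
      simp only [hf'tr, height_trunc c x le_rfl]]
    let f'' : (ℕ → E) → E → ℝ≥0∞ := fun b e => f' b e * (S n).indicator
      (fun b => (Ici 0).indicator V (height ζ x b n + ζ e) / V x) b
    have hf'' : Measurable (Function.uncurry f'') := by
      refine hf'.mul ?_
      have h1 : Measurable fun p : (ℕ → E) × E =>
          (Ici 0).indicator V (height ζ x p.1 n + ζ p.2) / V x :=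
        ((hV.measurable.indicator measurableSet_Ici).comp
          (((hm n).comp measurable_fst).add (hζ.comp measurable_snd))).div_const _
      exact h1.indicator (measurable_fst (hS n))
    have hf''tr : ∀ b e, f'' (trunc c n b) e = f'' b e := fun b e => by
      by_cases hb : b ∈ S n
      · simp only [f'', hf'tr, indicator_of_mem hb, indicator_of_mem ((hSt n b).2 hb),
          height_trunc c x le_rfl]
      · simp only [f'', hf'tr, indicator_of_notMem hb, indicator_of_notMem (mt (hSt n b).1 hb)]
    have hr : ∀ b, f b * {b | ∀ k ≤ n + 1, 0 ≤ height ζ x b k}.indicator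
        (fun b => V (height ζ x b (n + 1)) / V x) b = f'' b (b n) := fun b => by
      simp only [f'', ← hff', S, indicator, mem_Ici, ← height_succ, mem_ofPred_eq,
        Nat.le_succ_iff_eq_or_le, forall_eq_or_imp]
      congr 1
      split_ifs <;> first | rfl | tauto | simp
    rw [lintegral_congr hr, lintegral_infinitePi_step ν c n hf'' hf''tr]
    refine lintegral_congr fun b => ?_
    by_cases hb : b ∈ S n
    · have hb0 : 0 ≤ height ζ x b n := hb n le_rfl
      have hb' : ∀ k ≤ n, 0 ≤ height ζ x b k := hb
      have hfb : Measurable (f' b) := hf'.comp (measurable_const.prodMk measurable_id)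
      have hd : Measurable fun e => (Ici 0).indicator V (height ζ x b n + ζ e) :=
        (hV.measurable.indicator measurableSet_Ici).comp (hζ.const_add _)
      rw [indicator_of_mem (show b ∈ {b | ∀ k ≤ n, 0 ≤ height ζ x b k} from hb),
        doobKernel_of_nonneg hζ hV.measurable hb0,
        lintegral_withDensity_eq_lintegral_mul _ (hd.div_const _) hfb,
        ← lintegral_mul_const _ ((hd.div_const _).mul hfb)]
      refine lintegral_congr fun e => ?_
      simp only [f'', indicator_of_mem hb, Pi.mul_apply]
      have h0 := hV.ne_zero _ hb0
      have ht := hV.ne_top _ hb0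
      simp only [div_eq_mul_inv]
      -- The product of one-step densities telescopes: the value of `V` at time `n` cancels, which
      -- requires it to be neither zero nor infinite.
      calc _ = f' b e * ((Ici 0).indicator V (height ζ x b n + ζ e) * (V x)⁻¹) *
            ((V (height ζ x b n))⁻¹ * V (height ζ x b n)) := by ring
        _ = _ := by rw [ENNReal.inv_mul_cancel h0 ht, mul_one]
    · rw [indicator_of_notMem (show b ∉ {b | ∀ k ≤ n, 0 ≤ height ζ x b k} from hb), mul_zero]
      simp [f'', hb]

end DoobTransform

end SpinalBRW

namespace SpinalBRW

/-! ### Existence and uniqueness of P⁺, and both changes of measure on finite generations. -/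

noncomputable section PlusLaw

open Set

variable {Θ : Measure Offspring}

lemma measurableSpace_path_eq_generateFrom :
    (inferInstance : MeasurableSpace Path) =
      MeasurableSpace.generateFrom {A | ∃ n, MeasurableSet[canonicalFiltration n] A} := by
  refine le_antisymm ?_ (MeasurableSpace.generateFrom_le ?_)
  · refine sup_le ?_ ?_
    · rw [← measurable_iff_comap_le]
      refine @measurable_pi_lambda _ _ _ (_) _ _ fun u => ?_
      rw [measurable_iff_comap_le]
      rintro A hA
      exact MeasurableSpace.measurableSet_generateFrom ⟨u.length,
        (le_sup_of_le_left (le_iSup₂_of_le u le_rfl le_rfl) :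
          MeasurableSpace.comap (fun ω : Path => ω.1 u) _ ≤ canonicalFiltration u.length) A hA⟩
    · rw [← measurable_iff_comap_le]
      refine @measurable_pi_lambda _ _ _ (_) _ _ fun k => ?_
      rw [measurable_iff_comap_le]
      rintro A hA
      exact MeasurableSpace.measurableSet_generateFrom ⟨k,
        (le_sup_of_le_right (le_iSup₂_of_le k le_rfl le_rfl) :
          MeasurableSpace.comap (fun ω : Path => ω.2 k) _ ≤ canonicalFiltration k) A hA⟩
  · rintro A ⟨n, hA⟩
    exact canonicalFiltration.le n A hA

/-- The filtration is increasing, so the events of finite generations are stable under intersection;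
they generate the σ-algebra and their probabilities are prescribed. -/
lemma IsPlusLaw.unique {x : ℝ} {P P' : Measure Path} (hP : IsPlusLaw Θ x P)
    (hP' : IsPlusLaw Θ x P') : P = P' := by
  have := hP.isProbabilityMeasure
  have := hP'.isProbabilityMeasure
  refine ext_of_generate_finite _ measurableSpace_path_eq_generateFrom ?_ ?_ (by simp)
  · rintro A ⟨m, hA⟩ B ⟨n, hB⟩ -
    exact ⟨max m n, (canonicalFiltration.mono (le_max_left m n) A hA).inter
      (canonicalFiltration.mono (le_max_right m n) B hB)⟩
  · rintro A ⟨n, hA⟩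
    rw [hP.density n A hA, hP'.density n A hA]

variable [IsProbabilityMeasure Θ]

lemma BoundaryCase.isHarmonic_renewal (h : BoundaryCase Θ) :
    IsHarmonic (stepLaw Θ) (renewal Θ) := by
  have := h.isProbabilityMeasure_stepLaw
  have e : renewal Θ = renewalFn (stepLaw Θ) := funext h.renewal_eq
  rw [e]
  exact
    { measurable := measurable_renewalFn
      ne_zero := fun s hs => (zero_lt_one.trans_le (one_le_renewalFn hs)).ne'
      ne_top := fun s hs => h.centeredLaw.renewalFn_ne_top hs
      walkOp_eq := fun s hs => h.centeredLaw.walkOp_renewalFn hs }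

/-- The density of `P⁺_x` with respect to `P*_x` in generation `n`. -/
def plusDensity (Θ : Measure Offspring) (x : ℝ) (n : ℕ) : Path → ℝ≥0∞ :=
  (stayHeight n).indicator fun ω => renewal Θ (spineHeight n ω) / renewal Θ x

lemma BoundaryCase.measurable_plusDensity (h : BoundaryCase Θ) (x : ℝ) (n : ℕ) :
    Measurable[canonicalFiltration n] (plusDensity Θ x n) :=
  ((h.isHarmonic_renewal.measurable.comp (measurable_spineHeight n)).div_const _).indicator
    (measurableSet_stayHeight n)

lemma BoundaryCase.plusDensity_ae_eq (h : BoundaryCase Θ) (x : ℝ) (n : ℕ) :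
    (stayNonneg n).indicator (fun ω => renewal Θ ((spinePos n ω).untopD 0) / renewal Θ x)
      =ᵐ[starLaw Θ x] plusDensity Θ x n := by
  filter_upwards [h.ae_spinePos_eq x, h.ae_mem_stayNonneg_iff x] with ω h1 h2
  by_cases hω : ω ∈ stayHeight n
  · rw [plusDensity, indicator_of_mem hω, indicator_of_mem ((h2 n).2 hω), h1, WithTop.untopD_coe]
  · rw [plusDensity, indicator_of_notMem hω, indicator_of_notMem (mt (h2 n).1 hω)]

/-- The prescribed density is a function of the spine steps alone. Hence only these are transformed,
and the off-spine vectors remain independent of them with law Θ. -/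
lemma BoundaryCase.exists_isPlusLaw (h : BoundaryCase Θ) {x : ℝ} (hx : 0 ≤ x) :
    ∃ P, IsPlusLaw Θ x P := by
  have := isProbabilityMeasure_spineStep Θ h
  obtain ⟨Q, hQ, hd⟩ := h.isHarmonic_renewal.exists_density
    (ν := spineStep Θ) measurable_stepHeight hx (fun _ => 0, 0)
  refine ⟨((Measure.infinitePi fun _ : Vertex => Θ).prod Q).map (pathOf x),
    Measure.isProbabilityMeasure_map (measurable_pathOf x).aemeasurable, fun n A hA => ?_⟩
  have hA' : MeasurableSet A := canonicalFiltration.le n A hA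
  have hD := (h.measurable_plusDensity x n).mono (canonicalFiltration.le n) le_rfl
  have hAm : MeasurableSet (pathOf x ⁻¹' A) := measurable_pathOf x hA'
  rw [setLIntegral_congr_fun_ae hA' ((h.plusDensity_ae_eq x n).mono fun ω hω _ => hω),
    ← lintegral_indicator hA', lintegral_starLaw Θ x (hD.indicator hA'), inputLaw,
    Measure.map_apply (measurable_pathOf x) hA', ← lintegral_indicator_one hAm,
    lintegral_prod _ (measurable_one.indicator hAm).aemeasurable,
    lintegral_prod (fun a => A.indicator (plusDensity Θ x n) (pathOf x a))
      ((hD.indicator hA').comp (measurable_pathOf x)).aemeasurable]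
  refine lintegral_congr fun a₁ => ?_
  rw [hd n (fun b => (pathOf x ⁻¹' A).indicator 1 (a₁, b))
    ((measurable_one.indicator hAm).comp measurable_prodMk_left) fun b => ?_]
  · refine lintegral_congr_ae ?_
    filter_upwards [h.ae_infinitePi_ne_top] with b hb
    have h1 := mem_stayHeight_pathOf x (a := (a₁, b)) hb n
    have h2 := spineHeight_pathOf x (a := (a₁, b)) hb n
    by_cases hb' : ∀ k ≤ n, 0 ≤ height stepHeight x b k
    · rw [indicator_of_mem (show b ∈ {b | ∀ k ≤ n, 0 ≤ height stepHeight x b k} from hb')]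
      by_cases hbA : pathOf x (a₁, b) ∈ A
      · rw [indicator_of_mem hbA, indicator_of_mem (show (a₁, b) ∈ pathOf x ⁻¹' A from hbA),
          plusDensity, indicator_of_mem (h1.2 hb'), h2, Pi.one_apply, one_mul]
      · rw [indicator_of_notMem hbA, indicator_of_notMem (show (a₁, b) ∉ pathOf x ⁻¹' A from hbA),
          zero_mul]
    · rw [indicator_of_notMem (show b ∉ {b | ∀ k ≤ n, 0 ≤ height stepHeight x b k} from hb'),
        mul_zero]
      refine (indicator_apply_eq_zero.2 fun _ => ?_).symm
      rw [plusDensity, indicator_of_notMem (mt h1.1 hb')]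
  · have h1 : (a₁, trunc (fun _ => 0, 0) n b) ∈ pathOf x ⁻¹' A ↔ (a₁, b) ∈ pathOf x ⁻¹' A :=
      mem_iff_of_measurableSet x hA (a₁, b)
    by_cases hb : (a₁, b) ∈ pathOf x ⁻¹' A
    · rw [indicator_of_mem hb, indicator_of_mem (h1.2 hb), Pi.one_apply, Pi.one_apply]
    · rw [indicator_of_notMem hb, indicator_of_notMem (mt h1.1 hb)]

lemma IsPlusLaw.measure_eq (h : BoundaryCase Θ) {x : ℝ} {P : Measure Path}
    (hP : IsPlusLaw Θ x P) {n : ℕ} {A : Set Path} (hA : MeasurableSet[canonicalFiltration n] A) :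
    P A = ∫⁻ ω in A, plusDensity Θ x n ω ∂starLaw Θ x :=
  (hP.density n A hA).trans (setLIntegral_congr_fun_ae (canonicalFiltration.le n A hA)
    ((h.plusDensity_ae_eq x n).mono fun _ hω _ => hω))

lemma BoundaryCase.plusDensity_ne_top (h : BoundaryCase Θ) {x : ℝ} (hx : 0 ≤ x) (n : ℕ)
    (ω : Path) : plusDensity Θ x n ω ≠ ∞ := by
  by_cases hω : ω ∈ stayHeight n
  · rw [plusDensity, indicator_of_mem hω]
    exact ENNReal.div_ne_top (h.isHarmonic_renewal.ne_top _ (hω n le_rfl))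
      (h.isHarmonic_renewal.ne_zero x hx)
  · rw [plusDensity, indicator_of_notMem hω]
    exact ENNReal.zero_ne_top

/-- Change of measure for functions of the first `n` generations. -/
lemma IsPlusLaw.integral_eq (h : BoundaryCase Θ) {x : ℝ} (hx : 0 ≤ x) {P : Measure Path}
    (hP : IsPlusLaw Θ x P) {n : ℕ} {Z : Path → ℝ} (hZ : Measurable[canonicalFiltration n] Z) :
    ∫ ω, Z ω ∂P = ∫ ω, (plusDensity Θ x n ω).toReal * Z ω ∂starLaw Θ x := by
  have hle := canonicalFiltration.le n
  have hD := (h.measurable_plusDensity x n).mono hle le_rfl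
  have e : P.trim hle = ((starLaw Θ x).withDensity (plusDensity Θ x n)).trim hle := by
    refine @Measure.ext _ (canonicalFiltration n) _ _ fun A hA => ?_
    rw [trim_measurableSet_eq hle hA, trim_measurableSet_eq hle hA,
      withDensity_apply _ (hle A hA), hP.measure_eq h hA]
  rw [integral_trim hle hZ.stronglyMeasurable, e, ← integral_trim hle hZ.stronglyMeasurable,
    integral_withDensity_eq_integral_toReal_smul hD
      (ae_of_all _ fun ω => (h.plusDensity_ne_top hx n ω).lt_top)]
  rfl

lemma IsPlusLaw.integrable_plusDensity (h : BoundaryCase Θ) {x : ℝ} {P : Measure Path}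
    (hP : IsPlusLaw Θ x P) (n : ℕ) :
    Integrable (fun ω => (plusDensity Θ x n ω).toReal) (starLaw Θ x) := by
  have := hP.isProbabilityMeasure
  refine integrable_toReal_of_lintegral_ne_top
    ((h.measurable_plusDensity x n).mono (canonicalFiltration.le n) le_rfl).aemeasurable ?_
  have := hP.measure_eq h (n := n) MeasurableSet.univ
  rw [measure_univ, Measure.restrict_univ] at this
  rw [← this]
  exact ENNReal.one_ne_top

lemma IsPlusLaw.ae_of_ae (h : BoundaryCase Θ) {x : ℝ} {P : Measure Path} (hP : IsPlusLaw Θ x P)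
    {n : ℕ} {A : Set Path} (hA : MeasurableSet[canonicalFiltration n] A)
    (hA' : ∀ᵐ ω ∂starLaw Θ x, ω ∈ A) : ∀ᵐ ω ∂P, ω ∈ A := by
  rw [ae_iff]
  change P Aᶜ = 0
  rw [hP.measure_eq h hA.compl]
  exact setLIntegral_measure_zero _ _ hA'

/-- The Markov property over several generations. -/
lemma BoundaryCase.lintegral_starLaw_survival (h : BoundaryCase Θ) (x : ℝ) (n j : ℕ)
    {Z : Path → ℝ≥0∞} (hZ : Measurable[canonicalFiltration n] Z) :
    ∫⁻ ω, Z ω * (stayHeight (n + j)).indicator 1 ω ∂starLaw Θ x =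
      ∫⁻ ω, Z ω * (stayHeight n).indicator
        (fun ω => survival (stepLaw Θ) j (spineHeight n ω)) ω ∂starLaw Θ x := by
  have := h.isProbabilityMeasure_stepLaw
  induction j generalizing n with
  | zero => rfl
  | succ j ih =>
    rw [← Nat.add_assoc, Nat.add_right_comm,
      ih (n + 1) (hZ.mono (canonicalFiltration.mono n.le_succ) le_rfl),
      h.lintegral_starLaw_step x n hZ (measurable_survival j)]
    rfl

/-- The density of the event of survival up to time `n + j`, given the first `n` generations. -/
def stayDensity (Θ : Measure Offspring) (n j : ℕ) : Path → ℝ≥0∞ :=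
  (stayHeight n).indicator fun ω => survival (stepLaw Θ) j (spineHeight n ω)

lemma BoundaryCase.measurable_stayDensity (h : BoundaryCase Θ) (n j : ℕ) :
    Measurable (stayDensity Θ n j) := by
  have := h.isProbabilityMeasure_stepLaw
  exact ((measurable_survival j).comp ((measurable_spineHeight n).mono
    (canonicalFiltration.le n) le_rfl)).indicator
      (canonicalFiltration.le n _ (measurableSet_stayHeight n))

lemma BoundaryCase.stayDensity_ne_top (h : BoundaryCase Θ) (n j : ℕ) (ω : Path) :
    stayDensity Θ n j ω ≠ ∞ := by
  have := h.isProbabilityMeasure_stepLaw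
  by_cases hω : ω ∈ stayHeight n
  · rw [stayDensity, indicator_of_mem hω]
    exact survival_ne_top _ _
  · rw [stayDensity, indicator_of_notMem hω]
    exact ENNReal.zero_ne_top

/-- By the Markov property the restricted measure and the weighted measure agree on F_n. Passing
through the trimmed measures transfers this to real functions without any integrability assumption.
-/
lemma BoundaryCase.setIntegral_stayHeight (h : BoundaryCase Θ) (x : ℝ) (n j : ℕ) {Z : Path → ℝ}
    (hZ : Measurable[canonicalFiltration n] Z) :
    ∫ ω in stayHeight (n + j), Z ω ∂starLaw Θ x =
      ∫ ω, (stayDensity Θ n j ω).toReal * Z ω ∂starLaw Θ x := by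
  have hle := canonicalFiltration.le n
  have hS : MeasurableSet (stayHeight (n + j)) :=
    canonicalFiltration.le _ _ (measurableSet_stayHeight (n + j))
  have e : ((starLaw Θ x).restrict (stayHeight (n + j))).trim hle =
      ((starLaw Θ x).withDensity (stayDensity Θ n j)).trim hle := by
    refine @Measure.ext _ (canonicalFiltration n) _ _ fun A hA => ?_
    have hA' := hle A hA
    have hAZ : Measurable[canonicalFiltration n] (A.indicator (1 : Path → ℝ≥0∞)) :=
      Measurable.indicator measurable_const hA
    have key := h.lintegral_starLaw_survival x n j hAZ
    rw [trim_measurableSet_eq hle hA, trim_measurableSet_eq hle hA, withDensity_apply _ hA',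
      Measure.restrict_apply hA', ← lintegral_indicator_one (hA'.inter hS),
      ← lintegral_indicator hA']
    convert key using 2
    · ext ω
      rw [← inter_indicator_mul]
      simp [Pi.one_def]
    · ext ω
      by_cases hω : ω ∈ A <;> simp [hω, stayDensity]
  rw [integral_trim hle hZ.stronglyMeasurable, e, ← integral_trim hle hZ.stronglyMeasurable,
    integral_withDensity_eq_integral_toReal_smul (h.measurable_stayDensity n j)
      (ae_of_all _ fun ω => (h.stayDensity_ne_top n j ω).lt_top)]
  rfl

lemma BoundaryCase.ae_spineHeight_zero (h : BoundaryCase Θ) (x : ℝ) :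
    ∀ᵐ ω ∂starLaw Θ x, spineHeight 0 ω = x := by
  have hm : MeasurableSet {ω : Path | spineHeight 0 ω = x} :=
    ((measurable_spineHeight 0).mono (canonicalFiltration.le 0) le_rfl) (measurableSet_singleton x)
  refine (ae_map_iff (measurable_pathOf x).aemeasurable hm).2 ?_
  filter_upwards [h.ae_input_ne_top] with a ha
  rw [spineHeight_pathOf x ha, height_zero]

lemma BoundaryCase.starLaw_stayHeight (h : BoundaryCase Θ) {x : ℝ} (hx : 0 ≤ x) (n : ℕ) :
    starLaw Θ x (stayHeight n) = survival (stepLaw Θ) n x := by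
  have := isProbabilityMeasure_starLaw Θ h x
  have e := h.lintegral_starLaw_survival x 0 n (Z := fun _ => 1) measurable_const
  simp only [one_mul, zero_add] at e
  rw [lintegral_indicator_one (canonicalFiltration.le n _ (measurableSet_stayHeight n))] at e
  rw [e]
  calc _ = ∫⁻ _, survival (stepLaw Θ) n x ∂starLaw Θ x := by
        refine lintegral_congr_ae ?_
        filter_upwards [h.ae_spineHeight_zero x] with ω hω
        rw [indicator_of_mem, hω]
        intro k hk
        rw [Nat.le_zero.1 hk, hω]
        exact hx
    _ = _ := by simp

end PlusLaw

end SpinalBRW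

namespace SpinalBRW

/-! ### Bounded convergence in measure. -/

section BoundedConvergence

variable {Ω : Type*} [MeasurableSpace Ω] {μ : Measure Ω} {Y : ℕ → Ω → ℝ} {Y' : Ω → ℝ} {C : ℝ}

lemma ae_abs_le_of_tendstoInMeasure (hC : ∀ n, ∀ᵐ ω ∂μ, |Y n ω| ≤ C)
    (h : TendstoInMeasure μ Y atTop Y') : ∀ᵐ ω ∂μ, |Y' ω| ≤ C := by
  obtain ⟨ns, -, hns⟩ := h.exists_seq_tendsto_ae
  filter_upwards [ae_all_iff.2 hC, hns] with ω h1 h2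
  exact le_of_tendsto h2.abs (Eventually.of_forall fun i => h1 _)

/-- Uniformly bounded sequences that converge in measure converge in mean. -/
lemma tendsto_integral_abs_sub_of_tendstoInMeasure [IsFiniteMeasure μ] (hY : ∀ n, Measurable (Y n))
    (hY' : Measurable Y') (hC : ∀ n, ∀ᵐ ω ∂μ, |Y n ω| ≤ C) (h : TendstoInMeasure μ Y atTop Y') :
    Tendsto (fun n => ∫ ω, |Y n ω - Y' ω| ∂μ) atTop (𝓝 0) := by
  -- Every subsequence has a further one converging almost everywhere, to which dominated
  -- convergence applies.
  refine tendsto_of_subseq_tendsto fun ns hns => ?_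
  obtain ⟨ms, -, hms⟩ := (h.comp hns).exists_seq_tendsto_ae
  refine ⟨ms, ?_⟩
  rw [← integral_zero Ω ℝ (μ := μ)]
  refine tendsto_integral_of_dominated_convergence (fun _ => C + C)
    (fun n => ((hY _).sub hY').norm.aestronglyMeasurable) (integrable_const _) (fun n => ?_) ?_
  · filter_upwards [hC (ns (ms n)), ae_abs_le_of_tendstoInMeasure hC h] with ω h1 h2
    rw [Real.norm_eq_abs, abs_abs]
    exact (abs_sub _ _).trans (add_le_add h1 h2)
  · filter_upwards [hms] with ω hω
    simpa using (hω.sub_const (Y' ω)).abs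

end BoundedConvergence

/-! ### Conditioning on long survival and the limit theorem. -/

section Conditioning

open Set

variable {Θ : Measure Offspring} [IsProbabilityMeasure Θ]

lemma BoundaryCase.integral_cond_stayNonneg (h : BoundaryCase Θ) {x : ℝ} (hx : 0 ≤ x) (n : ℕ)
    (Z : Path → ℝ) :
    ∫ ω, Z ω ∂(cond (starLaw Θ x) (stayNonneg n)) =
      (∫ ω in stayHeight n, Z ω ∂starLaw Θ x) / (survival (stepLaw Θ) n x).toReal := by
  have e : (stayNonneg n : Set Path) =ᵐ[starLaw Θ x] stayHeight n :=
    (h.ae_mem_stayNonneg_iff x).mono fun ω hω => propext (hω n)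
  rw [ProbabilityTheory.cond, measure_congr e, Measure.restrict_congr_set e, integral_smul_measure,
    h.starLaw_stayHeight hx, ENNReal.toReal_inv, smul_eq_mul, inv_mul_eq_div]

/-- Domination of the conditional densities by the density of `P⁺_x`. -/
lemma BoundaryCase.exists_stayDensity_le (h : BoundaryCase Θ) {x : ℝ} (hx : 0 ≤ x) (q : ℕ) :
    ∃ K : ℝ, 0 ≤ K ∧ ∀ n j : ℕ, n ≤ q * (j + 1) → ∀ ω,
      (stayDensity Θ n j ω).toReal / (survival (stepLaw Θ) (n + j) x).toReal ≤
        K * (plusDensity Θ x n ω).toReal := by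
  have := h.isProbabilityMeasure_stepLaw
  obtain ⟨C, hC⟩ := h.centeredLaw.exists_survival_div_le q
  have hR : 0 < (renewal Θ x).toReal := by
    rw [h.renewal_eq]
    exact zero_lt_one.trans_le (h.centeredLaw.one_le_renewalFn hx)
  refine ⟨|C| * (renewal Θ x).toReal, by positivity, fun n j hnj ω => ?_⟩
  by_cases hω : ω ∈ stayHeight n
  · rw [stayDensity, plusDensity, indicator_of_mem hω, indicator_of_mem hω, ENNReal.toReal_div,
      mul_assoc, mul_div_cancel₀ _ hR.ne', h.renewal_eq]
    refine (hC n j hnj x _ hx (hω n le_rfl)).trans ?_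
    gcongr
    exact le_abs_self C
  · simp [stayDensity, plusDensity, hω]

lemma BoundaryCase.tendsto_stayDensity (h : BoundaryCase Θ) {x : ℝ} (hx : 0 ≤ x) (n : ℕ)
    (ω : Path) :
    Tendsto (fun j => (stayDensity Θ n j ω).toReal / (survival (stepLaw Θ) (n + j) x).toReal) atTop
      (𝓝 (plusDensity Θ x n ω).toReal) := by
  have := h.isProbabilityMeasure_stepLaw
  by_cases hω : ω ∈ stayHeight n
  · simp only [stayDensity, plusDensity, indicator_of_mem hω, ENNReal.toReal_div, h.renewal_eq]
    exact h.centeredLaw.tendsto_survival_ratio n hx (hω n le_rfl)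
  · simp [stayDensity, plusDensity, hω]

/-- The conditional expectation given survival up to time `m`. -/
noncomputable def stayMean (Θ : Measure Offspring) (x : ℝ) (m : ℕ) (Z : Path → ℝ) : ℝ :=
  (∫ ω in stayHeight m, Z ω ∂starLaw Θ x) / (survival (stepLaw Θ) m x).toReal

lemma BoundaryCase.stayMean_eq (h : BoundaryCase Θ) (x : ℝ) (n j : ℕ) {Z : Path → ℝ}
    (hZ : Measurable[canonicalFiltration n] Z) :
    stayMean Θ x (n + j) Z = ∫ ω, (stayDensity Θ n j ω).toReal /
      (survival (stepLaw Θ) (n + j) x).toReal * Z ω ∂starLaw Θ x := by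
  rw [stayMean, h.setIntegral_stayHeight x n j hZ, ← integral_div]
  exact integral_congr_ae (ae_of_all _ fun ω => by ring)

lemma integrable_of_ae_abs_le {μ : Measure Path} [IsFiniteMeasure μ] {Z : Path → ℝ}
    (hZ : Measurable Z) {C : ℝ} (hC : ∀ᵐ ω ∂μ, |Z ω| ≤ C) : Integrable Z μ :=
  Integrable.of_bound hZ.aestronglyMeasurable C hC

lemma IsPlusLaw.integrable_plusDensity_mul (h : BoundaryCase Θ) {x : ℝ} {P : Measure Path}
    (hP : IsPlusLaw Θ x P) (n : ℕ) {Z : Path → ℝ} (hZ : Measurable Z)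
    {C : ℝ} (hC : ∀ᵐ ω ∂starLaw Θ x, |Z ω| ≤ C) :
    Integrable (fun ω => (plusDensity Θ x n ω).toReal * Z ω) (starLaw Θ x) :=
  (hP.integrable_plusDensity h n).mul_bdd hZ.aestronglyMeasurable hC

/-- Conditioning a fixed generation on survival for a long time gives the law `P⁺_x`. -/
lemma IsPlusLaw.tendsto_stayMean (h : BoundaryCase Θ) {x : ℝ} (hx : 0 ≤ x) {P : Measure Path}
    (hP : IsPlusLaw Θ x P) {n : ℕ} {Z : Path → ℝ} (hZ : Measurable[canonicalFiltration n] Z)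
    {C : ℝ} (hC : ∀ᵐ ω ∂starLaw Θ x, |Z ω| ≤ C) :
    Tendsto (fun m => stayMean Θ x m Z) atTop (𝓝 (∫ ω, Z ω ∂P)) := by
  -- Taking the proportion `q = n` makes the domination valid for every `j`, since n ≤ n(j + 1).
  obtain ⟨K, hK0, hK⟩ := h.exists_stayDensity_le hx n
  have hmZ : Measurable Z := hZ.mono (canonicalFiltration.le n) le_rfl
  rw [← tendsto_add_atTop_iff_nat n, hP.integral_eq h hx hZ]
  simp only [add_comm _ n, h.stayMean_eq x n _ hZ]
  refine tendsto_integral_of_dominated_convergence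
    (fun ω => K * ((plusDensity Θ x n ω).toReal * |Z ω|))
    (fun j => (((h.measurable_stayDensity n j).ennreal_toReal.div_const _).mul
      hmZ).aestronglyMeasurable)
    ((hP.integrable_plusDensity_mul h n hmZ.norm (C := C) (by simpa using hC)).const_mul K)
    (fun j => ae_of_all _ fun ω => ?_)
    (ae_of_all _ fun ω => (h.tendsto_stayDensity hx n ω).mul_const _)
  rw [norm_mul, Real.norm_of_nonneg (by positivity), ← mul_assoc, Real.norm_eq_abs]
  exact mul_le_mul_of_nonneg_right
    (hK n j (by rw [mul_add, mul_one]; exact Nat.le_add_left _ _) ω) (abs_nonneg _)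

/-- Conditional expectations of the first `n` generations are dominated by expectations under
`P⁺_x` if the conditioning goes beyond time `n` by a fixed proportion. -/
lemma IsPlusLaw.exists_abs_stayMean_le (h : BoundaryCase Θ) {x : ℝ} (hx : 0 ≤ x)
    {P : Measure Path} (hP : IsPlusLaw Θ x P) (q : ℕ) :
    ∃ K : ℝ, 0 ≤ K ∧ ∀ n j : ℕ, n ≤ q * (j + 1) → ∀ Z : Path → ℝ,
      Measurable[canonicalFiltration n] Z → (∃ C : ℝ, ∀ᵐ ω ∂starLaw Θ x, |Z ω| ≤ C) →
        |stayMean Θ x (n + j) Z| ≤ K * ∫ ω, |Z ω| ∂P := by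
  obtain ⟨K, hK0, hK⟩ := h.exists_stayDensity_le hx q
  refine ⟨K, hK0, fun n j hnj Z hZ ⟨C, hC⟩ => ?_⟩
  have hmZ : Measurable Z := hZ.mono (canonicalFiltration.le n) le_rfl
  have hZa : Measurable[canonicalFiltration n] fun ω => |Z ω| :=
    continuous_abs.measurable.comp hZ
  rw [h.stayMean_eq x n j hZ, hP.integral_eq h hx hZa, ← integral_const_mul, ← Real.norm_eq_abs]
  refine norm_integral_le_of_norm_le
    ((hP.integrable_plusDensity_mul h n hmZ.norm (C := C) (by simpa using hC)).const_mul K)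
    (ae_of_all _ fun ω => ?_)
  rw [norm_mul, Real.norm_of_nonneg (by positivity), ← mul_assoc, Real.norm_eq_abs]
  exact mul_le_mul_of_nonneg_right (hK n j hnj ω) (abs_nonneg _)

lemma BoundaryCase.stayMean_sub (h : BoundaryCase Θ) (x : ℝ) (m : ℕ) {Z Z' : Path → ℝ}
    (hZ : Measurable Z) (hZ' : Measurable Z') {C : ℝ} (hC : ∀ᵐ ω ∂starLaw Θ x, |Z ω| ≤ C)
    (hC' : ∀ᵐ ω ∂starLaw Θ x, |Z' ω| ≤ C) :
    stayMean Θ x m (fun ω => Z ω - Z' ω) = stayMean Θ x m Z - stayMean Θ x m Z' := by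
  have := isProbabilityMeasure_starLaw Θ h x
  rw [stayMean, stayMean, stayMean, ← sub_div, integral_sub
    (integrable_of_ae_abs_le hZ hC).integrableOn (integrable_of_ae_abs_le hZ' hC').integrableOn]

lemma stayHeight_antitone : Antitone stayHeight :=
  fun _ _ hmn _ hω k hk => hω k (hk.trans hmn)

/-- The effect of prolonging the conditioning. -/
lemma BoundaryCase.abs_stayMean_sub_le (h : BoundaryCase Θ) {x : ℝ} (hx : 0 ≤ x) {n m : ℕ}
    (hnm : n ≤ m) {Z : Path → ℝ} (hZ : Measurable Z) {C : ℝ}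
    (hC : ∀ᵐ ω ∂starLaw Θ x, |Z ω| ≤ C) :
    |stayMean Θ x n Z - stayMean Θ x m Z| ≤
      2 * C * (1 - (survival (stepLaw Θ) m x).toReal / (survival (stepLaw Θ) n x).toReal) := by
  have := isProbabilityMeasure_starLaw Θ h x
  have := h.isProbabilityMeasure_stepLaw
  have hS : ∀ k, MeasurableSet (stayHeight k) := fun k =>
    canonicalFiltration.le k _ (measurableSet_stayHeight k)
  have hZi := integrable_of_ae_abs_le hZ hC
  have hreal : ∀ k, (starLaw Θ x).real (stayHeight k) = (survival (stepLaw Θ) k x).toReal :=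
    fun k => by rw [Measure.real, h.starLaw_stayHeight hx]
  have hsub := stayHeight_antitone hnm
  have hint : ∫ ω in stayHeight n \ stayHeight m, Z ω ∂starLaw Θ x =
      (∫ ω in stayHeight n, Z ω ∂starLaw Θ x) - ∫ ω in stayHeight m, Z ω ∂starLaw Θ x :=
    setIntegral_sdiff (hS m) hZi.integrableOn hsub
  have b1 : |∫ ω in stayHeight n \ stayHeight m, Z ω ∂starLaw Θ x| ≤
      C * ((survival (stepLaw Θ) n x).toReal - (survival (stepLaw Θ) m x).toReal) := by
    rw [← hreal, ← hreal, ← measureReal_sdiff hsub (hS m)]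
    exact norm_setIntegral_le_of_norm_le_const_ae' (f := Z) (C := C) (measure_lt_top _ _)
      (hC.mono fun ω hω _ => hω)
  have b2 : |∫ ω in stayHeight m, Z ω ∂starLaw Θ x| ≤ C * (survival (stepLaw Θ) m x).toReal := by
    rw [← hreal]
    exact norm_setIntegral_le_of_norm_le_const_ae' (f := Z) (C := C) (measure_lt_top _ _)
      (hC.mono fun ω hω _ => hω)
  rw [hint] at b1
  have pn := h.centeredLaw.survival_pos n hx
  have pm := h.centeredLaw.survival_pos m hx
  have pnm := toReal_survival_antitone (F := stepLaw Θ) x hnm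
  simp only at pnm
  rw [stayMean, stayMean]
  generalize (survival (stepLaw Θ) n x).toReal = p at *
  generalize (survival (stepLaw Θ) m x).toReal = r at *
  generalize ∫ ω in stayHeight n, Z ω ∂starLaw Θ x = a at *
  generalize ∫ ω in stayHeight m, Z ω ∂starLaw Θ x = b at *
  -- The first term is the contribution of paths that die between `n` and `m`, the second the change
  -- of normalization; each is at most C(1 - r/p).
  have e : a / p - b / r = (a - b) / p - b * ((p - r) / (r * p)) := by field_simp; ring
  rw [e]
  calc _ ≤ |(a - b) / p| + |b * ((p - r) / (r * p))| := abs_sub _ _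
    _ = |a - b| / p + |b| * ((p - r) / (r * p)) := by
        rw [abs_div, abs_mul, abs_of_pos pn,
          abs_of_nonneg (div_nonneg (sub_nonneg.2 pnm) (by positivity))]
    _ ≤ C * (p - r) / p + C * r * ((p - r) / (r * p)) :=
        add_le_add (div_le_div_of_nonneg_right b1 pn.le)
          (mul_le_mul_of_nonneg_right b2 (div_nonneg (sub_nonneg.2 pnm) (by positivity)))
    _ = 2 * C * (1 - r / p) := by field_simp; ring

/-- Conditional expectations given survival converge to expectations under `P⁺_x`. -/
theorem IsPlusLaw.tendsto_stayMean_of_tendstoInMeasure (h : BoundaryCase Θ) {x : ℝ} (hx : 0 ≤ x)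
    {P : Measure Path} (hP : IsPlusLaw Θ x P) {Y : ℕ → Path → ℝ} {Y' : Path → ℝ}
    (hY : Adapted canonicalFiltration Y) {C : ℝ} (hC : ∀ n, ∀ᵐ ω ∂starLaw Θ x, |Y n ω| ≤ C)
    (hY' : Measurable Y') (hlim : TendstoInMeasure P Y atTop Y') :
    Tendsto (fun n => stayMean Θ x n (Y n)) atTop (𝓝 (∫ ω, Y' ω ∂P)) := by
  have := hP.isProbabilityMeasure
  have := isProbabilityMeasure_starLaw Θ h x
  have := h.isProbabilityMeasure_stepLaw
  have hmY : ∀ n, Measurable (Y n) := fun n => (hY n).mono (canonicalFiltration.le n) le_rfl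
  have hC0 : 0 ≤ C := by
    obtain ⟨ω, hω⟩ := (hC 0).exists
    exact (abs_nonneg _).trans hω
  have hCP : ∀ n, ∀ᵐ ω ∂P, |Y n ω| ≤ C := fun n =>
    hP.ae_of_ae h (A := {ω | |Y n ω| ≤ C})
      ((continuous_abs.measurable.comp (hY n)) measurableSet_Iic) (hC n)
  have hint : ∀ n, Integrable (Y n) P := fun n => integrable_of_ae_abs_le (hmY n) (hCP n)
  have hint' : Integrable Y' P :=
    integrable_of_ae_abs_le hY' (ae_abs_le_of_tendstoInMeasure hCP hlim)
  have hL1 := tendsto_integral_abs_sub_of_tendstoInMeasure hmY hY' hCP hlim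
  have hd : ∀ n, Integrable (fun ω => |Y n ω - Y' ω|) P := fun n => ((hint n).sub hint').abs
  rw [Metric.tendsto_atTop]
  intro ε hε
  -- The order of choices matters: `q` fixes the cost of prolonging the conditioning, then the
  -- domination constant `K` depends on `q`, and only then is the generation `k` chosen according to
  -- `K`.
  obtain ⟨q, hq, hslow⟩ := h.centeredLaw.exists_survival_slow hx
    (δ := ε / (8 * (C + 1))) (by positivity)
  obtain ⟨K, hK0, hK⟩ := hP.exists_abs_stayMean_le h hx q
  obtain ⟨k, hk⟩ := eventually_atTop.1
    (hL1.eventually_lt_const (show 0 < ε / (8 * (K + 1)) by positivity))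
  have hfix := Metric.tendsto_atTop.1 (hP.tendsto_stayMean h hx (hY k) (hC k)) (ε / 4)
    (by positivity)
  obtain ⟨N₁, hN₁⟩ := hfix
  obtain ⟨N₂, hN₂⟩ := eventually_atTop.1 hslow
  refine ⟨max k (max N₁ N₂), fun n hn => ?_⟩
  have hkn : k ≤ n := (le_max_left _ _).trans hn
  have hn₁ : N₁ ≤ n := (le_max_left _ _).trans ((le_max_right _ _).trans hn)
  have hn₂ : N₂ ≤ n := (le_max_right _ _).trans ((le_max_right _ _).trans hn)
  have c1 : |stayMean Θ x n (Y n) - stayMean Θ x (n + n / q) (Y n)| ≤ ε / 4 := by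
    refine (h.abs_stayMean_sub_le hx (Nat.le_add_right n (n / q)) (hmY n) (hC n)).trans ?_
    have pn := h.centeredLaw.survival_pos n hx
    have b : 1 - (survival (stepLaw Θ) (n + n / q) x).toReal / (survival (stepLaw Θ) n x).toReal ≤
        ε / (8 * (C + 1)) := by
      rw [sub_le_comm, le_div_iff₀ pn]
      exact hN₂ n hn₂
    calc _ ≤ 2 * C * (ε / (8 * (C + 1))) := mul_le_mul_of_nonneg_left b (by positivity)
      _ = ε / 4 * (C / (C + 1)) := by field_simp; ring
      _ ≤ ε / 4 * 1 := by gcongr; rw [div_le_one (by positivity)]; linarith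
      _ = ε / 4 := mul_one _
  have c2 : |stayMean Θ x (n + n / q) (Y n) - stayMean Θ x (n + n / q) (Y k)| ≤ ε / 4 := by
    rw [← h.stayMean_sub x _ (hmY n) (hmY k) (hC n) (hC k)]
    have hYk : Measurable[canonicalFiltration n] (Y k) :=
      (hY k).mono (canonicalFiltration.mono hkn) le_rfl
    -- Integer division leaves n < q(n/q + 1), which is the room needed for the domination.
    refine (hK n (n / q) (Nat.lt_mul_div_succ n hq).le _ (Measurable.sub (hY n) hYk)
      ⟨C + C, ?_⟩).trans ?_
    · filter_upwards [hC n, hC k] with ω h1 h2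
      exact (abs_sub _ _).trans (add_le_add h1 h2)
    have b : ∫ ω, |Y n ω - Y k ω| ∂P ≤ ε / (8 * (K + 1)) + ε / (8 * (K + 1)) := by
      calc _ ≤ ∫ ω, (|Y n ω - Y' ω| + |Y k ω - Y' ω|) ∂P := by
            refine integral_mono ((hint n).sub (hint k)).abs ((hd n).add (hd k)) fun ω => ?_
            rw [abs_sub_comm (Y k ω)]
            exact abs_sub_le _ _ _
        _ = _ := integral_add (hd n) (hd k)
        _ ≤ _ := add_le_add (hk n hkn).le (hk k le_rfl).le
    calc _ ≤ K * (ε / (8 * (K + 1)) + ε / (8 * (K + 1))) := mul_le_mul_of_nonneg_left b hK0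
      _ = ε / 4 * (K / (K + 1)) := by field_simp; ring
      _ ≤ ε / 4 * 1 := by gcongr; rw [div_le_one (by positivity)]; linarith
      _ = ε / 4 := mul_one _
  have c3 : |stayMean Θ x (n + n / q) (Y k) - ∫ ω, Y k ω ∂P| < ε / 4 :=
    hN₁ _ (hn₁.trans (Nat.le_add_right _ _))
  have c4 : |(∫ ω, Y k ω ∂P) - ∫ ω, Y' ω ∂P| ≤ ε / 8 := by
    rw [← integral_sub (hint k) hint']
    refine (abs_integral_le_integral_abs).trans ((hk k le_rfl).le.trans ?_)
    gcongr
    linarith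
  rw [Real.dist_eq]
  calc _ ≤ |stayMean Θ x n (Y n) - stayMean Θ x (n + n / q) (Y n)| +
        (|stayMean Θ x (n + n / q) (Y n) - stayMean Θ x (n + n / q) (Y k)| +
        (|stayMean Θ x (n + n / q) (Y k) - ∫ ω, Y k ω ∂P| +
          |(∫ ω, Y k ω ∂P) - ∫ ω, Y' ω ∂P|)) :=
        (abs_sub_le _ _ _).trans (add_le_add le_rfl ((abs_sub_le _ _ _).trans
          (add_le_add le_rfl (abs_sub_le _ _ _))))
    _ < ε := by linarith

end Conditioning

end SpinalBRW

theorem mainTheorem5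
    (Θ : Measure SpinalBRW.Offspring) [IsProbabilityMeasure Θ]
    (hΘ : SpinalBRW.BoundaryCase Θ) (x : ℝ) (hx : 0 ≤ x) :
    (∃! P : Measure SpinalBRW.Path, SpinalBRW.IsPlusLaw Θ x P) ∧
    ∀ Pplus : Measure SpinalBRW.Path, SpinalBRW.IsPlusLaw Θ x Pplus →
      ∀ (Y : ℕ → SpinalBRW.Path → ℝ) (Yinf : SpinalBRW.Path → ℝ),
        Adapted SpinalBRW.canonicalFiltration Y →
        (∃ C : ℝ, ∀ n, ∀ᵐ ω ∂(SpinalBRW.starLaw Θ x), |Y n ω| ≤ C) →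
        Measurable Yinf →
        TendstoInMeasure Pplus Y atTop Yinf →
        Tendsto
          (fun n => ∫ ω, Y n ω ∂(cond (SpinalBRW.starLaw Θ x) (SpinalBRW.stayNonneg n)))
          atTop (𝓝 (∫ ω, Yinf ω ∂Pplus)) := by
  obtain ⟨P, hP⟩ := hΘ.exists_isPlusLaw hx
  refine ⟨⟨P, hP, fun P' hP' => hP'.unique hP⟩, ?_⟩
  rintro P' hP' Y Yinf hY ⟨C, hC⟩ hYinf hlim
  simp only [hΘ.integral_cond_stayNonneg hx]
  exact hP'.tendsto_stayMean_of_tendstoInMeasure hΘ hx hY hC hYinf hlim
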